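/- Fix $\lambda>0$. Consider single-server queues in tandem at sites $1,2,\dots$, with queue lengths $Q=(Q_1,Q_2,\dots)$ in $\bar{\mathbb Z}_+^{\{1,2,\dots\}}$, where $\bar{\mathbb Z}_+=\{0,1,2,\dots\}\cup\{\infty\}$ has its usual compact topology (with $\infty\pm1=\infty$) and the product carries the product topology. Let the arrival process at site $1$ be Poisson of rate $\lambda$ and let every site $n$ have a service clock $\Pi_n$ that is Poisson of rate $1$; all these processes are independent of each other and of the initial state. At a point of the arrival process $Q_1$ increases by one. At a point $\tau$ of $\Pi_n$ one customer moves from site $n$ to site $n+1$ if $Q_n(\tau-)>Q_{n+1}(\tau-)$, and nothing happens otherwise. This defines the infinite system $Q(\cdot)$. The system $Q^{(N)}(\cdot)$ with $N\ge1$ sites is defined in the same way, except that a customer who would enter site $N+1$ leaves the system, $Q^{(N)}_n\equiv0$ for $n>N$, and all queues are finite. Write $Q\le Q'$ for the componentwise order, and $Q\preceq Q'$ if $\sum_nQ_n<\infty$, $\sum_nQ'_n<\infty$ and $\sum_{k\ge n}Q_k\le\sum_{k\ge n}Q'_k$ for all $n$. For distributions, $\mu\le_{\mathrm{st}}\mu'$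 means $\mu(U)\le\mu'(U)$ for every measurable set $U$ that is increasing for $\le$. A distribution is called stationary for one of these systems if it is a probability distribution on its state space such that the process started from it has this distribution at all times. Let the infinite system and all finite systems start with all queues empty. Then: (i) All the processes can be coupled so that, almost surely, for all $t\ge0$, $$Q^{(1)}(t)\le Q^{(2)}(t)\le\dots\le Q^{(N)}(t)\le\dots\le Q(t),$$ $$Q^{(1)}(t)\preceq Q^{(2)}(t)\preceq\dots\preceq Q^{(N)}(t)\preceq\dots\preceq Q(t).$$ (ii) The distributions of $Q(t)$ are stochastically non-decreasing in $t$, and those of $Q^{(N)}(t)$ are stochastically non-decreasing in both $t$ and $N$ (with $Q$ as the case $N=\infty$). (iii) There is a probability distribution on $\bar{\mathbb Z}_+^{\{1,2,\dots\}}$, that of a random element denoted $Q(\infty)$, such that $Q(t)\Rightarrow Q(\infty)$ as $t\to\infty$. If moreover $\lambda<1$, then for each $N\ge1$ the system with $N$ sites has exactly one stationary distribution, that of a random element denoted $Q^{(N)}(\infty)$; $Q^{(N)}(t)\Rightarrow Q^{(N)}(\infty)$ as $t\to\infty$; $Q^{(N)}(\infty)$ is stochastically non-decreasing in $N$; and $Q^{(N)}(\infty)\Rightarrow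 Q(\infty)$ as $N\to\infty$. (iv) The distribution of $Q(\infty)$ is a stationary distribution of the infinite system, and it is the lower invariant measure: it is $\le_{\mathrm{st}}$ every stationary distribution of the infinite system. (v) Almost surely $Q_n(t)+1\ge\sup_{k>n}Q_k(t)$ for all $n\ge1$ and all $t\ge0$; and almost surely $Q_n(\infty)+1\ge\sup_{k>n}Q_k(\infty)$ for all $n\ge1$. -/

import Mathlib

open MeasureTheory ProbabilityTheory Filter Topology
open scoped NNReal

universe u

/-- A configuration of queues in tandem: `q i` is the length, possibly infinite, of the queue at
site number `i + 1`. The space carries the product of the usual (compact, metrizable) topologies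
of `ℕ∞`, the product σ-algebra and the componentwise order. -/
abbrev QueueState : Type := ℕ → ℕ∞

/-- The σ-algebra that Mathlib puts on `ℕ∞` is the Borel σ-algebra. -/
instance instBorelSpaceENat : BorelSpace ℕ∞ where
  measurable_eq := by
    refine le_antisymm (fun s _ => ?_) le_top
    letI : MeasurableSpace ℕ∞ := borel ℕ∞
    haveI : BorelSpace ℕ∞ := ⟨rfl⟩
    exact (Set.to_countable s).measurableSet

/-- The clocks that drive the system: `none` is the clock of the exogenous arrivals at the first
site, `some i` is the service clock of the site number `i + 1`. -/
abbrev Clock : Type := Option ℕ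

/-- The configuration right after a tick of the given clock in the system with `N` sites under the
back-pressure rule, if `q` is the configuration right before; `N = ⊤` is the infinite system.
On an arrival the first queue grows by one. When the service clock of a site ticks, a customer
moves to the next site if the queue at the site is larger than the queue at the next one, and
nothing happens otherwise; a customer who would enter the site number `N + 1` leaves the system.
Note that `⊤ - 1 = ⊤` and `⊤ + 1 = ⊤` in `ℕ∞`. -/
def afterTick (N : ℕ∞) : Clock → QueueState → QueueState
  | none, q => fun k => if k = 0 then q 0 + 1 else q k
  | some i, q =>
      if q (i + 1) < q i then
        fun k =>
          if k = i then q i - 1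
          else if k = i + 1 ∧ ((i + 1 : ℕ) : ℕ∞) < N then q (i + 1) + 1
          else q k
      else q

/-- The state space of the system with `N` sites. If `N` is finite, these are the configurations
with finite queues, which are empty beyond the site number `N`; the queues of the infinite system
may be infinite. -/
def stateSpace (N : ℕ∞) : Set QueueState :=
  {q | N ≠ ⊤ → ∀ i : ℕ, q i ≠ ⊤ ∧ (N ≤ (i : ℕ∞) → q i = 0)}

/-- `A` is (the counting process of) a Poisson process of rate `r` on `[0, ∞)`. -/
structure IsPoissonProcess {Ω : Type*} [MeasurableSpace Ω] (r : ℝ≥0) (P : Measure Ω)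
    (A : ℝ≥0 → Ω → ℕ) : Prop where
  measurable : ∀ t, Measurable (A t)
  paths : ∀ᵐ ω ∂P, A 0 ω = 0 ∧ Monotone (fun t => A t ω) ∧
    ∀ t, ∀ᶠ s in 𝓝[>] t, A s ω = A t ω
  indep_increments : HasIndepIncrements A P
  law_increment : ∀ s t, s ≤ t →
    P.map (fun ω => A t ω - A s ω) = poissonMeasure (r * (t - s))

/-- The driving clocks: independent Poisson processes, of rate `lam` for the arrivals and of
rate `1` for every service clock. -/
structure IsDrivingNoise {Ω : Type*} [MeasurableSpace Ω] (lam : ℝ≥0) (P : Measure Ω)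
    (clk : Clock → ℝ≥0 → Ω → ℕ) : Prop where
  arrivals : IsPoissonProcess lam P (clk none)
  services : ∀ i : ℕ, IsPoissonProcess 1 P (clk (some i))
  indep : iIndepFun (fun (e : Clock) (ω : Ω) (t : ℝ≥0) => clk e t ω) P

/-- A clock with counting path `a` ticks at time `t`: `t > 0` is a jump of `a`. -/
def TicksAt (a : ℝ≥0 → ℕ) (t : ℝ≥0) : Prop :=
  0 < t ∧ ∀ s, s < t → a s < a t

/-- The path `q` of the system with `N` sites follows the clocks with counting paths `a`: every
queue length is a right-continuous step function of time, at a tick of a clock the configuration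
changes from its left limit according to the back-pressure rule, and it does not change at any
other time. (Almost surely no two clocks tick simultaneously.) -/
structure FollowsClocks (N : ℕ∞) (a : Clock → ℝ≥0 → ℕ) (q : ℝ≥0 → QueueState) : Prop where
  right_cont : ∀ t k, ∀ᶠ s in 𝓝[>] t, q s k = q t k
  at_tick : ∀ e t, TicksAt (a e) t → ∀ k, ∀ᶠ s in 𝓝[<] t, q t k = afterTick N e (q s) k
  no_tick : ∀ t, (∀ e, ¬ TicksAt (a e) t) → ∀ k, ∀ᶠ s in 𝓝[<] t, q t k = q s k

/-- `Q` is a version, on the probability space `(Ω, P)`, of the queue length process of the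
back-pressure system with `N` sites (`N = ⊤`: infinitely many sites) and arrival rate `lam`: it
starts in the state space, and it follows driving clocks that are independent of its initial
configuration. -/
structure IsBackPressureProcess {Ω : Type*} [MeasurableSpace Ω] (lam : ℝ≥0) (N : ℕ∞)
    (P : Measure Ω) (Q : ℝ≥0 → Ω → QueueState) : Prop where
  measurable : ∀ t, Measurable (Q t)
  init : ∀ᵐ ω ∂P, Q 0 ω ∈ stateSpace N
  dynamics : ∃ clk : Clock → ℝ≥0 → Ω → ℕ,
    IsDrivingNoise lam P clk ∧
    IndepFun (Q 0) (fun (ω : Ω) (e : Clock) (t : ℝ≥0) => clk e t ω) P ∧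
    ∀ᵐ ω ∂P, FollowsClocks N (fun e t => clk e t ω) (fun t => Q t ω)

/-- A version of the queue length process that starts with all queues empty. -/
def IsBackPressureFromZero {Ω : Type*} [MeasurableSpace Ω] (lam : ℝ≥0) (N : ℕ∞)
    (P : Measure Ω) (Q : ℝ≥0 → Ω → QueueState) : Prop :=
  IsBackPressureProcess lam N P Q ∧ ∀ᵐ ω ∂P, Q 0 ω = 0

/-- `μ` is a stationary distribution of the system with `N` sites: the process started from `μ`
has distribution `μ` at all times. -/
def IsStationaryDistribution (lam : ℝ≥0) (N : ℕ∞) (μ : Measure QueueState) : Prop :=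
  ∃ (Ω : Type) (_ : MeasurableSpace Ω) (P : Measure Ω) (Q : ℝ≥0 → Ω → QueueState),
    IsProbabilityMeasure P ∧ IsBackPressureProcess lam N P Q ∧ ∀ t, P.map (Q t) = μ

/-- The order `⪯`: both configurations have finitely many customers in total, and all tail sums
are ordered. -/
def TailLE (q q' : QueueState) : Prop :=
  ∑' k, q k ≠ ⊤ ∧ ∑' k, q' k ≠ ⊤ ∧ ∀ n : ℕ, ∑' k, q (n + k) ≤ ∑' k, q' (n + k)

/-- Stochastic order of distributions on the configurations, with respect to the componentwise
order: every increasing event is at most as probable under `μ` as under `μ'`. -/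
def StochLE (μ μ' : Measure QueueState) : Prop :=
  ∀ U : Set QueueState, MeasurableSet U → IsUpperSet U → μ U ≤ μ' U

/-- No queue is longer than a queue upstream of it by more than one: `q n + 1 ≥ sup_{k > n} q k`
for every `n`. -/
def BoundedTail (q : QueueState) : Prop :=
  ∀ n : ℕ, ⨆ k, ⨆ (_ : n < k), q k ≤ q n + 1

/-! Order. When a service clock ticks, the serving queue `x` and the next queue `y` become `min x
(max y (x - 1))` and `max y (min x (y + 1))`. Both are monotone in `(x, y)`, and letting customers
out at the end of a shorter line only lowers the configuration. So every tick preserves the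
componentwise order and the order in the number of sites, and systems that share their clocks and
start empty stay ordered. The order of the tail sums follows, the totals being bounded by the number
of arrivals.

Infinitely many clocks. In the infinite system there is no first tick. But almost surely, for every
`T`, there are service clocks arbitrarily far out that are silent up to `T`. The sites up to a
silent one evolve autonomously, driven by finitely many ticks. Existence, uniqueness, comparison and
the bound on the downstream queues are therefore proved by induction along time on such finite
blocks (`FollowsClocks.pair_induction`).

Laws. The claims concern arbitrary versions of the process, so their laws are computed from the
clocks. On a time grid the clocks give independent bits, and expectations are powers of a product of
operators. As the mesh vanishes these powers tend to the exponential of the generator of finitely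
many clocks. The probability that a long block of sites has no silent clock decays geometrically,
uniformly in the configuration and in `N`. This gives a Feller semigroup `queueSemigroup` on the
compact space of configurations that preserves monotone functions and increases with `N`;
`IsBackPressureProcess.integral_eq` ties every version to it.

Limits. The empty configuration is the least one, so the semigroup at `0` is non-decreasing in time
on monotone observables. These observables determine the law and the stochastic order, so
compactness gives a limit law. It is invariant, it lies below every stationary law, and the limits
in `t` and `N` commute, being suprema of a monotone double family.

Finite systems, `lam < 1`. The sum of squares of the queues has negative drift, which bounds
averages of expected queue lengths along the jump chain; by monotonicity from `0` each capped
expectation obeys the bound, so no mass escapes to infinity. Any two stationary laws coincide: what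
remains of each above their infimum would be invariant and nonzero, hence would charge the empty
configuration, which is reachable from everywhere, and the infimum could be enlarged there
(`eq_of_stepMeasure_eq`). -/

/-! ### The service rule: order, locality, continuity, conservation -/

theorem ENat.ite_lt_sub_one_eq (x y : ℕ∞) :
    (if y < x then x - 1 else x) = min x (max y (x - 1)) := by
  split_ifs with h
  · have h1 : y ≤ x - 1 := ENat.le_sub_one_of_lt h
    rw [max_eq_right h1, min_eq_right tsub_le_self]
  · exact (min_eq_left ((not_lt.1 h).trans (le_max_left _ _))).symm

theorem ENat.ite_lt_add_one_eq (x y : ℕ∞) :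
    (if y < x then y + 1 else y) = max y (min x (y + 1)) := by
  split_ifs with h
  · rw [min_eq_right (Order.add_one_le_of_lt h), max_eq_right le_self_add]
  · exact (max_eq_left ((min_le_left _ _).trans (not_lt.1 h))).symm

theorem afterTick_none_apply (N : ℕ∞) (q : QueueState) (k : ℕ) :
    afterTick N none q k = if k = 0 then q k + 1 else q k := by
  by_cases h : k = 0 <;> simp [afterTick, h]

/-- In this lattice form the rule is a composition of maps that are monotone and continuous on `ℕ∞`;
the case distinction on `q (i + 1) < q i` hides both properties. -/
theorem afterTick_some_apply (N : ℕ∞) (i : ℕ) (q : QueueState) (k : ℕ) :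
    afterTick N (some i) q k =
      if k = i then min (q i) (max (q (i + 1)) (q i - 1))
      else if k = i + 1 ∧ ((i + 1 : ℕ) : ℕ∞) < N then
        max (q (i + 1)) (min (q i) (q (i + 1) + 1))
      else q k := by
  rw [← ENat.ite_lt_sub_one_eq, ← ENat.ite_lt_add_one_eq]
  unfold afterTick
  by_cases hlt : q (i + 1) < q i
  · simp only [hlt, if_true]
  · simp only [hlt, if_false]
    split_ifs with h1 h2
    · rw [h1]
    · rw [h2.1]
    · rfl

/-- The service rule is monotone in the configuration and in the number of sites. -/
theorem afterTick_le_afterTick {M N : ℕ∞} (hMN : M ≤ N) (e : Clock) {q q' : QueueState} {m : ℕ}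
    (he : ∀ j, e = some j → j < m) (hq : ∀ k ≤ m, q k ≤ q' k) :
    ∀ k ≤ m, afterTick M e q k ≤ afterTick N e q' k := by
  intro k hk
  rcases e with _ | i
  · simp only [afterTick_none_apply]
    split_ifs
    · gcongr; exact hq k hk
    · exact hq k hk
  · have hi := he i rfl
    have h1 := hq i hi.le
    have h2 := hq (i + 1) hi
    simp only [afterTick_some_apply]
    by_cases hki : k = i
    · simp only [hki, if_true]; gcongr
    simp only [hki, if_false]
    by_cases hk1 : k = i + 1
    · by_cases hM : ((i + 1 : ℕ) : ℕ∞) < M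
      · simp only [hk1, hM, hM.trans_le hMN, and_self, if_true]; gcongr
      -- In the smaller system the customer leaves here; in the larger one the queue can only gain.
      · simp only [hM, and_false, if_false]
        split_ifs
        · exact (hq k hk).trans (by rw [hk1]; exact le_max_left _ _)
        · exact hq k hk
    · simp only [hk1, false_and, if_false]; exact hq k hk

theorem monotone_afterTick (N : ℕ∞) (e : Clock) : Monotone (afterTick N e) := by
  intro q q' h k
  rcases e with _ | i
  · exact afterTick_le_afterTick le_rfl none (m := k) (by simp) (fun k _ => h k) k le_rfl
  · exact afterTick_le_afterTick le_rfl (some i) (m := max (i + 1) k) (by simp) (fun k _ => h k) k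
      (le_max_right _ _)

theorem afterTick_mono_sites {M N : ℕ∞} (hMN : M ≤ N) (e : Clock) (q : QueueState) :
    afterTick M e q ≤ afterTick N e q := by
  intro k
  rcases e with _ | i
  · exact afterTick_le_afterTick hMN none (m := k) (by simp) (fun k _ => le_rfl) k le_rfl
  · exact afterTick_le_afterTick hMN (some i) (m := max (i + 1) k) (by simp) (fun k _ => le_rfl) k
      (le_max_right _ _)

theorem afterTick_congr (N : ℕ∞) (e : Clock) {q q' : QueueState} {m : ℕ}
    (he : ∀ j, e = some j → j < m) (hq : ∀ k ≤ m, q k = q' k) :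
    ∀ k ≤ m, afterTick N e q k = afterTick N e q' k := fun k hk =>
  le_antisymm (afterTick_le_afterTick le_rfl e he (fun k hk => (hq k hk).le) k hk)
    (afterTick_le_afterTick le_rfl e he (fun k hk => (hq k hk).ge) k hk)

theorem afterTick_of_lt (N : ℕ∞) {i m : ℕ} (hi : m < i) (q : QueueState) :
    ∀ k ≤ m, afterTick N (some i) q k = q k := by
  intro k hk
  rw [afterTick_some_apply, if_neg (by omega), if_neg (by omega)]

/-- The only delicate point is `x ↦ x - 1` at `⊤`, where it is continuous because the subtrahend is
finite. Continuity at infinite queues is what makes the semigroup Feller on a compact space. -/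
theorem continuous_afterTick (N : ℕ∞) (e : Clock) : Continuous (afterTick N e) := by
  have hsub : Continuous fun x : ℕ∞ => x - 1 := by
    refine continuous_iff_continuousAt.2 fun x => ?_
    exact Filter.Tendsto.enatSub tendsto_id tendsto_const_nhds (Or.inr (by simp))
  refine continuous_pi fun k => ?_
  rcases e with _ | i
  · simp only [afterTick_none_apply]
    split_ifs <;> fun_prop
  · simp only [afterTick_some_apply]
    split_ifs
    · exact (continuous_apply i).min ((continuous_apply _).max (hsub.comp (continuous_apply i)))
    · exact (continuous_apply _).max ((continuous_apply i).min (by fun_prop))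
    · fun_prop

/-- The bound `q k ≤ q n + 1`, `n < k`, on the first sites is preserved by the service rule. -/
theorem afterTick_bounded (N : ℕ∞) (e : Clock) {q : QueueState} {m : ℕ}
    (he : ∀ j, e = some j → j < m) (hq : ∀ k ≤ m, ∀ n < k, q k ≤ q n + 1) :
    ∀ k ≤ m, ∀ n < k, afterTick N e q k ≤ afterTick N e q n + 1 := by
  intro k hk n hn
  rcases e with _ | i
  · simp only [afterTick_none_apply, show k ≠ 0 by omega, if_false]
    split_ifs
    · exact (hq k hk n hn).trans (by gcongr; exact le_self_add)
    · exact hq k hk n hn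
  · have hi := he i rfl
    unfold afterTick
    dsimp only
    by_cases hlt : q (i + 1) < q i
    · simp only [hlt, if_true]
      have hs : q i ≤ (q i - 1) + 1 := le_tsub_add
      have h1 : q (i + 1) + 1 ≤ q i := Order.add_one_le_of_lt hlt
      -- A departure from `n = i` is harmless: queue `i` was strictly longer than queue `i + 1`, and
      -- the latter plus one bounds everything further downstream.
      have hle : q k ≤ (if n = i then q i - 1 else q n) + 1 := by
        split_ifs with h
        · refine le_trans ?_ hs
          rcases eq_or_ne k (i + 1) with rfl | hk1
          · exact hlt.le
          · exact (hq k hk (i + 1) (by omega)).trans h1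
        · exact hq k hk n hn
      have hle1 : k = i + 1 → q (i + 1) + 1 ≤ (if n = i then q i - 1 else q n) + 1 := by
        intro hki
        split_ifs with h
        · exact h1.trans hs
        · exact h1.trans (hq i (by omega) n (by omega))
      -- A customer received by the upstream queue `n` only enlarges the right side.
      have hR : (if n = i then q i - 1 else q n) + 1 ≤
          (if n = i then q i - 1 else if n = i + 1 ∧ ((i + 1 : ℕ) : ℕ∞) < N then q (i + 1) + 1
            else q n) + 1 := by
        split_ifs with h h'
        · exact le_rfl
        · rw [h'.1]; gcongr; exact le_self_add
        · exact le_rfl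
      refine le_trans ?_ hR
      by_cases hki : k = i
      · rw [if_pos hki]
        subst hki
        exact tsub_le_self.trans hle
      · rw [if_neg hki]
        by_cases h : k = i + 1 ∧ ((i + 1 : ℕ) : ℕ∞) < N
        · rw [if_pos h]; exact hle1 h.1
        · rw [if_neg h]; exact hle
    · simp only [hlt, if_false]; exact hq k hk n hn

theorem sum_afterTick_none_le (N : ℕ∞) (q : QueueState) (m : ℕ) :
    ∑ k ∈ Finset.range (m + 1), afterTick N none q k = (∑ k ∈ Finset.range (m + 1), q k) + 1 := by
  simp only [Finset.sum_range_succ', afterTick_none_apply]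
  simp [add_assoc]

/-- Since `i < m`, the window contains both ends of the move: the sum is conserved, or drops by one
if the customer leaves the system. -/
theorem sum_afterTick_some_le (N : ℕ∞) {i m : ℕ} (hi : i < m) (q : QueueState) :
    ∑ k ∈ Finset.range (m + 1), afterTick N (some i) q k ≤ ∑ k ∈ Finset.range (m + 1), q k := by
  have split : ∀ f : ℕ → ℕ∞, ∑ k ∈ Finset.range (m + 1), f k =
      f i + (f (i + 1) + ∑ k ∈ ((Finset.range (m + 1)).erase i).erase (i + 1), f k) := by
    intro f
    rw [Finset.add_sum_erase _ _ (by simp; omega), Finset.add_sum_erase _ _ (by simp; omega)]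
  rw [split, split q]
  have hrest : ∑ k ∈ ((Finset.range (m + 1)).erase i).erase (i + 1), afterTick N (some i) q k =
      ∑ k ∈ ((Finset.range (m + 1)).erase i).erase (i + 1), q k := by
    refine Finset.sum_congr rfl fun k hk => ?_
    simp only [Finset.mem_erase, ne_eq] at hk
    rw [afterTick_some_apply, if_neg hk.2.1, if_neg (by tauto)]
  rw [hrest, ← add_assoc, ← add_assoc]
  gcongr ?_ + _
  unfold afterTick
  by_cases h : q (i + 1) < q i
  · have h0 : (1 : ℕ∞) ≤ q i := by
      refine le_trans ?_ (Order.add_one_le_of_lt h); simp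
    have h2 : (q i - 1) + (q (i + 1) + 1) = q i + q (i + 1) := by
      rw [add_comm (q (i + 1)), ← add_assoc, tsub_add_cancel_of_le h0]
    simp only [h, if_true, if_neg (Nat.succ_ne_self i), true_and]
    split_ifs
    · exact h2.le
    · exact le_trans (by gcongr; exact le_self_add) h2.le
  · simp only [h, if_false, le_refl]

theorem afterTick_mem_stateSpace {N : ℕ∞} (hN : 1 ≤ N) (e : Clock) {q : QueueState}
    (hq : q ∈ stateSpace N) : afterTick N e q ∈ stateSpace N := by
  intro hNt i
  have h := hq hNt
  rcases e with _ | j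
  · rw [afterTick_none_apply]
    split_ifs with hi
    · subst hi
      refine ⟨by simpa using (h 0).1, fun h0 => absurd (hN.trans h0) (by simp)⟩
    · exact h i
  · rw [afterTick_some_apply]
    split_ifs with h1 h2
    · subst h1
      refine ⟨fun ht => (h i).1 (top_le_iff.1 (ht ▸ min_le_left _ _)), fun hi => ?_⟩
      rw [(h i).2 hi]; simp
    · obtain ⟨rfl, h2⟩ := h2
      refine ⟨?_, fun hi => absurd h2 (not_lt.2 hi)⟩
      have h3 := (h (j + 1)).1
      have : max (q (j + 1)) (min (q j) (q (j + 1) + 1)) ≤ q (j + 1) + 1 :=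
        max_le le_self_add (min_le_right _ _)
      exact ne_top_of_le_ne_top (by simpa using h3) this
    · exact h i

theorem afterTick_of_le {N : ℕ∞} (hN : N ≠ ⊤) {i : ℕ} (hi : N ≤ i) {q : QueueState}
    (hq : q ∈ stateSpace N) : afterTick N (some i) q = q := by
  have : q i = 0 := (hq hN i).2 hi
  simp [afterTick, this]

theorem zero_mem_stateSpace (N : ℕ∞) : (0 : QueueState) ∈ stateSpace N :=
  fun _ i => ⟨by simp, fun _ => rfl⟩

/-! ### Counting paths and their ticks -/

/-- Induction along an interval of `ℝ≥0`. -/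
theorem NNReal.interval_induction {R : ℝ≥0 → Prop} {S T : ℝ≥0} (h0 : R S)
    (hr : ∀ t, S ≤ t → t < T → R t → ∀ᶠ s in 𝓝[>] t, R s)
    (hl : ∀ t, S < t → t ≤ T → (∀ s, S ≤ s → s < t → R s) → R t) :
    ∀ t, S ≤ t → t ≤ T → R t := by
  by_contra! hcon
  obtain ⟨t₁, hS₁, hT₁, hR₁⟩ := hcon
  let B : Set ℝ≥0 := {t | S ≤ t ∧ ¬ R t}
  have hB : B.Nonempty := ⟨t₁, hS₁, hR₁⟩
  have hbdd : BddBelow B := OrderBot.bddBelow _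
  -- At the infimum of the failure times the relation holds by `hl`, and `hr` carries it beyond, a
  -- contradiction.
  let τ := sInf B
  have hSτ : S ≤ τ := le_csInf hB fun x hx => hx.1
  have hτT : τ ≤ t₁ := csInf_le hbdd ⟨hS₁, hR₁⟩
  have hbelow : ∀ s, S ≤ s → s < τ → R s := fun s hs hsτ => by
    by_contra h
    exact absurd (csInf_le hbdd ⟨hs, h⟩) (not_le.2 hsτ)
  have hRτ : R τ := by
    rcases hSτ.eq_or_lt with h | h
    · rw [← h]; exact h0
    · exact hl τ h (hτT.trans hT₁) hbelow
  have hlt : τ < t₁ := lt_of_le_of_ne hτT fun h => hR₁ (h ▸ hRτ)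
  obtain ⟨u, hu, hRu⟩ := (mem_nhdsGT_iff_exists_Ioo_subset' (a := τ) hlt).1
    (hr τ hSτ (hlt.trans_le hT₁) hRτ)
  obtain ⟨x, hx, hxu⟩ := exists_lt_of_csInf_lt hB (show sInf B < u from hu)
  have hτx : τ ≤ x := csInf_le hbdd hx
  rcases hτx.eq_or_lt with h | h
  · exact hx.2 (h ▸ hRτ)
  · exact hx.2 (hRu ⟨h, hxu⟩)

theorem eventually_Ico_nhdsLT {t S : ℝ≥0} (h : S < t) : ∀ᶠ s in 𝓝[<] t, S ≤ s ∧ s < t :=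
  mem_of_superset (Ioo_mem_nhdsLT h) fun _ hs => ⟨hs.1.le, hs.2⟩

theorem nhdsLT_neBot_of_lt {t S : ℝ≥0} (h : S < t) : (𝓝[<] t).NeBot :=
  nhdsLT_neBot_of_exists_lt ⟨S, h⟩

section CountingPath

variable {a : ℝ≥0 → ℕ}

theorem eventually_eq_of_not_ticksAt (ha : Monotone a) {t : ℝ≥0} (h : ¬ TicksAt a t) :
    ∀ᶠ s in 𝓝[<] t, a s = a t := by
  by_cases ht : 0 < t
  · obtain ⟨u, hut, hu⟩ : ∃ u < t, a t ≤ a u := by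
      by_contra! hcon
      exact h ⟨ht, hcon⟩
    filter_upwards [eventually_Ico_nhdsLT hut] with s hs
    exact le_antisymm (ha hs.2.le) (hu.trans (ha hs.1))
  · obtain rfl : t = 0 := by simpa using ht
    simp

theorem exists_eventually_eq_nhdsLT (ha : Monotone a) {t : ℝ≥0} (ht : 0 < t) :
    ∃ s₀ < t, ∀ s, s₀ ≤ s → s < t → a s = a s₀ := by
  have hbdd : BddAbove (a '' Set.Iio t) := ⟨a t, by rintro _ ⟨s, hs, rfl⟩; exact ha (le_of_lt hs)⟩
  obtain ⟨s₀, hs₀, hmax⟩ := Nat.sSup_mem (s := a '' Set.Iio t) ⟨a 0, 0, ht, rfl⟩ hbdd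
  refine ⟨s₀, hs₀, fun s h1 h2 => le_antisymm ?_ (ha h1)⟩
  rw [hmax]
  exact le_csSup hbdd ⟨s, h2, rfl⟩

theorem eq_of_no_tick (ha : Monotone a) (hrc : ∀ t, ∀ᶠ s in 𝓝[>] t, a s = a t) {S T : ℝ≥0}
    (hST : S ≤ T) (h : ∀ t, S < t → t ≤ T → ¬ TicksAt a t) : a T = a S := by
  refine NNReal.interval_induction (R := fun t => a t = a S) rfl ?_ ?_ T hST le_rfl
  · intro t _ _ ht
    filter_upwards [hrc t] with s hs using hs.trans ht
  · intro t hSt htT ih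
    have := nhdsLT_neBot_of_lt hSt
    obtain ⟨s, hs1, hs2⟩ := ((eventually_eq_of_not_ticksAt ha (h t hSt htT)).and
      (eventually_Ico_nhdsLT hSt)).exists
    exact hs1.symm.trans (ih s hs2.1 hs2.2)

/-- This links ticks, a property of the path, to increments, whose law is prescribed. -/
theorem ne_iff_exists_tick (ha : Monotone a) (hrc : ∀ t, ∀ᶠ s in 𝓝[>] t, a s = a t) {S T : ℝ≥0}
    (hST : S ≤ T) : a T ≠ a S ↔ ∃ t, S < t ∧ t ≤ T ∧ TicksAt a t := by
  constructor
  · intro h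
    by_contra! hcon
    exact h (eq_of_no_tick ha hrc hST hcon)
  · rintro ⟨t, h1, h2, ht⟩
    exact ((ht.2 S h1).trans_le (ha h2)).ne'

/-- A counting path is injective on its tick times and is bounded by `a T` on those up to `T`. -/
theorem finite_ticks (ha : Monotone a) (T : ℝ≥0) : {t | t ≤ T ∧ TicksAt a t}.Finite := by
  refine Set.Finite.of_finite_image (f := a) ((Set.finite_Iic (a T)).subset ?_) ?_
  · rintro _ ⟨t, ht, rfl⟩; exact ha ht.1
  · intro s hs t ht hst
    by_contra hne
    rcases lt_or_gt_of_ne hne with h | h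
    · exact (ht.2.2 s h).ne hst
    · exact (hs.2.2 t h).ne' hst

end CountingPath

/-! ### Truncated clocks and good realizations -/

/-- Only the clock of the arrivals and the clocks `some j`, `j < m`. -/
def Clock.Below (m : ℕ) (e : Clock) : Prop := ∀ j, e = some j → j < m

theorem Clock.below_none (m : ℕ) : Clock.Below m none := by simp [Clock.Below]

theorem Clock.below_some {m j : ℕ} : Clock.Below m (some j) ↔ j < m := by
  simp [Clock.Below]

theorem Clock.Below.mono {m n : ℕ} (h : m ≤ n) {e : Clock} (he : Clock.Below m e) :
    Clock.Below n e := fun j hj => (he j hj).trans_le h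

theorem Clock.finite_below (m : ℕ) : {e | Clock.Below m e}.Finite := by
  refine ((Set.finite_singleton none).union ((Set.finite_Iio m).image some)).subset ?_
  rintro (_ | j) h
  · simp
  · exact Or.inr ⟨j, h j rfl, rfl⟩

theorem Clock.eq_or_gt_of_not_below {m : ℕ} {e : Clock} (h : ¬ Clock.Below m e) :
    ∃ j, e = some j ∧ m ≤ j := by
  unfold Clock.Below at h
  push Not at h
  exact h

open Classical in
/-- The clocks with all the service clocks `some j`, `m ≤ j`, switched off. -/
noncomputable def truncateClocks (m : ℕ) (a : Clock → ℝ≥0 → ℕ) : Clock → ℝ≥0 → ℕ :=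
  fun e t => if Clock.Below m e then a e t else 0

theorem truncateClocks_of_below {m : ℕ} {e : Clock} (he : Clock.Below m e)
    (a : Clock → ℝ≥0 → ℕ) : truncateClocks m a e = a e := by
  funext t; simp [truncateClocks, he]

theorem truncateClocks_of_not_below {m : ℕ} {e : Clock} (he : ¬ Clock.Below m e)
    (a : Clock → ℝ≥0 → ℕ) : truncateClocks m a e = fun _ => 0 := by
  funext t; simp [truncateClocks, he]

theorem not_ticksAt_zero (t : ℝ≥0) : ¬ TicksAt (fun _ => 0) t := fun h => (h.2 0 h.1).ne rfl

theorem below_of_ticksAt_truncateClocks {m : ℕ} {a : Clock → ℝ≥0 → ℕ} {e : Clock} {t : ℝ≥0}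
    (h : TicksAt (truncateClocks m a e) t) : Clock.Below m e := by
  by_contra he
  rw [truncateClocks_of_not_below he] at h
  exact not_ticksAt_zero t h

/-- Realizations of the driving clocks for which the queues are well defined. -/
structure GoodClocks (a : Clock → ℝ≥0 → ℕ) : Prop where
  zero : ∀ e, a e 0 = 0
  mono : ∀ e, Monotone (a e)
  right_cont : ∀ e t, ∀ᶠ s in 𝓝[>] t, a e s = a e t
  simple : ∀ e e' t, TicksAt (a e) t → TicksAt (a e') t → e = e'
  silent : ∀ T K, ∃ i, K ≤ i ∧ a (some i) T = 0

namespace GoodClocks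

variable {a : Clock → ℝ≥0 → ℕ} (ha : GoodClocks a)
include ha

theorem not_ticksAt {e : Clock} {T t : ℝ≥0} (h : a e T = 0) (ht : t ≤ T) : ¬ TicksAt (a e) t := by
  intro hk
  have h1 := hk.2 0 hk.1
  have h2 := ha.mono e ht
  omega

protected theorem truncate (m : ℕ) : GoodClocks (truncateClocks m a) := by
  have hcase : ∀ e, truncateClocks m a e = a e ∨ truncateClocks m a e = fun _ => 0 := fun e => by
    by_cases he : Clock.Below m e
    · exact Or.inl (truncateClocks_of_below he a)
    · exact Or.inr (truncateClocks_of_not_below he a)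
  constructor
  · intro e; rcases hcase e with h | h <;> rw [h]; exact ha.zero e
  · intro e; rcases hcase e with h | h <;> rw [h]; exacts [ha.mono e, monotone_const]
  · intro e t; rcases hcase e with h | h <;> rw [h]; exacts [ha.right_cont e t, by simp]
  · intro e e' t h h'
    rw [truncateClocks_of_below (below_of_ticksAt_truncateClocks h)] at h
    rw [truncateClocks_of_below (below_of_ticksAt_truncateClocks h')] at h'
    exact ha.simple e e' t h h'
  · intro T K
    obtain ⟨i, hi, hT⟩ := ha.silent T K
    exact ⟨i, hi, by rcases hcase (some i) with h | h <;> rw [h]; exact hT⟩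

end GoodClocks

/-! ### Induction along paths: uniqueness, comparison, invariants -/

section Paths

variable {N M : ℕ∞} {a a' : Clock → ℝ≥0 → ℕ} {q q' : ℝ≥0 → QueueState}

theorem FollowsClocks.eventually_right (h : FollowsClocks N a q) (t : ℝ≥0) (m : ℕ) :
    ∀ᶠ s in 𝓝[>] t, ∀ k ≤ m, q s k = q t k := by
  have := (Set.finite_Iic m).eventually_all (l := 𝓝[>] t) (p := fun k s => q s k = q t k)
  exact this.2 fun k _ => h.right_cont t k

theorem FollowsClocks.eventually_at_tick (h : FollowsClocks N a q) {e : Clock} {t : ℝ≥0}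
    (ht : TicksAt (a e) t) (m : ℕ) :
    ∀ᶠ s in 𝓝[<] t, ∀ k ≤ m, q t k = afterTick N e (q s) k := by
  have := (Set.finite_Iic m).eventually_all (l := 𝓝[<] t)
    (p := fun k s => q t k = afterTick N e (q s) k)
  exact this.2 fun k _ => h.at_tick e t ht k

/-- A tick may still occur at `t`, but only at a site beyond `m`, and such a service does not touch
the sites up to `m`. -/
theorem FollowsClocks.eventually_no_tick (h : FollowsClocks N a q) {t : ℝ≥0} {m : ℕ}
    (ht : ∀ e, Clock.Below (m + 1) e → ¬ TicksAt (a e) t) :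
    ∀ᶠ s in 𝓝[<] t, ∀ k ≤ m, q t k = q s k := by
  have := (Set.finite_Iic m).eventually_all (l := 𝓝[<] t) (p := fun k s => q t k = q s k)
  refine this.2 fun k hk => ?_
  by_cases h' : ∀ e, ¬ TicksAt (a e) t
  · exact h.no_tick t h' k
  · push Not at h'
    obtain ⟨e, he⟩ := h'
    obtain ⟨j, rfl, hj⟩ := Clock.eq_or_gt_of_not_below (fun hb => ht e hb he)
    filter_upwards [h.at_tick _ t he k] with s hs
    rw [hs, afterTick_of_lt N (show m < j by omega) (q s) k hk]

theorem not_ticks_below_succ {m : ℕ} {t : ℝ≥0} (hm : ¬ TicksAt (a (some m)) t)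
    (h : ∀ e, Clock.Below m e → ¬ TicksAt (a e) t) :
    ∀ e, Clock.Below (m + 1) e → ¬ TicksAt (a e) t := by
  rintro (_ | j) he
  · exact h _ (Clock.below_none m)
  · rcases Nat.lt_succ_iff_lt_or_eq.1 (Clock.below_some.1 he) with hj | rfl
    · exact h _ (Clock.below_some.2 hj)
    · exact hm

/-- As long as the clock of a site is silent, a relation between two paths that depends on the
sites up to that one only and is preserved by every tick of the clocks holds at all times. -/
theorem FollowsClocks.pair_induction (hq : FollowsClocks N a q) (hq' : FollowsClocks M a' q')
    {m : ℕ} {T : ℝ≥0} (hsame : ∀ e, Clock.Below m e → ∀ t ≤ T, TicksAt (a e) t ↔ TicksAt (a' e) t)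
    (hm : ∀ t ≤ T, ¬ TicksAt (a (some m)) t) (hm' : ∀ t ≤ T, ¬ TicksAt (a' (some m)) t)
    (R : ℝ≥0 → QueueState → QueueState → Prop)
    (hloc : ∀ s t x x' y y', s ≤ t → (∀ k ≤ m, y k = x k) → (∀ k ≤ m, y' k = x' k) →
      R s x x' → R t y y')
    (h0 : R 0 (q 0) (q' 0))
    (htick : ∀ e, Clock.Below m e → ∀ s t x x', s < t → t ≤ T → TicksAt (a e) t → R s x x' →
      R t (afterTick N e x) (afterTick M e x')) :
    ∀ t ≤ T, R t (q t) (q' t) := by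
  intro t htT
  refine NNReal.interval_induction (S := 0) (T := T) (R := fun t => R t (q t) (q' t)) h0 ?_ ?_ t
    zero_le htT
  · intro t _ _ ht
    filter_upwards [hq.eventually_right t m, hq'.eventually_right t m, self_mem_nhdsWithin]
      with s h1 h2 hs
    exact hloc t s _ _ _ _ (le_of_lt hs) h1 h2 ht
  · intro t ht0 htT ih
    have := nhdsLT_neBot_of_lt ht0
    by_cases hex : ∃ e, Clock.Below m e ∧ TicksAt (a e) t
    · obtain ⟨e, he, htk⟩ := hex
      obtain ⟨s, ⟨h1, h2⟩, hs⟩ := (((hq.eventually_at_tick htk m).and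
        (hq'.eventually_at_tick ((hsame e he t htT).1 htk) m)).and
          (eventually_Ico_nhdsLT ht0)).exists
      exact hloc t t _ _ _ _ le_rfl h1 h2 (htick e he s t _ _ hs.2 htT htk (ih s hs.1 hs.2))
    · push Not at hex
      obtain ⟨s, ⟨h1, h2⟩, hs⟩ := (((hq.eventually_no_tick
        (not_ticks_below_succ (hm t htT) hex)).and (hq'.eventually_no_tick
        (not_ticks_below_succ (hm' t htT) fun e he => by
          rw [← hsame e he t htT]; exact hex e he))).and (eventually_Ico_nhdsLT ht0)).exists
      exact hloc s t _ _ _ _ hs.2.le h1 h2 (ih s hs.1 hs.2)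

/-- Allowing two families of clocks that agree below `m` lets a path be compared with the paths of
truncated clocks. -/
theorem FollowsClocks.agree (hq : FollowsClocks N a q) (hq' : FollowsClocks N a' q')
    {m : ℕ} {T : ℝ≥0} (hsame : ∀ e, Clock.Below m e → ∀ t ≤ T, TicksAt (a e) t ↔ TicksAt (a' e) t)
    (hm : ∀ t ≤ T, ¬ TicksAt (a (some m)) t) (hm' : ∀ t ≤ T, ¬ TicksAt (a' (some m)) t)
    (h0 : ∀ k ≤ m, q 0 k = q' 0 k) : ∀ t ≤ T, ∀ k ≤ m, q t k = q' t k := by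
  refine hq.pair_induction hq' hsame hm hm' (fun _ x x' => ∀ k ≤ m, x k = x' k) ?_ h0 ?_
  · intro s t x x' y y' _ h1 h2 h k hk
    rw [h1 k hk, h2 k hk, h k hk]
  · intro e he s t x x' _ _ _ h
    exact afterTick_congr N e he h

theorem FollowsClocks.unique (ha : GoodClocks a) (hq : FollowsClocks N a q)
    (hq' : FollowsClocks N a q') (h0 : q 0 = q' 0) : q = q' := by
  funext t k
  obtain ⟨i, hi, hT⟩ := ha.silent t k
  exact hq.agree hq' (fun _ _ _ _ => Iff.rfl) (fun s hs => ha.not_ticksAt hT hs)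
    (fun s hs => ha.not_ticksAt hT hs) (fun k _ => by rw [h0]) t le_rfl k hi

theorem FollowsClocks.le (ha : GoodClocks a) (hMN : M ≤ N) (hq : FollowsClocks M a q)
    (hq' : FollowsClocks N a q') (h0 : q 0 ≤ q' 0) (t : ℝ≥0) : q t ≤ q' t := by
  intro k
  obtain ⟨i, hi, hT⟩ := ha.silent t k
  refine hq.pair_induction hq' (fun _ _ _ _ => Iff.rfl) (fun s hs => ha.not_ticksAt hT hs)
    (fun s hs => ha.not_ticksAt hT hs) (fun _ x x' => ∀ k ≤ i, x k ≤ x' k) ?_ (fun k _ => h0 k) ?_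
      t le_rfl k hi
  · intro s t x x' y y' _ h1 h2 h k hk
    rw [h1 k hk, h2 k hk]; exact h k hk
  · intro e he s t x x' _ _ _ h
    exact afterTick_le_afterTick hMN e he h

theorem FollowsClocks.boundedTail (ha : GoodClocks a) (hq : FollowsClocks N a q)
    (h0 : q 0 = 0) (t : ℝ≥0) : BoundedTail (q t) := by
  intro n
  refine iSup₂_le fun k hk => ?_
  obtain ⟨i, hi, hT⟩ := ha.silent t k
  refine hq.pair_induction hq (fun _ _ _ _ => Iff.rfl) (fun s hs => ha.not_ticksAt hT hs)
    (fun s hs => ha.not_ticksAt hT hs) (fun _ x _ => ∀ k ≤ i, ∀ n < k, x k ≤ x n + 1) ?_ ?_ ?_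
      t le_rfl k hi n hk
  · intro s t x x' y y' _ h1 _ h k hk n hn
    rw [h1 k hk, h1 n (by omega)]; exact h k hk n hn
  · intro k _ n _; simp [h0]
  · intro e he s t x x' _ _ _ h
    exact afterTick_bounded N e he h

/-- On a window that ends at a silent site services never increase the sum and each arrival adds one
customer. The infinite sum in `ℕ∞` is the supremum of the finite ones. -/
theorem FollowsClocks.tsum_le (ha : GoodClocks a) (hq : FollowsClocks N a q)
    (h0 : q 0 = 0) (t : ℝ≥0) : ∑' k, q t k ≤ (a none t : ℕ∞) := by
  have hfin : ∀ n, ∑ k ∈ Finset.range n, q t k ≤ (a none t : ℕ∞) := by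
    intro n
    obtain ⟨i, hi, hT⟩ := ha.silent t n
    -- The window is enlarged so that its last site is the silent one.
    refine (Finset.sum_le_sum_of_subset (Finset.range_mono (hi.trans (Nat.le_succ i)))).trans ?_
    refine hq.pair_induction hq (fun _ _ _ _ => Iff.rfl) (fun s hs => ha.not_ticksAt hT hs)
      (fun s hs => ha.not_ticksAt hT hs)
      (fun s x _ => ∑ k ∈ Finset.range (i + 1), x k ≤ (a none s : ℕ∞)) ?_ ?_ ?_ t le_rfl
    · intro s t x x' y y' hst h1 _ h
      rw [Finset.sum_congr rfl fun k hk => h1 k (by simpa [Nat.lt_succ_iff] using hk)]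
      exact h.trans (by exact_mod_cast ha.mono none hst)
    · simp [h0]
    · intro e he s t x x' hst _ htk h
      rcases e with _ | j
      · rw [sum_afterTick_none_le]
        have := htk.2 s hst
        calc _ ≤ (a none s : ℕ∞) + 1 := by gcongr
          _ ≤ _ := by exact_mod_cast this
      · exact (sum_afterTick_some_le N (Clock.below_some.1 he) x).trans
          (h.trans (by exact_mod_cast ha.mono none hst.le))
  have : HasSum (fun k => q t k) (⨆ s : Finset ℕ, ∑ k ∈ s, q t k) :=
    tendsto_atTop_iSup fun s s' h => Finset.sum_le_sum_of_subset h
  rw [this.tsum_eq]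
  refine iSup_le fun s => ?_
  obtain ⟨n, hn⟩ := s.exists_nat_subset_range
  exact (Finset.sum_le_sum_of_subset hn).trans (hfin n)

end Paths

/-! ### Construction of the paths -/

section Existence

variable {a : Clock → ℝ≥0 → ℕ}

/-- With finitely many clocks the sum `c` of their counts encodes the past: the configuration is `x
(c t)`, where `x` is defined by recursion on the value of the count. -/
theorem GoodClocks.exists_path_of_finite (ha : GoodClocks a) (N : ℕ∞) (q₀ : QueueState) {m : ℕ}
    (hfin : ∀ e t, TicksAt (a e) t → Clock.Below m e) :
    ∃ q, FollowsClocks N a q ∧ q 0 = q₀ := by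
  classical
  let E : Finset Clock := (Clock.finite_below m).toFinset
  let c : ℝ≥0 → ℕ := fun t => ∑ e ∈ E, a e t
  have hE : ∀ {e t}, TicksAt (a e) t → e ∈ E := fun h => by simpa [E] using hfin _ _ h
  have hc : Monotone c := fun s t hst => Finset.sum_le_sum fun e _ => ha.mono e hst
  have hc0 : c 0 = 0 := Finset.sum_eq_zero fun e _ => ha.zero e
  have hclt : ∀ {e t}, TicksAt (a e) t → ∀ s < t, c s < c t := fun h s hs =>
    Finset.sum_lt_sum (fun e _ => ha.mono e hs.le) ⟨_, hE h, h.2 s hs⟩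
  -- `Jump v e`: the clock `e` ticks at the moment when the total count leaves the value `v`.
  let Jump : ℕ → Clock → Prop := fun v e =>
    ∃ t, TicksAt (a e) t ∧ (∃ s < t, c s = v) ∧ ∀ s < t, c s ≤ v
  have huniq : ∀ v e e', Jump v e → Jump v e' → e = e' := by
    rintro v e e' ⟨t, h1, ⟨s, hs, hsv⟩, h3⟩ ⟨t', h1', ⟨s', hs', hsv'⟩, h3'⟩
    have key : t = t' := by
      by_contra hne
      rcases lt_or_gt_of_ne hne with h | h
      · have := hclt h1 s hs; have := h3' t h; omega
      · have := hclt h1' s' hs'; have := h3 t' h; omega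
    subst key
    exact ha.simple e e' t h1 h1'
  let x : ℕ → QueueState := fun v => Nat.rec q₀
    (fun v y => if h : ∃ e, Jump v e then afterTick N h.choose y else y) v
  have hx : ∀ v, x (v + 1) = if h : ∃ e, Jump v e then afterTick N h.choose (x v) else x v :=
    fun v => rfl
  have hx1 : ∀ v e, Jump v e → x (v + 1) = afterTick N e (x v) := by
    intro v e he
    have hex : ∃ e, Jump v e := ⟨e, he⟩
    rw [hx, dif_pos hex, huniq v _ e hex.choose_spec he]
  have hx2 : ∀ v, (∀ e, ¬ Jump v e) → x (v + 1) = x v := by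
    intro v hv
    rw [hx, dif_neg (by push Not; exact hv)]
  refine ⟨fun t => x (c t), ⟨?_, ?_, ?_⟩, by change x (c 0) = q₀; rw [hc0]; rfl⟩
  · intro t k
    have : ∀ᶠ s in 𝓝[>] t, ∀ e ∈ E, a e s = a e t :=
      (Finset.eventually_all E).2 fun e _ => ha.right_cont e t
    filter_upwards [this] with s hs
    rw [show c s = c t from Finset.sum_congr rfl hs]
  · intro e t ht k
    obtain ⟨s₀, hs₀, hconst⟩ := exists_eventually_eq_nhdsLT hc ht.1
    have hle : ∀ s < t, c s ≤ c s₀ := fun s hs => by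
      rcases le_total s₀ s with h | h
      · exact (hconst s h hs).le
      · exact hc h
    -- A tick may raise the count by more than one. The skipped values are never attained, carry no
    -- jump, and leave `x` unchanged.
    have hfinal : ∀ n, c s₀ + 1 + n ≤ c t → x (c s₀ + 1 + n) = afterTick N e (x (c s₀)) := by
      intro n
      induction n with
      | zero => intro _; exact hx1 _ e ⟨t, ht, ⟨s₀, hs₀, rfl⟩, hle⟩
      | succ n ih =>
        intro hn
        rw [← add_assoc, hx2, ih (by omega)]
        rintro e' ⟨t', h1, ⟨s, hs, hsv⟩, h3⟩
        rcases le_or_gt t' t with h | h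
        · have := hle s (hs.trans_le h); omega
        · have := h3 t h; omega
    filter_upwards [eventually_Ico_nhdsLT hs₀] with s hs
    have h1 := hclt ht s₀ hs₀
    have h2 := hfinal (c t - (c s₀ + 1)) (by omega)
    rw [show c s₀ + 1 + (c t - (c s₀ + 1)) = c t by omega] at h2
    simp only [h2, hconst s hs.1 hs.2]
  · intro t ht k
    have : ∀ᶠ s in 𝓝[<] t, ∀ e ∈ E, a e s = a e t :=
      (Finset.eventually_all E).2 fun e _ => eventually_eq_of_not_ticksAt (ha.mono e) (ht e)
    filter_upwards [this] with s hs
    rw [show c s = c t from Finset.sum_congr rfl hs]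

/-- Truncation at a level `n ≥ i` switches off only service clocks from `i` on, and the block up to
the silent site `i` does not feel these. -/
theorem GoodClocks.agree_truncate (ha : GoodClocks a) {N : ℕ∞} {b b' : Clock → ℝ≥0 → ℕ}
    {q q' : ℝ≥0 → QueueState} (hq : FollowsClocks N b q) (hq' : FollowsClocks N b' q')
    {i n n' : ℕ} {T : ℝ≥0} (hi : a (some i) T = 0) (hn : i ≤ n) (hn' : i ≤ n')
    (hb : b = a ∨ b = truncateClocks n a) (hb' : b' = a ∨ b' = truncateClocks n' a)
    (h0 : q 0 = q' 0) : ∀ t ≤ T, ∀ k ≤ i, q t k = q' t k := by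
  have key : ∀ (b : Clock → ℝ≥0 → ℕ) n, i ≤ n → (b = a ∨ b = truncateClocks n a) →
      (∀ e, Clock.Below i e → b e = a e) ∧ ∀ t ≤ T, ¬ TicksAt (b (some i)) t := by
    rintro b n hn (rfl | rfl)
    · exact ⟨fun _ _ => rfl, fun t ht => ha.not_ticksAt hi ht⟩
    · refine ⟨fun e he => truncateClocks_of_below (he.mono hn) a, fun t ht => ?_⟩
      by_cases h : Clock.Below n (some i)
      · rw [truncateClocks_of_below h]; exact ha.not_ticksAt hi ht
      · rw [truncateClocks_of_not_below h]; exact not_ticksAt_zero t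
  obtain ⟨h1, h2⟩ := key b n hn hb
  obtain ⟨h1', h2'⟩ := key b' n' hn' hb'
  exact hq.agree hq' (fun e he t _ => by rw [h1 e he, h1' e he]) h2 h2' (fun k _ => by rw [h0])

/-- Each coordinate at time `t` is read off the path truncated at a site beyond it that is silent up
to `t`; the choice of the site does not matter by `agree_truncate`. -/
theorem GoodClocks.exists_path (ha : GoodClocks a) (N : ℕ∞) (q₀ : QueueState) :
    ∃ q, FollowsClocks N a q ∧ q 0 = q₀ := by
  have hex : ∀ m, ∃ q, FollowsClocks N (truncateClocks m a) q ∧ q 0 = q₀ := fun m =>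
    (ha.truncate m).exists_path_of_finite N q₀ fun e t h => below_of_ticksAt_truncateClocks h
  choose p hp hp0 using hex
  choose I hI hI0 using ha.silent
  let q : ℝ≥0 → QueueState := fun t k => p (I t k) t k
  have hqp : ∀ {i T}, a (some i) T = 0 → ∀ t ≤ T, ∀ k ≤ i, q t k = p i t k := by
    intro i T hi t ht k hk
    have hit : a (some i) t = 0 := Nat.le_zero.1 (hi ▸ ha.mono _ ht)
    have h0 : p (I t k) 0 = p i 0 := by rw [hp0, hp0]
    rcases le_total i (I t k) with h | h
    · exact ha.agree_truncate (hp (I t k)) (hp i) hit h le_rfl (Or.inr rfl) (Or.inr rfl) h0 t le_rfl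
        k hk
    · exact ha.agree_truncate (hp (I t k)) (hp i) (hI0 t k) le_rfl h (Or.inr rfl) (Or.inr rfl) h0 t
        le_rfl k (hI t k)
  refine ⟨q, ⟨?_, ?_, ?_⟩, ?_⟩
  · intro t k
    obtain ⟨i, hi, hiT⟩ := ha.silent (t + 1) k
    filter_upwards [(hp i).right_cont t k, Ioo_mem_nhdsGT (show t < t + 1 by simp)] with s hs hs1
    rw [hqp hiT s hs1.2.le k hi, hqp hiT t (by simp) k hi, hs]
  · intro e t ht k
    obtain ⟨i, hi, hiT⟩ := ha.silent t k
    by_cases he : Clock.Below i e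
    · have htk : TicksAt (truncateClocks i a e) t := by rwa [truncateClocks_of_below he]
      filter_upwards [(hp i).at_tick e t htk k, self_mem_nhdsWithin] with s hs hst
      rw [hqp hiT t le_rfl k hi, hs]
      exact (afterTick_congr N e he (fun j hj => hqp hiT s (le_of_lt hst) j hj) k hi).symm
    · obtain ⟨j, rfl, hj⟩ := Clock.eq_or_gt_of_not_below he
      have hij : i < j := lt_of_le_of_ne hj fun h => by
        subst h; exact ha.not_ticksAt hiT le_rfl ht
      -- The ticking clock lies beyond the silent site, so by simplicity none of the clocks kept in
      -- the truncation ticks at `t`.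
      have hno : ∀ e, ¬ TicksAt (truncateClocks i a e) t := fun e he' => by
        have hb := below_of_ticksAt_truncateClocks he'
        rw [truncateClocks_of_below hb] at he'
        exact he (ha.simple e _ t he' ht ▸ hb)
      filter_upwards [(hp i).no_tick t hno k, self_mem_nhdsWithin] with s hs hst
      rw [afterTick_of_lt N hij _ k hi, hqp hiT t le_rfl k hi, hs, hqp hiT s (le_of_lt hst) k hi]
  · intro t ht k
    obtain ⟨i, hi, hiT⟩ := ha.silent t k
    have hno : ∀ e, ¬ TicksAt (truncateClocks i a e) t := fun e he' => by
      have hb := below_of_ticksAt_truncateClocks he'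
      rw [truncateClocks_of_below hb] at he'
      exact ht e he'
    filter_upwards [(hp i).no_tick t hno k, self_mem_nhdsWithin] with s hs hst
    rw [hqp hiT t le_rfl k hi, hs, hqp hiT s (le_of_lt hst) k hi]
  · funext k
    exact congrFun (hp0 _) k

open Classical in
/-- The path of the system with `N` sites that starts from `q₀` and follows the clocks `a`, if
these are good. -/
noncomputable def queuePath (N : ℕ∞) (q₀ : QueueState) (a : Clock → ℝ≥0 → ℕ) : ℝ≥0 → QueueState :=
  if ha : GoodClocks a then (ha.exists_path N q₀).choose else fun _ => q₀

theorem GoodClocks.followsClocks_queuePath (ha : GoodClocks a) (N : ℕ∞) (q₀ : QueueState) :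
    FollowsClocks N a (queuePath N q₀ a) := by
  rw [queuePath, dif_pos ha]
  exact (ha.exists_path N q₀).choose_spec.1

theorem queuePath_zero (N : ℕ∞) (q₀ : QueueState) (a : Clock → ℝ≥0 → ℕ) :
    queuePath N q₀ a 0 = q₀ := by
  rw [queuePath]
  split_ifs with ha
  · exact (ha.exists_path N q₀).choose_spec.2
  · rfl

theorem GoodClocks.eq_queuePath (ha : GoodClocks a) {N : ℕ∞} {q : ℝ≥0 → QueueState}
    (hq : FollowsClocks N a q) : q = queuePath N (q 0) a :=
  hq.unique ha (ha.followsClocks_queuePath N _) (queuePath_zero N _ a).symm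

theorem GoodClocks.queuePath_truncate_eq (ha : GoodClocks a) (N : ℕ∞) (q₀ : QueueState)
    {i n : ℕ} (hin : i ≤ n) {t : ℝ≥0} (hi : a (some i) t = 0) :
    ∀ k ≤ i, queuePath N q₀ (truncateClocks n a) t k = queuePath N q₀ a t k :=
  ha.agree_truncate ((ha.truncate n).followsClocks_queuePath N q₀)
    (ha.followsClocks_queuePath N q₀) hi hin hin (Or.inr rfl) (Or.inl rfl)
    (by rw [queuePath_zero, queuePath_zero]) t le_rfl

theorem GoodClocks.tendsto_queuePath_truncate (ha : GoodClocks a) (N : ℕ∞) (q₀ : QueueState)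
    (t : ℝ≥0) :
    Tendsto (fun n => queuePath N q₀ (truncateClocks n a) t) atTop (𝓝 (queuePath N q₀ a t)) := by
  refine tendsto_pi_nhds.2 fun k => ?_
  obtain ⟨i, hi, hit⟩ := ha.silent t k
  refine tendsto_const_nhds.congr' ?_
  filter_upwards [eventually_ge_atTop i] with n hn
  exact (ha.queuePath_truncate_eq N q₀ hn hit k hi).symm

end Existence

/-! ### Discretization of time -/

/-- The clocks `none` and `some j`, `j < m`, as a list. -/
def clockList (m : ℕ) : List Clock := none :: (List.range m).map some

theorem mem_clockList {m : ℕ} {e : Clock} : e ∈ clockList m ↔ Clock.Below m e := by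
  rcases e with _ | j <;> simp [clockList, Clock.Below]

theorem nodup_clockList (m : ℕ) : (clockList m).Nodup := by
  simp [clockList, List.nodup_range, List.nodup_map_iff (Option.some_injective ℕ)]

/-- The pairs of a time step below `n` and a clock of `clockList m`, in lexicographic order. -/
def gridList (m n : ℕ) : List (ℕ × Clock) :=
  (List.range n).flatMap fun j => (clockList m).map fun e => (j, e)

theorem gridList_succ (m n : ℕ) :
    gridList m (n + 1) = gridList m n ++ (clockList m).map fun e => (n, e) := by
  simp [gridList, List.range_succ]

theorem mem_gridList {m n : ℕ} {p : ℕ × Clock} :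
    p ∈ gridList m n ↔ p.1 < n ∧ Clock.Below m p.2 := by
  obtain ⟨j, e⟩ := p
  simp [gridList, mem_clockList]

theorem nodup_gridList (m n : ℕ) : (gridList m n).Nodup := by
  induction n with
  | zero => simp [gridList]
  | succ n ih =>
    rw [gridList_succ, List.nodup_append]
    refine ⟨ih, (nodup_clockList m).map fun e e' h => by simpa using h, ?_⟩
    rintro p hp p' hp' rfl
    have h1 := (mem_gridList.1 hp).1
    obtain ⟨e, _, rfl⟩ := List.mem_map.1 hp'
    exact lt_irrefl _ h1

/-- The clocks of the pairs in a list tick one after the other, as far as `b` tells them to. -/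
def tickFold (N : ℕ∞) (b : ℕ × Clock → Bool) (l : List (ℕ × Clock)) (q : QueueState) : QueueState :=
  l.foldl (fun q p => if b p then afterTick N p.2 q else q) q

theorem tickFold_cons (N : ℕ∞) (b : ℕ × Clock → Bool) (p : ℕ × Clock) (l : List (ℕ × Clock))
    (q : QueueState) :
    tickFold N b (p :: l) q = tickFold N b l (if b p then afterTick N p.2 q else q) := rfl

theorem tickFold_append (N : ℕ∞) (b : ℕ × Clock → Bool) (l l' : List (ℕ × Clock))
    (q : QueueState) : tickFold N b (l ++ l') q = tickFold N b l' (tickFold N b l q) :=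
  List.foldl_append

theorem tickFold_of_none (N : ℕ∞) {b : ℕ × Clock → Bool} {l : List (ℕ × Clock)}
    (h : ∀ p ∈ l, b p = false) (q : QueueState) : tickFold N b l q = q := by
  induction l generalizing q with
  | nil => rfl
  | cons p l ih =>
    rw [tickFold_cons, h p (by simp)]
    exact ih (fun p hp => h p (by simp [hp])) q

theorem tickFold_of_single (N : ℕ∞) {b : ℕ × Clock → Bool} {l : List (ℕ × Clock)} (hl : l.Nodup)
    {p : ℕ × Clock} (hp : p ∈ l) (hb : b p = true) (h : ∀ p' ∈ l, p' ≠ p → b p' = false)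
    (q : QueueState) : tickFold N b l q = afterTick N p.2 q := by
  induction l generalizing q with
  | nil => simp at hp
  | cons p' l ih =>
    obtain ⟨hp'l, hl⟩ := List.nodup_cons.1 hl
    rw [tickFold_cons]
    by_cases hpp : p' = p
    · subst hpp
      rw [hb, tickFold_of_none N fun p'' hp'' => h p'' (by simp [hp'']) fun h => hp'l (h ▸ hp'')]
      rfl
    · rw [h p' (by simp) hpp]
      exact ih hl (by simpa [Ne.symm hpp] using hp) (fun p'' hp'' => h p'' (by simp [hp''])) q

/-- Which clocks have ticked in the time steps of length `h`. -/
def gridBits (a : Clock → ℝ≥0 → ℕ) (h : ℝ≥0) (p : ℕ × Clock) : Bool :=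
  decide (a p.2 ((p.1 + 1 : ℕ) * h) - a p.2 (p.1 * h) ≠ 0)

theorem GoodClocks.gridBits_eq_true {a : Clock → ℝ≥0 → ℕ} (ha : GoodClocks a) (h : ℝ≥0)
    (p : ℕ × Clock) : gridBits a h p = true ↔
      ∃ t, p.1 * h < t ∧ t ≤ (p.1 + 1 : ℕ) * h ∧ TicksAt (a p.2) t := by
  have hle : (p.1 : ℝ≥0) * h ≤ (p.1 + 1 : ℕ) * h := by gcongr; simp
  rw [← ne_iff_exists_tick (ha.mono p.2) (ha.right_cont p.2) hle]
  have := ha.mono p.2 hle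
  simp only [gridBits, decide_eq_true_eq]
  omega

section Step

variable {N : ℕ∞} {b : Clock → ℝ≥0 → ℕ} {q : ℝ≥0 → QueueState}

theorem FollowsClocks.eq_of_no_tick (hq : FollowsClocks N b q) {S T : ℝ≥0} (hST : S ≤ T)
    (h : ∀ t, S < t → t ≤ T → ∀ e, ¬ TicksAt (b e) t) : q T = q S := by
  funext k
  refine NNReal.interval_induction (R := fun t => q t k = q S k) rfl ?_ ?_ T hST le_rfl
  · intro t _ _ ht
    filter_upwards [hq.right_cont t k] with s hs using hs.trans ht
  · intro t hSt htT ih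
    have := nhdsLT_neBot_of_lt hSt
    obtain ⟨s, hs1, hs2⟩ := ((hq.no_tick t (h t hSt htT) k).and (eventually_Ico_nhdsLT hSt)).exists
    exact hs1.trans (ih s hs2.1 hs2.2)

theorem FollowsClocks.eq_afterTick (hq : FollowsClocks N b q) {S T τ : ℝ≥0} (hSτ : S < τ)
    (hτT : τ ≤ T) {e : Clock} (he : TicksAt (b e) τ)
    (h : ∀ t, S < t → t ≤ T → ∀ e, TicksAt (b e) t → t = τ) : q T = afterTick N e (q S) := by
  rw [hq.eq_of_no_tick hτT fun t h1 h2 e htk => h1.ne' (h t (hSτ.trans h1) h2 e htk)]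
  funext k
  have := nhdsLT_neBot_of_lt hSτ
  obtain ⟨s, hs1, hs2⟩ := ((hq.at_tick e τ he k).and (eventually_Ico_nhdsLT hSτ)).exists
  rw [hs1, hq.eq_of_no_tick hs2.1 fun t h1 h2 e htk =>
    (h2.trans_lt hs2.2).ne (h t h1 (h2.trans (hs2.2.le.trans hτT)) e htk)]

/-- When all ticks in a cell fall at one time, `GoodClocks.simple` leaves at most one clock, so the
order in which a cell processes its clocks is irrelevant and the fold reproduces the path. -/
theorem FollowsClocks.tickFold_gridList (hb : GoodClocks b) (hq : FollowsClocks N b q) {m : ℕ}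
    (hm : ∀ e t, TicksAt (b e) t → Clock.Below m e) (h : ℝ≥0) (n : ℕ)
    (hsep : ∀ j < n, ∀ e e' t t', TicksAt (b e) t → TicksAt (b e') t' →
      (j : ℝ≥0) * h < t → t ≤ (j + 1 : ℕ) * h → (j : ℝ≥0) * h < t' → t' ≤ (j + 1 : ℕ) * h →
        t = t') :
    tickFold N (gridBits b h) (gridList m n) (q 0) = q (n * h) := by
  induction n with
  | zero => simp [gridList, tickFold]
  | succ n ih =>
    rw [gridList_succ, tickFold_append, ih fun j hj => hsep j (by omega)]
    have hle : (n : ℝ≥0) * h ≤ (n + 1 : ℕ) * h := by gcongr; simp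
    by_cases hex : ∃ e t, (n : ℝ≥0) * h < t ∧ t ≤ (n + 1 : ℕ) * h ∧ TicksAt (b e) t
    · obtain ⟨e, t, h1, h2, htk⟩ := hex
      have huniq : ∀ t', (n : ℝ≥0) * h < t' → t' ≤ (n + 1 : ℕ) * h → ∀ e, TicksAt (b e) t' →
          t' = t := fun t' h1' h2' e' htk' =>
        hsep n (by omega) e' e t' t htk' htk h1' h2' h1 h2
      rw [hq.eq_afterTick h1 h2 htk huniq]
      refine tickFold_of_single N ((nodup_clockList m).map fun e e' h => by simpa using h)
        (p := (n, e)) (List.mem_map.2 ⟨e, mem_clockList.2 (hm e t htk), rfl⟩)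
        ((hb.gridBits_eq_true h _).2 ⟨t, h1, h2, htk⟩) ?_ _
      intro p hp hne
      obtain ⟨e', _, rfl⟩ := List.mem_map.1 hp
      rw [← Bool.not_eq_true, hb.gridBits_eq_true]
      rintro ⟨t', h1', h2', htk'⟩
      have := huniq t' h1' h2' e' htk'
      subst this
      exact hne (by rw [hb.simple e' e t' htk' htk])
    · rw [hq.eq_of_no_tick hle fun t h1 h2 e htk => hex ⟨e, t, h1, h2, htk⟩]
      refine tickFold_of_none N ?_ _
      intro p hp
      obtain ⟨e', _, rfl⟩ := List.mem_map.1 hp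
      rw [← Bool.not_eq_true, hb.gridBits_eq_true]
      rintro ⟨t', h1', h2', htk'⟩
      exact hex ⟨e', t', h1', h2', htk'⟩

end Step

theorem tickFold_congr (N : ℕ∞) {b b' : ℕ × Clock → Bool} {l : List (ℕ × Clock)}
    (h : ∀ p ∈ l, b p = b' p) (q : QueueState) : tickFold N b l q = tickFold N b' l q := by
  induction l generalizing q with
  | nil => rfl
  | cons p l ih =>
    rw [tickFold_cons, tickFold_cons, h p (by simp)]
    exact ih (fun p hp => h p (by simp [hp])) _

/-- The queues that follow finitely many clocks are the limit of their discretizations. -/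
theorem GoodClocks.eventually_tickFold_eq {a : Clock → ℝ≥0 → ℕ} (ha : GoodClocks a) (N : ℕ∞)
    (q₀ : QueueState) (m : ℕ) (T : ℝ≥0) :
    ∀ᶠ n : ℕ in atTop, tickFold N (gridBits a (T / n)) (gridList m n) q₀ =
      queuePath N q₀ (truncateClocks m a) T := by
  let b := truncateClocks m a
  have hb : GoodClocks b := ha.truncate m
  have hm : ∀ e t, TicksAt (b e) t → Clock.Below m e := fun e t h => below_of_ticksAt_truncateClocks h
  let J : Set ℝ≥0 := {t | t ≤ T ∧ ∃ e, TicksAt (b e) t}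
  have hJ : J.Finite := by
    refine ((Clock.finite_below m).biUnion fun e _ => finite_ticks (hb.mono e) T).subset ?_
    rintro t ⟨ht, e, he⟩
    exact Set.mem_biUnion (hm e t he) ⟨ht, he⟩
  -- There are finitely many tick times up to `T`; for large `n` their gaps exceed the mesh.
  have hsep : ∀ᶠ n : ℕ in atTop, ∀ x ∈ J, ∀ y ∈ J, x < y → x + T / n < y := by
    refine (hJ.eventually_all).2 fun x _ => (hJ.eventually_all).2 fun y _ => ?_
    by_cases hxy : x < y
    · have hlim : Tendsto (fun n : ℕ => x + T / (n : ℝ≥0)) atTop (𝓝 (x + 0)) :=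
        tendsto_const_nhds.add (tendsto_const_div_atTop_nhds_zero_nat T)
      rw [add_zero] at hlim
      filter_upwards [hlim.eventually_lt_const hxy] with n hn _ using hn
    · exact Eventually.of_forall fun _ h => absurd h hxy
  filter_upwards [hsep, eventually_ge_atTop 1] with n hn hn1
  have hn0 : (n : ℝ≥0) ≠ 0 := by positivity
  have hT : (n : ℝ≥0) * (T / n) = T := mul_div_cancel₀ T hn0
  have hstep : ∀ j : ℕ, ((j + 1 : ℕ) : ℝ≥0) * (T / n) = j * (T / n) + T / n := fun j => by
    push_cast; ring
  have key : ∀ j < n, ∀ t t', t ≤ (j + 1 : ℕ) * (T / n) → t' ≤ (j + 1 : ℕ) * (T / n) →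
      (j : ℝ≥0) * (T / n) < t → (∃ e, TicksAt (b e) t) → (∃ e, TicksAt (b e) t') → ¬ t < t' := by
    intro j hj t t' h1 h1' h2 he he' hlt
    have hjT : ((j + 1 : ℕ) : ℝ≥0) * (T / n) ≤ T := by
      calc ((j + 1 : ℕ) : ℝ≥0) * (T / n) ≤ n * (T / n) := by gcongr; exact_mod_cast hj
        _ = T := hT
    have h3 := hn t ⟨h1.trans hjT, he⟩ t' ⟨h1'.trans hjT, he'⟩ hlt
    have h4 : (j : ℝ≥0) * (T / n) + T / n < t + T / n := by gcongr
    rw [hstep] at h1'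
    exact absurd (h4.trans h3) (not_lt.2 h1')
  have hmain := (hb.followsClocks_queuePath N q₀).tickFold_gridList hb hm (T / n) n ?_
  · rw [queuePath_zero, hT] at hmain
    rw [← hmain]
    refine tickFold_congr N (fun p hp => ?_) q₀
    simp only [gridBits, b, truncateClocks_of_below (mem_gridList.1 hp).2]
  · intro j hj e e' t t' he he' h1 h2 h1' h2'
    rcases lt_trichotomy t t' with h | h | h
    · exact absurd h (key j hj t t' h2 h2' h1 ⟨e, he⟩ ⟨e', he'⟩)
    · exact h
    · exact absurd h (key j hj t' t h2' h2 h1' ⟨e', he'⟩ ⟨e, he⟩)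

theorem measurable_afterTick (N : ℕ∞) (e : Clock) : Measurable (afterTick N e) :=
  (continuous_afterTick N e).measurable

/-- Ticking is not an event of the product σ-algebra on paths, as it involves uncountably many
times. A grid bit looks at two times only. -/
theorem measurable_gridBits (h : ℝ≥0) (p : ℕ × Clock) :
    Measurable fun a : Clock → ℝ≥0 → ℕ => gridBits a h p := by
  have h1 : ∀ s, Measurable fun a : Clock → ℝ≥0 → ℕ => a p.2 s := fun s =>
    (measurable_pi_apply s).comp (measurable_pi_apply p.2)
  exact (Measurable.of_discrete (f := fun x : ℕ × ℕ => decide (x.1 - x.2 ≠ 0))).comp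
    ((h1 _).prodMk (h1 _))

theorem measurable_tickFold_gridBits (N : ℕ∞) (h : ℝ≥0) (l : List (ℕ × Clock)) :
    Measurable fun x : QueueState × (Clock → ℝ≥0 → ℕ) => tickFold N (gridBits x.2 h) l x.1 := by
  induction l using List.reverseRecOn with
  | nil => exact measurable_fst
  | append_singleton l p ih =>
    simp only [tickFold_append]
    exact Measurable.ite ((measurable_gridBits h p).comp measurable_snd
      (measurableSet_singleton true)) ((measurable_afterTick N p.2).comp ih) ih

/-! ### Almost sure properties of the driving clocks -/

/-- The rate of a clock. -/
def clockRate (lam : ℝ≥0) : Clock → ℝ≥0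
  | none => lam
  | some _ => 1

/-- The probability that a Poisson clock of rate `r` ticks during a time `h`. -/
noncomputable def tickProb (r h : ℝ≥0) : ℝ := 1 - Real.exp (-(r * h))

theorem tickProb_nonneg (r h : ℝ≥0) : 0 ≤ tickProb r h := by
  have : Real.exp (-(r * h : ℝ)) ≤ 1 := Real.exp_le_one_iff.2 (by simp; positivity)
  simp only [tickProb]; linarith

theorem tickProb_lt_one (r h : ℝ≥0) : tickProb r h < 1 := by
  have := Real.exp_pos (-(r * h : ℝ))
  simp only [tickProb]; linarith

theorem tickProb_le (r h : ℝ≥0) : tickProb r h ≤ r * h := by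
  have := Real.add_one_le_exp (-(r * h : ℝ))
  simp only [tickProb]; linarith

section Noise

variable {Ω : Type*} [MeasurableSpace Ω] {P : Measure Ω} {lam : ℝ≥0}
  {clk : Clock → ℝ≥0 → Ω → ℕ}

theorem IsDrivingNoise.poisson (hc : IsDrivingNoise lam P clk) (e : Clock) :
    IsPoissonProcess (clockRate lam e) P (clk e) := by
  rcases e with _ | i
  · exact hc.arrivals
  · exact hc.services i


/-- Independence between the clocks and independence of the increments of each clock combine to
joint independence over all pairs of a cell and a clock. -/
theorem IsDrivingNoise.iIndepFun_gridBits (hc : IsDrivingNoise lam P clk) (h : ℝ≥0) :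
    iIndepFun (fun (p : ℕ × Clock) ω => gridBits (fun e t => clk e t ω) h p) P := by
  have hm : ∀ (e : Clock) (j : ℕ), Measurable fun ω =>
      clk e ((j + 1 : ℕ) * h) ω - clk e (j * h) ω := fun e j =>
    ((hc.poisson e).measurable _).sub ((hc.poisson e).measurable _)
  have h1 : iIndepFun (fun (e : Clock) ω (j : ℕ) =>
      clk e ((j + 1 : ℕ) * h) ω - clk e (j * h) ω) P :=
    hc.indep.comp (g := fun _ a (j : ℕ) => a ((j + 1 : ℕ) * h) - a (j * h)) fun e =>
      measurable_pi_lambda _ fun j => (measurable_pi_apply _).sub (measurable_pi_apply _)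
  have h2 : ∀ e : Clock, iIndepFun (fun (j : ℕ) ω =>
      clk e ((j + 1 : ℕ) * h) ω - clk e (j * h) ω) P := fun e => by
    refine (hc.poisson e).indep_increments.nat (t := fun j : ℕ => (j : ℝ≥0) * h) ?_
    intro i j hij
    dsimp only
    gcongr
  have h3 := iIndepFun_uncurry' (P := P)
    (X := fun (e : Clock) (j : ℕ) ω => clk e ((j + 1 : ℕ) * h) ω - clk e (j * h) ω) hm h1 h2
  exact (h3.precomp Prod.swap_injective).comp (fun _ x => decide (x ≠ 0)) fun _ =>
    Measurable.of_discrete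

theorem IsDrivingNoise.measurable_gridBits (hc : IsDrivingNoise lam P clk) (h : ℝ≥0)
    (p : ℕ × Clock) : Measurable fun ω => gridBits (fun e t => clk e t ω) h p :=
  (Measurable.of_discrete (f := fun x : ℕ => decide (x ≠ 0))).comp
    (((hc.poisson p.2).measurable _).sub ((hc.poisson p.2).measurable _))

variable [IsProbabilityMeasure P]

theorem IsPoissonProcess.measure_increment_ne_zero {r : ℝ≥0} {A : ℝ≥0 → Ω → ℕ}
    (hA : IsPoissonProcess r P A) {s t : ℝ≥0} (hst : s ≤ t) :
    P {ω | A t ω - A s ω ≠ 0} = ENNReal.ofReal (tickProb r (t - s)) := by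
  have hm : Measurable fun ω => A t ω - A s ω := (hA.measurable t).sub (hA.measurable s)
  have h0 : (P.map fun ω => A t ω - A s ω) {0} =
      ENNReal.ofReal (Real.exp (-(r * (t - s) : ℝ≥0))) := by
    rw [hA.law_increment s t hst, poissonMeasure_singleton]; simp
  have h1 : (P.map fun ω => A t ω - A s ω) {0}ᶜ = ENNReal.ofReal (tickProb r (t - s)) := by
    have := Measure.isProbabilityMeasure_map (μ := P) hm.aemeasurable
    rw [prob_compl_eq_one_sub (measurableSet_singleton 0), h0, tickProb,
      ENNReal.ofReal_sub _ (Real.exp_pos _).le, ENNReal.ofReal_one]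
    simp
  rw [← h1, Measure.map_apply hm (measurableSet_singleton 0).compl]
  rfl

theorem IsDrivingNoise.measure_gridBits (hc : IsDrivingNoise lam P clk) (h : ℝ≥0)
    (p : ℕ × Clock) : P {ω | gridBits (fun e t => clk e t ω) h p = true} =
      ENNReal.ofReal (tickProb (clockRate lam p.2) h) := by
  have hle : (p.1 : ℝ≥0) * h ≤ (p.1 + 1 : ℕ) * h := by gcongr; simp
  have hs : ((p.1 + 1 : ℕ) : ℝ≥0) * h - p.1 * h = h := by
    rw [← tsub_mul]; push_cast; rw [add_tsub_cancel_left, one_mul]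
  have := (hc.poisson p.2).measure_increment_ne_zero hle
  rw [hs] at this
  rw [← this]
  simp [gridBits]

/-- A common tick before `T` sets both bits of one cell, for every grid. On the grid with `n` cells
this has probability of order `n⁻²` for each cell, hence `n⁻¹` in all. -/
theorem IsDrivingNoise.ae_not_simultaneous (hc : IsDrivingNoise lam P clk) {e e' : Clock}
    (hee : e ≠ e') : ∀ᵐ ω ∂P, ∀ t, TicksAt (fun t => clk e t ω) t →
      ¬ TicksAt (fun t => clk e' t ω) t := by
  suffices hT : ∀ T : ℕ, ∀ᵐ ω ∂P, ∀ t ≤ (T : ℝ≥0), TicksAt (fun t => clk e t ω) t →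
      ¬ TicksAt (fun t => clk e' t ω) t by
    filter_upwards [ae_all_iff.2 hT] with ω hω t
    obtain ⟨T, hT⟩ := exists_nat_ge t
    exact hω T t hT
  intro T
  let bit : ℝ≥0 → ℕ × Clock → Ω → Bool := fun h p ω => gridBits (fun e t => clk e t ω) h p
  let Bad : ℕ → Set Ω := fun n => ⋃ j ∈ Finset.range n,
    {ω | bit (T / n) (j, e) ω = true} ∩ {ω | bit (T / n) (j, e') ω = true}
  have hBad : ∀ n : ℕ, 1 ≤ n → P (Bad n) ≤
      ENNReal.ofReal ((clockRate lam e * T * (clockRate lam e' * T) : ℝ≥0) / n) := by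
    intro n hn
    have hn0 : (0 : ℝ) < n := by positivity
    have hj : ∀ j, P ({ω | bit (T / n) (j, e) ω = true} ∩ {ω | bit (T / n) (j, e') ω = true}) ≤
        ENNReal.ofReal ((clockRate lam e * T * (clockRate lam e' * T) : ℝ≥0) / (n * n)) := by
      intro j
      have hind := (hc.iIndepFun_gridBits (T / n)).indepFun
        (show ((j, e) : ℕ × Clock) ≠ (j, e') by simpa using hee)
      have hmul := hind.measure_inter_preimage_eq_mul {true} {true} (measurableSet_singleton _)
        (measurableSet_singleton _)
      refine (le_of_eq hmul).trans ?_
      have e1 := hc.measure_gridBits (T / n) (j, e)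
      have e2 := hc.measure_gridBits (T / n) (j, e')
      calc _ = ENNReal.ofReal (tickProb (clockRate lam e) (T / n)) *
            ENNReal.ofReal (tickProb (clockRate lam e') (T / n)) := by rw [← e1, ← e2]; rfl
        _ = ENNReal.ofReal (tickProb (clockRate lam e) (T / n) *
            tickProb (clockRate lam e') (T / n)) := (ENNReal.ofReal_mul (tickProb_nonneg _ _)).symm
        _ ≤ _ := by
            refine ENNReal.ofReal_le_ofReal ?_
            refine (mul_le_mul (tickProb_le _ _) (tickProb_le _ _) (tickProb_nonneg _ _)
              (by positivity)).trans (le_of_eq ?_)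
            push_cast
            field_simp
    refine (measure_biUnion_finset_le _ _).trans ((Finset.sum_le_sum fun j _ => hj j).trans ?_)
    rw [Finset.sum_const, Finset.card_range, nsmul_eq_mul, ← ENNReal.ofReal_natCast,
      ← ENNReal.ofReal_mul (by positivity)]
    refine ENNReal.ofReal_le_ofReal (le_of_eq ?_)
    field_simp
  have hnull : P (⋂ n ≥ 1, Bad n) = 0 := by
    have hlim : Tendsto (fun n : ℕ => ENNReal.ofReal
        ((clockRate lam e * T * (clockRate lam e' * T) : ℝ≥0) / n)) atTop (𝓝 0) := by
      rw [← ENNReal.ofReal_zero]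
      exact ENNReal.tendsto_ofReal (tendsto_const_div_atTop_nhds_zero_nat _)
    refine le_antisymm (ge_of_tendsto hlim ?_) zero_le
    filter_upwards [eventually_ge_atTop 1] with n hn
    exact (measure_mono (Set.biInter_subset_of_mem hn)).trans (hBad n hn)
  filter_upwards [measure_eq_zero_iff_ae_notMem.1 hnull, (hc.poisson e).paths,
    (hc.poisson e').paths] with ω hω hp hp' t htT htk htk'
  refine hω (Set.mem_iInter₂.2 fun n hn => ?_)
  have hn0 : (0 : ℝ≥0) < n := by have : 1 ≤ n := hn; positivity
  have hTn : (n : ℝ≥0) * (T / n) = T := mul_div_cancel₀ _ hn0.ne'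
  have hex : ∃ j : ℕ, t ≤ (j + 1 : ℕ) * (T / n : ℝ≥0) := ⟨n, htT.trans (by
    calc (T : ℝ≥0) = n * (T / n) := hTn.symm
      _ ≤ _ := by gcongr; simp)⟩
  classical
  -- The cell `(j T / n, (j + 1) T / n]` that contains `t`.
  let j := Nat.find hex
  have hj1 : t ≤ (j + 1 : ℕ) * (T / n : ℝ≥0) := Nat.find_spec hex
  have hj0 : (j : ℝ≥0) * (T / n) < t := by
    rcases Nat.eq_zero_or_pos j with h | h
    · rw [h]; simpa using htk.1
    · have := Nat.find_min hex (show j - 1 < j by omega)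
      rw [show j - 1 + 1 = j by omega] at this
      exact not_le.1 this
  have hjn : j < n := by
    have : (j : ℝ≥0) * (T / n) < n * (T / n) := hj0.trans_le (htT.trans hTn.ge)
    exact_mod_cast lt_of_mul_lt_mul_right this zero_le
  have hbit : ∀ e : Clock, Monotone (fun t => clk e t ω) → TicksAt (fun t => clk e t ω) t →
      bit (T / n) (j, e) ω = true := by
    intro e hmono htk
    have h1 := htk.2 _ hj0
    have h2 := hmono hj1
    simp only [bit, gridBits, decide_eq_true_eq]
    dsimp only at h1 h2
    omega
  exact Set.mem_biUnion (Finset.mem_coe.2 (Finset.mem_range.2 hjn))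
    ⟨hbit e hp.2.1 htk, hbit e' hp'.2.1 htk'⟩

/-- The geometric rate gives silent sites almost surely, and it is also what makes the truncation of
the clocks converge uniformly. -/
theorem IsDrivingNoise.measure_not_silent_le (hc : IsDrivingNoise lam P clk) (K m : ℕ) (T : ℝ≥0) :
    P {ω | ∀ i, K ≤ i → i < m → clk (some i) T ω ≠ 0} ≤
      ENNReal.ofReal (tickProb 1 T ^ (m - K)) := by
  have hi : ∀ i : ℕ, P ((fun ω => clk (some i) T ω) ⁻¹' {0}ᶜ) = ENNReal.ofReal (tickProb 1 T) := by
    intro i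
    have := (hc.services i).measure_increment_ne_zero (zero_le (a := T))
    rw [tsub_zero] at this
    rw [← this]
    refine measure_congr ?_
    filter_upwards [(hc.services i).paths] with ω hω
    refine propext ?_
    change clk (some i) T ω ≠ 0 ↔ clk (some i) T ω - clk (some i) 0 ω ≠ 0
    rw [hω.1, Nat.sub_zero]
  have hind : iIndepFun (fun (i : ℕ) ω => clk (some i) T ω) P :=
    (hc.indep.precomp (Option.some_injective ℕ)).comp (fun _ a => a T) fun _ =>
      measurable_pi_apply T
  have := hind.measure_inter_preimage_eq_mul (Finset.Ico K m) (sets := fun _ => {0}ᶜ)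
    (fun _ _ => (measurableSet_singleton 0).compl)
  calc P {ω | ∀ i, K ≤ i → i < m → clk (some i) T ω ≠ 0}
      ≤ P (⋂ i ∈ Finset.Ico K m, (fun ω => clk (some i) T ω) ⁻¹' {0}ᶜ) := by
        refine measure_mono fun ω hω => Set.mem_iInter₂.2 fun i hi => ?_
        rw [Finset.mem_Ico] at hi
        exact hω i hi.1 hi.2
    _ = ∏ i ∈ Finset.Ico K m, P ((fun ω => clk (some i) T ω) ⁻¹' {0}ᶜ) := this
    _ = ENNReal.ofReal (tickProb 1 T ^ (m - K)) := by
        rw [Finset.prod_congr rfl fun i _ => hi i, Finset.prod_const, Nat.card_Ico,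
          ENNReal.ofReal_pow (tickProb_nonneg _ _)]
    _ ≤ _ := le_rfl

theorem IsDrivingNoise.ae_goodClocks (hc : IsDrivingNoise lam P clk) :
    ∀ᵐ ω ∂P, GoodClocks (fun e t => clk e t ω) := by
  have hpaths : ∀ᵐ ω ∂P, ∀ e, clk e 0 ω = 0 ∧ Monotone (fun t => clk e t ω) ∧
      ∀ t, ∀ᶠ s in 𝓝[>] t, clk e s ω = clk e t ω := ae_all_iff.2 fun e => (hc.poisson e).paths
  have hsim : ∀ᵐ ω ∂P, ∀ e e', e ≠ e' → ∀ t, TicksAt (fun t => clk e t ω) t →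
      ¬ TicksAt (fun t => clk e' t ω) t := by
    refine ae_all_iff.2 fun e => ae_all_iff.2 fun e' => ?_
    by_cases h : e = e'
    · exact Eventually.of_forall fun ω h' => absurd h h'
    · filter_upwards [hc.ae_not_simultaneous h] with ω hω _ using hω
  -- Integer times suffice: a clock silent up to a later time is silent up to an earlier one.
  have hsil : ∀ᵐ ω ∂P, ∀ T K : ℕ, ∃ i, K ≤ i ∧ clk (some i) T ω = 0 := by
    refine ae_all_iff.2 fun T => ae_all_iff.2 fun K => ?_
    have hlim : Tendsto (fun n : ℕ => ENNReal.ofReal (tickProb 1 T ^ n)) atTop (𝓝 0) := by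
      rw [← ENNReal.ofReal_zero]
      exact ENNReal.tendsto_ofReal
        (tendsto_pow_atTop_nhds_zero_of_lt_one (tickProb_nonneg _ _) (tickProb_lt_one _ _))
    have : P {ω | ¬ ∃ i, K ≤ i ∧ clk (some i) T ω = 0} = 0 := by
      refine le_antisymm (ge_of_tendsto' hlim fun n => ?_) zero_le
      have := hc.measure_not_silent_le K (K + n) T
      rw [Nat.add_sub_cancel_left] at this
      refine (measure_mono fun ω hω i hi _ h => ?_).trans this
      exact hω ⟨i, hi, h⟩
    exact this
  filter_upwards [hpaths, hsim, hsil] with ω h1 h2 h3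
  refine ⟨fun e => (h1 e).1, fun e => (h1 e).2.1, fun e => (h1 e).2.2, ?_, ?_⟩
  · intro e e' t h h'
    by_contra hne
    exact h2 e e' hne t h h'
  · intro T K
    obtain ⟨n, hn⟩ := exists_nat_ge T
    obtain ⟨i, hi, hi0⟩ := h3 n K
    exact ⟨i, hi, Nat.le_zero.1 (hi0 ▸ (h1 (some i)).2.1 hn)⟩

end Noise

/-! ### Construction of Poisson processes from blocks of uniform points -/

theorem integral_infinitePi_finset_prod {ι : Type*} {X : ι → Type*} [∀ i, MeasurableSpace (X i)]
    (μ : (i : ι) → Measure (X i)) [∀ i, IsProbabilityMeasure (μ i)] (s : Finset ι)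
    {f : (i : ι) → X i → ℂ} (hf : ∀ i, Measurable (f i)) :
    ∫ ω, ∏ i ∈ s, f i (ω i) ∂Measure.infinitePi μ = ∏ i ∈ s, ∫ x, f i x ∂μ i := by
  have h1 : ∀ ω : (i : ι) → X i, ∏ i ∈ s, f i (ω i) = ∏ i : s, f i (s.restrict ω i) := fun ω =>
    (Finset.prod_coe_sort s fun i => f i (ω i)).symm
  simp_rw [h1]
  rw [integral_restrict_infinitePi (μ := μ) (f := fun x => ∏ i : s, f i (x i)),
    integral_fintype_prod_eq_prod, Finset.prod_coe_sort s fun i => ∫ x, f i x ∂μ i]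
  exact (Finset.measurable_prod Finset.univ fun (i : s) _ =>
    (hf i).comp (measurable_pi_apply i)).aestronglyMeasurable

/-- The uniform distribution on `(0, 1]`. -/
noncomputable def uniformUnit : Measure ℝ := volume.restrict (Set.Ioc 0 1)

instance : IsProbabilityMeasure uniformUnit := ⟨by simp [uniformUnit]⟩

/-- A Poisson number, together with a sequence of independent uniform points. -/
noncomputable def blockMeasure (r : ℝ≥0) : Measure (ℕ × (ℕ → ℝ)) :=
  (poissonMeasure r).prod (Measure.infinitePi fun _ => uniformUnit)

instance (r : ℝ≥0) : IsProbabilityMeasure (blockMeasure r) := by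
  unfold blockMeasure; infer_instance

open Classical in
/-- The number of the first `x.1` points of the sequence `x.2` in `S`. -/
noncomputable def blockCount (S : Set ℝ) (x : ℕ × (ℕ → ℝ)) : ℕ :=
  ∑ k ∈ Finset.range x.1, if x.2 k ∈ S then 1 else 0

theorem measurable_blockCount {S : Set ℝ} (hS : MeasurableSet S) : Measurable (blockCount S) := by
  classical
  refine measurable_from_prod_countable_right fun n => ?_
  refine Finset.measurable_sum (Finset.range n) (f := fun k (y : ℕ → ℝ) => if y k ∈ S then 1 else 0)
    fun k _ => Measurable.ite ?_ measurable_const measurable_const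
  exact (measurable_pi_apply k) hS

theorem blockCount_empty (x : ℕ × (ℕ → ℝ)) : blockCount ∅ x = 0 := by simp [blockCount]

theorem blockCount_mono {S S' : Set ℝ} (h : S ⊆ S') (x : ℕ × (ℕ → ℝ)) :
    blockCount S x ≤ blockCount S' x := by
  classical
  refine Finset.sum_le_sum fun k _ => ?_
  split_ifs with h1 h2
  exacts [le_rfl, absurd (h h1) h2, zero_le_one, le_rfl]

theorem blockCount_add {S S' S'' : Set ℝ} (hd : Disjoint S S') (hu : S'' = S ∪ S')
    (x : ℕ × (ℕ → ℝ)) : blockCount S'' x = blockCount S x + blockCount S' x := by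
  classical
  subst hu
  simp only [blockCount, ← Finset.sum_add_distrib]
  refine Finset.sum_congr rfl fun k _ => ?_
  by_cases h1 : x.2 k ∈ S
  · have h2 : x.2 k ∉ S' := Set.disjoint_left.1 hd h1
    simp [h1, h2]
  · simp [h1]

/-- Given `n` points the mean is `c ^ n` with `c = ∫ F`, and the mean of `c ^ n` under the Poisson
distribution is `exp (r (c - 1))`. -/
theorem integral_blockMeasure_prod (r : ℝ≥0) {F : ℝ → ℂ} (hF : Measurable F)
    (hF1 : ∀ u, ‖F u‖ ≤ 1) :
    ∫ x, ∏ k ∈ Finset.range x.1, F (x.2 k) ∂blockMeasure r =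
      Complex.exp (r * ((∫ u, F u ∂uniformUnit) - 1)) := by
  have hm : Measurable fun x : ℕ × (ℕ → ℝ) => ∏ k ∈ Finset.range x.1, F (x.2 k) := by
    refine measurable_from_prod_countable_right fun n => ?_
    exact Finset.measurable_prod (Finset.range n) fun k _ => hF.comp (measurable_pi_apply k)
  have hi : Integrable (fun x : ℕ × (ℕ → ℝ) => ∏ k ∈ Finset.range x.1, F (x.2 k))
      (blockMeasure r) := by
    refine (integrable_const (1 : ℝ)).mono' hm.aestronglyMeasurable (Eventually.of_forall fun x => ?_)
    rw [norm_prod]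
    exact Finset.prod_le_one (fun _ _ => norm_nonneg _) fun k _ => hF1 _
  unfold blockMeasure at hi ⊢
  rw [integral_prod _ hi]
  simp_rw [integral_infinitePi_finset_prod (fun _ : ℕ => uniformUnit) (Finset.range _)
    (fun _ => hF), Finset.prod_const, Finset.card_range]
  rw [integral_poissonMeasure]
  set c : ℂ := ∫ u, F u ∂uniformUnit
  have hexp : Complex.exp (r * c) = ∑' n : ℕ, (r * c) ^ n / n.factorial := by
    rw [Complex.exp_eq_exp_ℂ, NormedSpace.exp_eq_tsum_div]
  rw [mul_sub, mul_one, Complex.exp_sub, div_eq_mul_inv, ← Complex.exp_neg, mul_comm, hexp,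
    ← tsum_mul_left]
  refine tsum_congr fun n => ?_
  rw [Complex.real_smul]
  push_cast
  ring

/-- The part of the block `b` that contributes to the counts in `(s, t]`. -/
def blockWindow (b : ℕ) (s t : ℝ≥0) : Set ℝ := {u | 0 < u ∧ (s : ℝ) < b + u ∧ b + u ≤ t}

theorem measurableSet_blockWindow (b : ℕ) (s t : ℝ≥0) : MeasurableSet (blockWindow b s t) := by
  unfold blockWindow
  measurability

theorem max_min_sub_max_eq {s t b : ℝ} (hst : s ≤ t) :
    max (min 1 (t - b) - max 0 (s - b)) 0 =
      (min t (b + 1) - min t b) - (min s (b + 1) - min s b) := by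
  simp only [min_def, max_def]
  split_ifs <;> linarith

/-- The length is written as a difference of two increments in `b`, so that the sum over the blocks
telescopes. -/
theorem uniformUnit_blockWindow (b : ℕ) {s t : ℝ≥0} (hst : s ≤ t) :
    uniformUnit.real (blockWindow b s t) =
      ((min (t : ℝ) (b + 1 : ℕ) - min (t : ℝ) b) - (min (s : ℝ) (b + 1 : ℕ) - min (s : ℝ) b)) := by
  have hset : blockWindow b s t ∩ Set.Ioc 0 1 =
      Set.Ioc (max 0 ((s : ℝ) - b)) (min 1 ((t : ℝ) - b)) := by
    ext u
    simp only [blockWindow, Set.mem_inter_iff, Set.mem_ofPred_eq, Set.mem_Ioc, max_lt_iff, le_min_iff]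
    constructor
    · rintro ⟨⟨h1, h2, h3⟩, h4, h5⟩; exact ⟨⟨h1, by linarith⟩, h5, by linarith⟩
    · rintro ⟨⟨h1, h2⟩, h3, h4⟩; exact ⟨⟨h1, by linarith, by linarith⟩, h1, h3⟩
  have hst' : (s : ℝ) ≤ t := hst
  rw [uniformUnit, measureReal_restrict_apply (measurableSet_blockWindow b s t), hset,
    measureReal_def, Real.volume_Ioc, ENNReal.toReal_ofReal']
  push_cast
  exact max_min_sub_max_eq hst'

/-- The counting process of the points of all the blocks. -/
noncomputable def blockProcess (t : ℝ≥0) (ω : ℕ → ℕ × (ℕ → ℝ)) : ℕ :=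
  ∑ b ∈ Finset.range ⌈t⌉₊, blockCount (blockWindow b 0 t) (ω b)

theorem blockProcess_eq {t : ℝ≥0} {B : ℕ} (hB : t ≤ B) (ω : ℕ → ℕ × (ℕ → ℝ)) :
    blockProcess t ω = ∑ b ∈ Finset.range B, blockCount (blockWindow b 0 t) (ω b) := by
  refine Finset.sum_subset (Finset.range_mono (Nat.ceil_le.2 hB)) fun b _ hb => ?_
  have : blockWindow b 0 t = ∅ := by
    ext u
    simp only [blockWindow, Set.mem_ofPred_eq, Set.mem_empty_iff_false, iff_false, not_and]
    intro h1 _ h2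
    have h3 : (t : ℝ) ≤ b := by
      have := Nat.ceil_le.1 (not_lt.1 fun h => hb (Finset.mem_range.2 h))
      exact_mod_cast this
    linarith
  rw [this, blockCount_empty]

theorem blockProcess_sub {s t : ℝ≥0} {B : ℕ} (hst : s ≤ t) (hB : t ≤ B) (ω : ℕ → ℕ × (ℕ → ℝ)) :
    blockProcess t ω - blockProcess s ω =
      ∑ b ∈ Finset.range B, blockCount (blockWindow b s t) (ω b) := by
  rw [blockProcess_eq hB, blockProcess_eq (hst.trans hB)]
  have : ∀ b, blockCount (blockWindow b 0 t) (ω b) =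
      blockCount (blockWindow b 0 s) (ω b) + blockCount (blockWindow b s t) (ω b) := by
    intro b
    have hst' : (s : ℝ) ≤ t := hst
    refine blockCount_add ?_ ?_ _
    · refine Set.disjoint_left.2 fun u h1 h2 => ?_
      exact absurd h1.2.2 (not_le.2 h2.2.1)
    · ext u
      simp only [blockWindow, Set.mem_ofPred_eq, Set.mem_union, NNReal.coe_zero]
      constructor
      · rintro ⟨h1, h2, h3⟩
        rcases le_or_gt ((b : ℝ) + u) s with h | h
        exacts [Or.inl ⟨h1, h2, h⟩, Or.inr ⟨h1, h, h3⟩]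
      · rintro (⟨h1, h2, h3⟩ | ⟨h1, h2, h3⟩)
        exacts [⟨h1, h2, h3.trans hst'⟩, ⟨h1, (NNReal.coe_nonneg s).trans_lt h2, h3⟩]
  simp_rw [this, Finset.sum_add_distrib]
  omega

theorem measurable_blockProcess (t : ℝ≥0) : Measurable (blockProcess t) :=
  Finset.measurable_sum _ fun b _ =>
    (measurable_blockCount (measurableSet_blockWindow b 0 t)).comp (measurable_pi_apply b)

theorem monotone_blockProcess (ω : ℕ → ℕ × (ℕ → ℝ)) : Monotone fun t => blockProcess t ω := by
  intro s t hst
  obtain ⟨B, hB⟩ := exists_nat_ge t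
  change blockProcess s ω ≤ blockProcess t ω
  rw [blockProcess_eq hB, blockProcess_eq (hst.trans hB)]
  refine Finset.sum_le_sum fun b _ => blockCount_mono ?_ _
  exact fun u hu => ⟨hu.1, hu.2.1, hu.2.2.trans (NNReal.coe_le_coe.2 hst)⟩

/-- Finitely many points matter near `t`. Each lies at or before `t` and stays counted, or lies at a
positive distance after `t`; the windows are closed on the right. -/
theorem eventually_blockProcess_eq (ω : ℕ → ℕ × (ℕ → ℝ)) (t : ℝ≥0) :
    ∀ᶠ s in 𝓝[>] t, blockProcess s ω = blockProcess t ω := by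
  classical
  obtain ⟨B, hB⟩ := exists_nat_ge (t + 1)
  have hpt : ∀ b ∈ Finset.range B, ∀ k ∈ Finset.range (ω b).1, ∀ᶠ s in 𝓝[>] t,
      ((ω b).2 k ∈ blockWindow b 0 s ↔ (ω b).2 k ∈ blockWindow b 0 t) := by
    intro b _ k _
    rcases le_or_gt ((b : ℝ) + (ω b).2 k) t with h | h
    · filter_upwards [self_mem_nhdsWithin] with s hs
      have hs' : (t : ℝ) < s := hs
      exact ⟨fun h' => ⟨h'.1, h'.2.1, h⟩, fun h' => ⟨h'.1, h'.2.1, h.trans hs'.le⟩⟩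
    · have : ∀ᶠ s : ℝ≥0 in 𝓝 t, (s : ℝ) < b + (ω b).2 k :=
        (NNReal.continuous_coe.tendsto t).eventually_lt_const h
      filter_upwards [nhdsWithin_le_nhds this] with s hs
      exact ⟨fun h' => absurd h'.2.2 (not_le.2 hs), fun h' => absurd h'.2.2 (not_le.2 h)⟩
  have := (Finset.eventually_all _).2 fun b hb => (Finset.eventually_all _).2 (hpt b hb)
  filter_upwards [this, Ioo_mem_nhdsGT (show t < t + 1 by simp)] with s hs hs1
  rw [blockProcess_eq (hs1.2.le.trans hB), blockProcess_eq (le_self_add.trans hB)]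
  refine Finset.sum_congr rfl fun b hb => Finset.sum_congr rfl fun k hk => ?_
  simp only [hs b hb k hk]

section Law

variable (r : ℝ≥0)

/-- The distribution of the points that make up a Poisson process of rate `r`. -/
noncomputable def poissonPoints : Measure (ℕ → ℕ × (ℕ → ℝ)) :=
  Measure.infinitePi fun _ => blockMeasure r

instance : IsProbabilityMeasure (poissonPoints r) := by unfold poissonPoints; infer_instance

/-- The joint characteristic function of the increments, which yields both their Poisson laws and
their independence. It factorizes over the blocks, and each block is evaluated by
`integral_blockMeasure_prod`. -/
theorem integral_exp_blockProcess {n : ℕ} {t : Fin (n + 1) → ℝ≥0} (ht : Monotone t)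
    (θ : Fin n → ℝ) :
    ∫ ω, Complex.exp ((∑ i, θ i * ((blockProcess (t i.succ) ω - blockProcess (t i.castSucc) ω : ℕ) : ℝ)
      : ℝ) * Complex.I) ∂poissonPoints r =
      ∏ i, Complex.exp ((r * (t i.succ - t i.castSucc) : ℝ≥0) *
        (Complex.exp (θ i * Complex.I) - 1)) := by
  classical
  obtain ⟨B, hB⟩ := exists_nat_ge (t (Fin.last n))
  have hst : ∀ i : Fin n, t i.castSucc ≤ t i.succ := fun i => ht (Fin.castSucc_le_succ i)
  have hlast : ∀ i, t i ≤ B := fun i => (ht (Fin.le_last i)).trans hB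
  let W : ℕ → Fin n → Set ℝ := fun b i => blockWindow b (t i.castSucc) (t i.succ)
  let F : ℕ → ℝ → ℂ := fun b u => Complex.exp ((∑ i, θ i * (if u ∈ W b i then 1 else 0) : ℝ) * Complex.I)
  have hFm : ∀ b, Measurable (F b) := by
    intro b
    refine Complex.measurable_exp.comp (Measurable.mul_const (Complex.measurable_ofReal.comp ?_) _)
    refine Finset.measurable_sum _ fun i _ => Measurable.const_mul ?_ _
    exact Measurable.ite (measurableSet_blockWindow b _ _) measurable_const measurable_const
  have hF1 : ∀ b u, ‖F b u‖ ≤ 1 := fun b u => (Complex.norm_exp_ofReal_mul_I _).le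
  have hexp : ∀ ω : ℕ → ℕ × (ℕ → ℝ),
      Complex.exp ((∑ i, θ i * ((blockProcess (t i.succ) ω - blockProcess (t i.castSucc) ω : ℕ) : ℝ)
        : ℝ) * Complex.I) =
      ∏ b ∈ Finset.range B, ∏ k ∈ Finset.range (ω b).1, F b ((ω b).2 k) := by
    intro ω
    simp_rw [F, ← Complex.exp_sum, ← Finset.sum_mul, ← Complex.ofReal_sum]
    congr 3
    simp_rw [fun i : Fin n => blockProcess_sub (hst i) (hlast i.succ) ω]
    push_cast [blockCount]
    simp_rw [Finset.mul_sum]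
    rw [Finset.sum_comm]
    refine Finset.sum_congr rfl fun b _ => ?_
    rw [Finset.sum_comm]
  simp_rw [hexp]
  rw [poissonPoints, integral_infinitePi_finset_prod (fun _ => blockMeasure r) (Finset.range B)
    (f := fun b x => ∏ k ∈ Finset.range x.1, F b (x.2 k))]
  · simp_rw [integral_blockMeasure_prod r (hFm _) (hF1 _)]
    have hint : ∀ b, (∫ u, F b u ∂uniformUnit) - 1 =
        ∑ i, (uniformUnit.real (W b i) : ℂ) * (Complex.exp (θ i * Complex.I) - 1) := by
      intro b
      have hdisj : ∀ i j u, u ∈ W b i → u ∈ W b j → i = j := by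
        intro i j u hi hj
        by_contra hne
        rcases lt_or_gt_of_ne hne with h | h
        · have h1 : t i.succ ≤ t j.castSucc := ht (by
            rw [Fin.le_def, Fin.val_succ, Fin.val_castSucc]; exact h)
          have h2 : (t i.succ : ℝ) ≤ t j.castSucc := h1
          exact absurd (hj.2.1.trans_le hi.2.2) (not_lt.2 h2)
        · have h1 : t j.succ ≤ t i.castSucc := ht (by
            rw [Fin.le_def, Fin.val_succ, Fin.val_castSucc]; exact h)
          have h2 : (t j.succ : ℝ) ≤ t i.castSucc := h1
          exact absurd (hi.2.1.trans_le hj.2.2) (not_lt.2 h2)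
      -- The windows of different increments are disjoint, so at most one term of the exponent is
      -- nonzero.
      have hpt : ∀ u, F b u = 1 + ∑ i, (W b i).indicator
          (fun _ => Complex.exp (θ i * Complex.I) - 1) u := by
        intro u
        by_cases hu : ∃ i, u ∈ W b i
        · obtain ⟨i, hi⟩ := hu
          have hj : ∀ j, j ≠ i → u ∉ W b j := fun j hne h => hne (hdisj j i u h hi)
          rw [Finset.sum_eq_single i (fun j _ hne => by simp [hj j hne]) (by simp)]
          simp only [F]
          rw [Finset.sum_eq_single i (fun j _ hne => by simp [hj j hne]) (by simp)]
          simp [hi]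
        · push Not at hu
          simp [F, hu]
      have hindi : ∀ i, Integrable ((W b i).indicator
          (fun _ => Complex.exp (θ i * Complex.I) - 1)) uniformUnit := fun i =>
        (integrable_const _).indicator (measurableSet_blockWindow b _ _)
      simp_rw [hpt]
      rw [integral_add (integrable_const _) (integrable_finsetSum _ fun i _ => hindi i),
        integral_finsetSum _ fun i _ => hindi i]
      rw [Finset.sum_congr rfl fun i _ => integral_indicator_const (μ := uniformUnit)
        (Complex.exp (θ i * Complex.I) - 1) (measurableSet_blockWindow b (t i.castSucc) (t i.succ))]
      simp [W]
    rw [← Complex.exp_sum, ← Complex.exp_sum]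
    congr 1
    simp_rw [hint, Finset.mul_sum]
    rw [Finset.sum_comm]
    refine Finset.sum_congr rfl fun i _ => ?_
    rw [← Finset.mul_sum, ← Finset.sum_mul, ← Complex.ofReal_sum]
    simp_rw [W, fun b => uniformUnit_blockWindow b (hst i)]
    rw [Finset.sum_sub_distrib, Finset.sum_range_sub (fun b : ℕ => min (t i.succ : ℝ) b),
      Finset.sum_range_sub (fun b : ℕ => min (t i.castSucc : ℝ) b)]
    have h1 : (t i.succ : ℝ) ≤ B := hlast _
    have h2 : (t i.castSucc : ℝ) ≤ B := hlast _
    have h3 : (t i.castSucc : ℝ) ≤ t i.succ := hst i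
    rw [min_eq_left h1, min_eq_left h2]
    simp only [Nat.cast_zero, min_eq_right (NNReal.coe_nonneg _), sub_zero]
    push_cast [NNReal.coe_sub (hst i)]
    ring
  · intro b
    refine measurable_from_prod_countable_right fun n => ?_
    exact Finset.measurable_prod (Finset.range n) fun k _ => (hFm b).comp (measurable_pi_apply k)

theorem map_blockProcess_increment {s t : ℝ≥0} (hst : s ≤ t) :
    (poissonPoints r).map (fun ω => blockProcess t ω - blockProcess s ω) =
      poissonMeasure (r * (t - s)) := by
  have hm : Measurable fun ω => blockProcess t ω - blockProcess s ω :=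
    (measurable_blockProcess t).sub (measurable_blockProcess s)
  have := Measure.isProbabilityMeasure_map (μ := poissonPoints r) hm.aemeasurable
  have hcast : Measurable (Nat.cast : ℕ → ℝ) := .of_discrete
  have := Measure.isProbabilityMeasure_map
    (μ := (poissonPoints r).map (fun ω => blockProcess t ω - blockProcess s ω)) hcast.aemeasurable
  have key : ((poissonPoints r).map (fun ω => blockProcess t ω - blockProcess s ω)).map
      (Nat.cast : ℕ → ℝ) = (poissonMeasure (r * (t - s))).map Nat.cast := by
    refine Measure.ext_of_charFun ?_
    ext θ
    rw [charFun_map_cast_poissonMeasure, charFun_apply_real, Measure.map_map hcast hm,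
      integral_map (hcast.comp hm).aemeasurable (by fun_prop)]
    have h := integral_exp_blockProcess r (n := 1) (t := ![s, t])
      (by intro i j hij; fin_cases i <;> fin_cases j <;> simp_all) (fun _ => θ)
    simpa using h
  have hemb : MeasurableEmbedding (Nat.cast : ℕ → ℝ) := hcast.measurableEmbedding Nat.cast_injective
  calc _ = (((poissonPoints r).map (fun ω => blockProcess t ω - blockProcess s ω)).map
        (Nat.cast : ℕ → ℝ)).comap Nat.cast := (hemb.comap_map _).symm
    _ = _ := by rw [key, hemb.comap_map]

theorem isPoissonProcess_blockProcess : IsPoissonProcess r (poissonPoints r) blockProcess where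
  measurable := measurable_blockProcess
  paths := Eventually.of_forall fun ω =>
    ⟨by simp [blockProcess], monotone_blockProcess ω, eventually_blockProcess_eq ω⟩
  law_increment _ _ hst := map_blockProcess_increment r hst
  indep_increments := by
    intro n t ht
    have hmn : ∀ i : Fin n, Measurable fun ω =>
        blockProcess (t i.succ) ω - blockProcess (t i.castSucc) ω := fun i =>
      (measurable_blockProcess _).sub (measurable_blockProcess _)
    have hm : ∀ i : Fin n, Measurable fun ω =>
        ((blockProcess (t i.succ) ω - blockProcess (t i.castSucc) ω : ℕ) : ℝ) := fun i =>
      (Measurable.of_discrete (f := (Nat.cast : ℕ → ℝ))).comp (hmn i)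
    have hreal : iIndepFun (fun (i : Fin n) ω =>
        ((blockProcess (t i.succ) ω - blockProcess (t i.castSucc) ω : ℕ) : ℝ)) (poissonPoints r) := by
      refine (iIndepFun_iff_charFun_pi fun i => (hm i).aemeasurable).2 fun θ => ?_
      have hmarg : ∀ i : Fin n, charFun ((poissonPoints r).map fun ω =>
          ((blockProcess (t i.succ) ω - blockProcess (t i.castSucc) ω : ℕ) : ℝ)) (θ.ofLp i) =
          Complex.exp ((r * (t i.succ - t i.castSucc) : ℝ≥0) *
            (Complex.exp (θ.ofLp i * Complex.I) - 1)) := by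
        intro i
        rw [← charFun_map_cast_poissonMeasure,
          ← map_blockProcess_increment r (ht (Fin.castSucc_le_succ i)),
          Measure.map_map .of_discrete (hmn i)]
        rfl
      simp_rw [hmarg]
      have hvec : Measurable fun ω => WithLp.toLp 2 fun i : Fin n =>
          ((blockProcess (t i.succ) ω - blockProcess (t i.castSucc) ω : ℕ) : ℝ) :=
        (WithLp.measurable_toLp 2 _).comp (measurable_pi_lambda _ hm)
      rw [← integral_exp_blockProcess r ht, charFun_apply,
        integral_map hvec.aemeasurable (by fun_prop)]
      simp only [PiLp.inner_apply, Real.inner_apply, mul_comm (θ.ofLp _)]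
    -- Characteristic functions need real values; the floor returns to the natural numbers.
    have := hreal.comp (fun _ x => ⌊x⌋₊) fun _ => Nat.measurable_floor
    simpa [Function.comp_def] using this

end Law

/-- The probability space of the driving clocks. -/
noncomputable def noiseMeasure (lam : ℝ≥0) : Measure (Clock → ℕ → ℕ × (ℕ → ℝ)) :=
  Measure.infinitePi fun e => poissonPoints (clockRate lam e)

instance (lam : ℝ≥0) : IsProbabilityMeasure (noiseMeasure lam) := by
  unfold noiseMeasure; infer_instance

/-- The driving clocks on their probability space. -/
noncomputable def noiseClocks (e : Clock) (t : ℝ≥0) (ω : Clock → ℕ → ℕ × (ℕ → ℝ)) : ℕ :=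
  blockProcess t (ω e)

theorem IsPoissonProcess.comp_measurePreserving {Ω Ω' : Type*} [MeasurableSpace Ω]
    [MeasurableSpace Ω'] {P : Measure Ω} {P' : Measure Ω'} {φ : Ω' → Ω}
    (hφ : MeasurePreserving φ P' P) {r : ℝ≥0} {A : ℝ≥0 → Ω → ℕ} (hA : IsPoissonProcess r P A) :
    IsPoissonProcess r P' (fun t ω => A t (φ ω)) where
  measurable t := (hA.measurable t).comp hφ.measurable
  paths := hφ.quasiMeasurePreserving.ae hA.paths
  law_increment s t hst := by
    have hm : Measurable fun ω => A t ω - A s ω := (hA.measurable t).sub (hA.measurable s)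
    rw [← hA.law_increment s t hst, ← hφ.map_eq, Measure.map_map hm hφ.measurable]
    rfl
  indep_increments n t ht := by
    have hm : ∀ i : Fin n, Measurable fun ω => A (t i.succ) ω - A (t i.castSucc) ω := fun i =>
      (hA.measurable _).sub (hA.measurable _)
    have h := hA.indep_increments n t ht
    have := h.isProbabilityMeasure
    have : IsProbabilityMeasure P' := by
      have h1 : IsProbabilityMeasure (P'.map φ) := hφ.map_eq.symm ▸ this
      exact Measure.isProbabilityMeasure_of_map φ
    rw [iIndepFun_iff_map_fun_eq_infinitePi_map hm] at h
    change iIndepFun (fun (i : Fin n) => (fun ω => A (t i.succ) ω - A (t i.castSucc) ω) ∘ φ) P'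
    rw [iIndepFun_iff_map_fun_eq_infinitePi_map fun i => (hm i).comp hφ.measurable]
    have h2 : ∀ i : Fin n, P.map (fun ω => A (t i.succ) ω - A (t i.castSucc) ω) =
        P'.map ((fun ω => A (t i.succ) ω - A (t i.castSucc) ω) ∘ φ) := fun i => by
      rw [← hφ.map_eq, Measure.map_map (hm i) hφ.measurable]
    simp_rw [← h2, ← h, ← hφ.map_eq]
    rw [Measure.map_map (measurable_pi_lambda _ hm) hφ.measurable]
    rfl

theorem isDrivingNoise_noiseClocks (lam : ℝ≥0) :
    IsDrivingNoise lam (noiseMeasure lam) noiseClocks where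
  arrivals := (isPoissonProcess_blockProcess lam).comp_measurePreserving
    (measurePreserving_eval_infinitePi (fun e => poissonPoints (clockRate lam e)) none)
  services i := (isPoissonProcess_blockProcess 1).comp_measurePreserving
    (measurePreserving_eval_infinitePi (fun e => poissonPoints (clockRate lam e)) (some i))
  indep := iIndepFun_infinitePi (P := fun e => poissonPoints (clockRate lam e))
    (X := fun _ x t => blockProcess t x) fun _ =>
      measurable_pi_lambda _ fun t => measurable_blockProcess t

/-! ### Tick operators on observables -/

/-- The bounded continuous functions of the configuration. -/
abbrev Observable : Type := BoundedContinuousFunction QueueState ℝ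

instance : Nontrivial Observable :=
  ⟨0, BoundedContinuousFunction.const _ 1, fun h => by
    simpa using DFunLike.congr_fun h (0 : QueueState)⟩

/-- The bounded operators on a normed space. -/
abbrev EndOp (E : Type) [NormedAddCommGroup E] [NormedSpace ℝ E] : Type := E →L[ℝ] E

/-- The bounded operators on the bounded continuous functions of the configuration. -/
abbrev ObservableOp : Type := EndOp Observable

/-- The operator `f ↦ f ∘ afterTick N e` on the continuous functions. -/
noncomputable def tickOp (N : ℕ∞) (e : Clock) : ObservableOp :=
  LinearMap.mkContinuous
    { toFun := fun f => f.compContinuous ⟨afterTick N e, continuous_afterTick N e⟩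
      map_add' := fun _ _ => rfl
      map_smul' := fun _ _ => rfl } 1 fun f => by
    rw [one_mul]
    exact (BoundedContinuousFunction.norm_le (norm_nonneg f)).2 fun q => f.norm_coe_le_norm _

@[simp]
theorem tickOp_apply (N : ℕ∞) (e : Clock) (f : Observable) (q : QueueState) :
    tickOp N e f q = f (afterTick N e q) := rfl

/-- The operator of a clock that ticks with probability `p`. -/
noncomputable def lazyTickOp (N : ℕ∞) (p : ℝ) (e : Clock) :
    ObservableOp := 1 + p • (tickOp N e - 1)

theorem lazyTickOp_apply (N : ℕ∞) (p : ℝ) (e : Clock) (f : Observable) (q : QueueState) :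
    lazyTickOp N p e f q = p * f (afterTick N e q) + (1 - p) * f q := by
  have : lazyTickOp N p e f q = f q + p * (f (afterTick N e q) - f q) := rfl
  rw [this]; ring

theorem norm_lazyTickOp_le (N : ℕ∞) {p : ℝ} (h0 : 0 ≤ p) (h1 : p ≤ 1) (e : Clock) :
    ‖lazyTickOp N p e‖ ≤ 1 := by
  refine ContinuousLinearMap.opNorm_le_bound _ zero_le_one fun f => ?_
  rw [one_mul]
  refine (BoundedContinuousFunction.norm_le (norm_nonneg f)).2 fun q => ?_
  rw [lazyTickOp_apply]
  refine (norm_add_le _ _).trans ?_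
  rw [norm_mul, norm_mul, Real.norm_of_nonneg h0, Real.norm_of_nonneg (sub_nonneg.2 h1)]
  nlinarith [f.norm_coe_le_norm (afterTick N e q), f.norm_coe_le_norm q]

/-! ### A power formula for exponentials of operators -/

section Trotter

/-- Telescoping. Only `U` has to be a contraction; for `V`, later an exponential, bounded powers are
enough. -/
theorem norm_pow_sub_pow_le {A : Type*} [NormedRing A] {U V : A} {C : ℝ} (n : ℕ) (hU : ‖U‖ ≤ 1)
    (hV : ∀ k ≤ n, ‖V ^ k‖ ≤ C) : ‖U ^ n - V ^ n‖ ≤ n * (‖U - V‖ * C) := by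
  induction n with
  | zero => simp
  | succ n ih =>
    have : U ^ (n + 1) - V ^ (n + 1) = U * (U ^ n - V ^ n) + (U - V) * V ^ n := by
      rw [pow_succ', pow_succ']; noncomm_ring
    rw [this]
    refine (norm_add_le _ _).trans ?_
    have h1 : ‖U * (U ^ n - V ^ n)‖ ≤ n * (‖U - V‖ * C) := by
      refine (norm_mul_le _ _).trans ?_
      have := ih fun k hk => hV k (hk.trans n.le_succ)
      nlinarith [norm_nonneg (U ^ n - V ^ n)]
    have h2 : ‖(U - V) * V ^ n‖ ≤ ‖U - V‖ * C :=
      (norm_mul_le _ _).trans (by gcongr; exact hV n n.le_succ)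
    push_cast
    linarith

variable {A : Type*} [NormedRing A] [NormedAlgebra ℝ A] [CompleteSpace A]

/-- The scalar part commutes with everything. This turns the exponential of a generator into a
Poisson mixture of powers of `K`. -/
theorem exp_smul_sub_one (x : ℝ) (K : A) :
    NormedSpace.exp (x • (K - 1)) = Real.exp (-x) • NormedSpace.exp (x • K) := by
  let _ : NormedAlgebra ℚ A := NormedAlgebra.restrictScalars ℚ ℝ A
  have hc : Commute (x • K) ((-x) • (1 : A)) := (Commute.one_right _).smul_right _
  have h3 : NormedSpace.exp ((-x) • (1 : A)) = Real.exp (-x) • 1 := by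
    have := NormedSpace.algebraMap_exp_comm (𝕂 := ℝ) (𝔸 := A) (-x)
    rw [Algebra.algebraMap_eq_smul_one, Algebra.algebraMap_eq_smul_one] at this
    rw [← this, Real.exp_eq_exp_ℝ]
  rw [smul_sub, sub_eq_add_neg, ← neg_smul, NormedSpace.exp_add_of_commute hc, h3, mul_smul_comm,
    mul_one]

variable [NormOneClass A]

theorem norm_exp_le_exp_norm (x : A) : ‖NormedSpace.exp x‖ ≤ Real.exp ‖x‖ := by
  let _ : NormedAlgebra ℚ A := NormedAlgebra.restrictScalars ℚ ℝ A
  have h1 := NormedSpace.exp_series_hasSum_exp' (𝕂 := ℝ) x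
  have h2 := NormedSpace.expSeries_div_hasSum_exp ‖x‖
  rw [← Real.exp_eq_exp_ℝ] at h2
  refine h1.norm_le_of_bounded h2 fun n => ?_
  rw [norm_smul, norm_inv, Real.norm_natCast, div_eq_inv_mul]
  gcongr
  exact norm_pow_le x n

/-- A power formula for the exponential. -/
theorem tendsto_pow_exp_of_hasDerivAt {U : ℝ → A} {L : A} (hU0 : U 0 = 1)
    (hU : ∀ h, 0 ≤ h → ‖U h‖ ≤ 1) (hd : HasDerivAt U L 0) {t : ℝ} (ht : 0 ≤ t) :
    Tendsto (fun n : ℕ => U (t / n) ^ n) atTop (𝓝 (NormedSpace.exp (t • L))) := by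
  let _ : NormedAlgebra ℚ A := NormedAlgebra.restrictScalars ℚ ℝ A
  have hV : HasDerivAt (fun h : ℝ => NormedSpace.exp (h • L)) L 0 := by
    simpa using hasDerivAt_exp_smul_const (𝕂 := ℝ) L (0 : ℝ)
  -- The two curves agree to first order at `0`: one step of length `t / n` costs `o(1 / n)`, and
  -- `n` steps cost `o(1)`.
  have hlittle : (fun h : ℝ => U h - NormedSpace.exp (h • L)) =o[𝓝 0] fun h : ℝ => h := by
    have := (hd.sub hV).isLittleO
    simpa [hU0] using this
  have hlim : Tendsto (fun n : ℕ => t / (n : ℝ)) atTop (𝓝 0) :=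
    tendsto_const_div_atTop_nhds_zero_nat t
  have hsmall := hlittle.comp_tendsto hlim
  have hkey : Tendsto (fun n : ℕ => (n : ℝ) * (‖U (t / n) - NormedSpace.exp ((t / n) • L)‖ *
      Real.exp (t * ‖L‖))) atTop (𝓝 0) := by
    have h1 : (fun n : ℕ => (n : ℝ) * ‖U (t / n) - NormedSpace.exp ((t / n : ℝ) • L)‖) =o[atTop]
        fun _ : ℕ => (1 : ℝ) := by
      have h2 : (fun n : ℕ => (n : ℝ) * ‖U (t / n) - NormedSpace.exp ((t / n : ℝ) • L)‖) =o[atTop]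
          fun n : ℕ => (n : ℝ) * (t / n) :=
        (Asymptotics.isBigO_refl (fun n : ℕ => (n : ℝ)) atTop).mul_isLittleO hsmall.norm_left
      refine h2.trans_isBigO (Asymptotics.IsBigO.of_bound t ?_)
      filter_upwards [eventually_ge_atTop 1] with n hn
      have : (n : ℝ) ≠ 0 := by positivity
      rw [mul_div_cancel₀ _ this]
      simp [abs_of_nonneg ht]
    have h3 := ((Asymptotics.isLittleO_one_iff ℝ).1 h1).mul_const (Real.exp (t * ‖L‖))
    simpa [mul_assoc] using h3
  rw [tendsto_iff_norm_sub_tendsto_zero]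
  refine squeeze_zero' (Eventually.of_forall fun _ => norm_nonneg _) ?_ hkey
  filter_upwards [eventually_ge_atTop 1] with n hn
  have hn0 : (0 : ℝ) < n := by positivity
  have hpow : ∀ k : ℕ, NormedSpace.exp ((t / n : ℝ) • L) ^ k =
      NormedSpace.exp (((k : ℝ) * (t / n)) • L) := fun k => by
    rw [← NormedSpace.exp_nsmul, ← Nat.cast_smul_eq_nsmul ℝ, smul_smul]
  have hn1 : NormedSpace.exp (t • L) = NormedSpace.exp ((t / n : ℝ) • L) ^ n := by
    rw [hpow, mul_div_cancel₀ _ hn0.ne']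
  rw [hn1]
  refine norm_pow_sub_pow_le n (hU _ (by positivity)) fun k hk => ?_
  rw [hpow]
  refine (norm_exp_le_exp_norm _).trans (Real.exp_le_exp.2 ?_)
  rw [norm_smul, Real.norm_of_nonneg (by positivity)]
  gcongr
  calc (k : ℝ) * (t / n) ≤ n * (t / n) := by gcongr
    _ = t := mul_div_cancel₀ _ hn0.ne'

theorem hasSum_exp_smul_apply {E : Type} [NormedAddCommGroup E] [NormedSpace ℝ E]
    [CompleteSpace E] (K : EndOp E) (x : ℝ) (f : E) (ev : E →L[ℝ] ℝ) :
    HasSum (fun n : ℕ => x ^ n / n.factorial * ev ((K ^ n) f))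
      (ev (NormedSpace.exp (x • K) f)) := by
  let _ : NormedAlgebra ℚ (EndOp E) := NormedAlgebra.restrictScalars ℚ ℝ _
  have h4 := NormedSpace.exp_series_hasSum_exp' (𝕂 := ℝ) (x • K)
  have h5 := h4.mapL (ev.comp (ContinuousLinearMap.apply ℝ E f))
  refine h5.congr_fun fun n => ?_
  rw [smul_pow, smul_smul, map_smul, smul_eq_mul, div_eq_inv_mul]
  rfl

end Trotter

/-! ### The semigroup of finitely many clocks -/

/-- The total rate of the arrivals and of the first `m` service clocks. -/
def totalRate (lam : ℝ≥0) (m : ℕ) : ℝ := lam + m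

/-- The transition operator of the jump chain driven by the arrivals and the first `m` service
clocks. -/
noncomputable def jumpOp (lam : ℝ≥0) (N : ℕ∞) (m : ℕ) :
    ObservableOp :=
  (totalRate lam m)⁻¹ • ((lam : ℝ) • tickOp N none + ∑ i ∈ Finset.range m, tickOp N (some i))

/-- The semigroup of the system that is driven by the arrivals and the first `m` service clocks. -/
noncomputable def truncSemigroup (lam : ℝ≥0) (N : ℕ∞) (m : ℕ) (t : ℝ≥0) :
    ObservableOp :=
  NormedSpace.exp ((t * totalRate lam m : ℝ) • (jumpOp lam N m - 1))

section Semigroup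

variable {lam : ℝ≥0} (hlam : 0 < lam) (N : ℕ∞) (m : ℕ)

theorem jumpOp_apply (f : Observable) (q : QueueState) :
    jumpOp lam N m f q = (totalRate lam m)⁻¹ * (lam * f (afterTick N none q) +
      ∑ i ∈ Finset.range m, f (afterTick N (some i) q)) := by
  simp [jumpOp, mul_add]

include hlam in
theorem totalRate_pos : 0 < totalRate lam m := by
  have : (0 : ℝ) < lam := hlam
  unfold totalRate; positivity

/-- The operator of one time step of length `h`. -/
noncomputable def stepOp (lam : ℝ≥0) (N : ℕ∞) (m : ℕ) (h : ℝ) :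
    ObservableOp :=
  ((clockList m).map fun e => lazyTickOp N (1 - Real.exp (-(clockRate lam e * h))) e).prod

theorem norm_list_prod_le_one {A : Type*} [NormedRing A] [NormOneClass A] {l : List A}
    (hl : ∀ x ∈ l, ‖x‖ ≤ 1) : ‖l.prod‖ ≤ 1 := by
  induction l with
  | nil => simp
  | cons x l ih =>
    rw [List.prod_cons]
    refine (norm_mul_le _ _).trans ?_
    exact mul_le_one₀ (hl x (by simp)) (norm_nonneg _) (ih fun y hy => hl y (by simp [hy]))

theorem norm_stepOp_le {h : ℝ} (hh : 0 ≤ h) : ‖stepOp lam N m h‖ ≤ 1 := by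
  refine norm_list_prod_le_one fun x hx => ?_
  obtain ⟨e, _, rfl⟩ := List.mem_map.1 hx
  have h1 : Real.exp (-(clockRate lam e * h)) ≤ 1 := Real.exp_le_one_iff.2 (by simp; positivity)
  have h2 := Real.exp_pos (-(clockRate lam e * h))
  exact norm_lazyTickOp_le N (by linarith) (by linarith) e

theorem stepOp_zero : stepOp lam N m 0 = 1 := by
  simp [stepOp, lazyTickOp]

include hlam in
-- All factors equal `1` at `h = 0`, so by the product rule their derivatives simply add up, and the
-- order of the clocks does not matter to first order.
theorem hasDerivAt_stepOp :
    HasDerivAt (stepOp lam N m) (totalRate lam m • (jumpOp lam N m - 1)) 0 := by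
  have hlist : ∀ l : List Clock, HasDerivAt (fun h : ℝ =>
      (l.map fun e => lazyTickOp N (1 - Real.exp (-(clockRate lam e * h))) e).prod)
      ((l.map fun e => (clockRate lam e : ℝ) • (tickOp N e - 1)).sum) 0 := by
    intro l
    induction l with
    | nil => simpa using hasDerivAt_const (0 : ℝ) (1 : ObservableOp)
    | cons e l ih =>
      have h1 : HasDerivAt (fun h : ℝ => 1 - Real.exp (-(clockRate lam e * h)))
          (clockRate lam e : ℝ) 0 := by
        have := ((((hasDerivAt_id (0 : ℝ)).const_mul (clockRate lam e : ℝ)).neg).exp).const_sub 1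
        simpa using this
      have h2 : HasDerivAt (fun h : ℝ => lazyTickOp N (1 - Real.exp (-(clockRate lam e * h))) e)
          ((clockRate lam e : ℝ) • (tickOp N e - 1)) 0 :=
        (h1.smul_const (tickOp N e - 1)).const_add 1
      have h3 := h2.mul ih
      have h4 : (l.map fun e => lazyTickOp N (1 - Real.exp (-(clockRate lam e * (0 : ℝ)))) e).prod =
          1 := by
        simp [lazyTickOp]
      have h5 : lazyTickOp N (1 - Real.exp (-(clockRate lam e * (0 : ℝ)))) e = 1 := by
        simp [lazyTickOp]
      rw [h4, h5, mul_one, one_mul] at h3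
      simp only [List.map_cons, List.prod_cons, List.sum_cons]
      exact h3
  have := hlist (clockList m)
  have hsum : ((clockList m).map fun e => (clockRate lam e : ℝ) • (tickOp N e - 1)).sum =
      totalRate lam m • (jumpOp lam N m - 1) := by
    rw [jumpOp, smul_sub, smul_smul, mul_inv_cancel₀ (totalRate_pos hlam m).ne', one_smul]
    have h1 : ((List.range m).map fun i => tickOp N (some i) - 1).sum =
        ∑ i ∈ Finset.range m, (tickOp N (some i) - 1) := by
      clear this
      induction m with
      | zero => simp
      | succ m ih => rw [List.range_succ, Finset.sum_range_succ, ← ih]; simp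
    simp only [clockList, List.map_cons, List.map_map, List.sum_cons, clockRate, NNReal.coe_one,
      one_smul, Function.comp_def]
    rw [h1, Finset.sum_sub_distrib]
    simp only [Finset.sum_const, Finset.card_range, totalRate, add_smul, smul_sub]
    rw [Nat.cast_smul_eq_nsmul]
    abel
  rw [hsum] at this
  exact this

include hlam in
theorem tendsto_stepOp_pow (t : ℝ≥0) :
    Tendsto (fun n : ℕ => stepOp lam N m (t / n : ℝ) ^ n) atTop (𝓝 (truncSemigroup lam N m t)) := by
  have := tendsto_pow_exp_of_hasDerivAt (stepOp_zero N m)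
    (fun h hh => norm_stepOp_le (lam := lam) N m hh) (hasDerivAt_stepOp hlam N m) t.coe_nonneg
  rwa [smul_smul] at this

theorem truncSemigroup_add (s t : ℝ≥0) :
    truncSemigroup lam N m (s + t) = truncSemigroup lam N m s * truncSemigroup lam N m t := by
  let _ : NormedAlgebra ℚ ObservableOp :=
    NormedAlgebra.restrictScalars ℚ ℝ _
  unfold truncSemigroup
  rw [← NormedSpace.exp_add_of_commute]
  · push_cast
    rw [add_mul, add_smul]
  · exact ((Commute.refl _).smul_left _).smul_right _

/-- The weights of the Poisson distribution in the semigroup. -/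
noncomputable def semigroupWeight (lam : ℝ≥0) (m : ℕ) (t : ℝ≥0) (n : ℕ) : ℝ :=
  Real.exp (-(t * totalRate lam m)) * (t * totalRate lam m) ^ n / n.factorial

theorem semigroupWeight_nonneg (t : ℝ≥0) (n : ℕ) : 0 ≤ semigroupWeight lam m t n := by
  unfold semigroupWeight totalRate; positivity

theorem hasSum_semigroupWeight (t : ℝ≥0) : HasSum (semigroupWeight lam m t) 1 := by
  have h := (NormedSpace.expSeries_div_hasSum_exp (t * totalRate lam m : ℝ)).mul_left
    (Real.exp (-(t * totalRate lam m)))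
  rw [← Real.exp_eq_exp_ℝ, ← Real.exp_add, neg_add_cancel, Real.exp_zero] at h
  refine h.congr_fun fun n => ?_
  rw [semigroupWeight, mul_div_assoc]

theorem hasSum_truncSemigroup (t : ℝ≥0) (f : Observable) (q : QueueState) :
    HasSum (fun n => semigroupWeight lam m t n * (jumpOp lam N m ^ n) f q)
      (truncSemigroup lam N m t f q) := by
  have h := (hasSum_exp_smul_apply (jumpOp lam N m) (t * totalRate lam m) f
    (BoundedContinuousFunction.evalCLM ℝ q)).mul_left (Real.exp (-(t * totalRate lam m)))
  have h1 : truncSemigroup lam N m t f q = Real.exp (-(t * totalRate lam m)) *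
      (NormedSpace.exp ((t * totalRate lam m : ℝ) • jumpOp lam N m) f) q := by
    rw [truncSemigroup, exp_smul_sub_one]
    rfl
  rw [h1]
  refine h.congr_fun fun n => ?_
  rw [semigroupWeight, mul_div_assoc, mul_assoc]
  rfl

/-- The Poisson weights are nonnegative and do not depend on the number of sites; order statements
pass from the jump chain to the semigroup. -/
theorem truncSemigroup_le_of_jumpOp_le {M N : ℕ∞} {m : ℕ} (t : ℝ≥0) {f g : Observable}
    {q q' : QueueState} (h : ∀ n, (jumpOp lam M m ^ n) f q ≤ (jumpOp lam N m ^ n) g q') :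
    truncSemigroup lam M m t f q ≤ truncSemigroup lam N m t g q' :=
  hasSum_le (fun n => mul_le_mul_of_nonneg_left (h n) (semigroupWeight_nonneg m t n))
    (hasSum_truncSemigroup M m t f q) (hasSum_truncSemigroup N m t g q')

theorem truncSemigroup_le_const {m : ℕ} {N : ℕ∞} (t : ℝ≥0) {f : Observable} {q : QueueState}
    {c : ℝ} (h : ∀ n, (jumpOp lam N m ^ n) f q ≤ c) : truncSemigroup lam N m t f q ≤ c := by
  have := (hasSum_semigroupWeight (lam := lam) m t).mul_right c
  rw [one_mul] at this
  exact hasSum_le (fun n => mul_le_mul_of_nonneg_left (h n) (semigroupWeight_nonneg m t n))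
    (hasSum_truncSemigroup N m t f q) this

theorem const_le_truncSemigroup {m : ℕ} {N : ℕ∞} (t : ℝ≥0) {f : Observable} {q : QueueState}
    {c : ℝ} (h : ∀ n, c ≤ (jumpOp lam N m ^ n) f q) : c ≤ truncSemigroup lam N m t f q := by
  have := (hasSum_semigroupWeight (lam := lam) m t).mul_right c
  rw [one_mul] at this
  exact hasSum_le (fun n => mul_le_mul_of_nonneg_left (h n) (semigroupWeight_nonneg m t n))
    this (hasSum_truncSemigroup N m t f q)

theorem jumpOp_le_jumpOp {M N : ℕ∞} {m : ℕ} {f g : Observable} {q q' : QueueState}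
    (h : ∀ e, f (afterTick M e q) ≤ g (afterTick N e q')) :
    jumpOp lam M m f q ≤ jumpOp lam N m g q' := by
  rw [jumpOp_apply, jumpOp_apply]
  have : 0 ≤ (totalRate lam m)⁻¹ := by unfold totalRate; positivity
  gcongr
  · exact h _
  · exact h _

theorem jumpOp_pow_succ_apply (n : ℕ) (f : Observable) (q : QueueState) :
    (jumpOp lam N m ^ (n + 1)) f q = jumpOp lam N m ((jumpOp lam N m ^ n) f) q := by
  rw [pow_succ']; rfl

theorem monotone_jumpOp_pow {f : Observable} (hf : Monotone f) (n : ℕ) :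
    Monotone ((jumpOp lam N m ^ n) f) := by
  induction n with
  | zero => exact hf
  | succ n ih =>
    intro q q' hq
    rw [jumpOp_pow_succ_apply, jumpOp_pow_succ_apply]
    exact jumpOp_le_jumpOp fun e => ih (monotone_afterTick N e hq)

/-- After the first step the remaining steps are compared by induction, and the first step by
monotonicity of the iterated observable. -/
theorem jumpOp_pow_mono_sites {M N : ℕ∞} (hMN : M ≤ N) {f : Observable} (hf : Monotone f)
    (n : ℕ) (q : QueueState) : (jumpOp lam M m ^ n) f q ≤ (jumpOp lam N m ^ n) f q := by
  induction n generalizing q with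
  | zero => exact le_rfl
  | succ n ih =>
    rw [jumpOp_pow_succ_apply, jumpOp_pow_succ_apply]
    exact jumpOp_le_jumpOp fun e => (ih _).trans
      (monotone_jumpOp_pow N m hf n (afterTick_mono_sites hMN e q))

include hlam in
theorem jumpOp_const_le {f : Observable} {c : ℝ} (h : ∀ q, f q ≤ c) (q : QueueState) :
    jumpOp lam N m f q ≤ c := by
  have hc := totalRate_pos hlam m
  rw [jumpOp_apply, inv_mul_le_iff₀ hc]
  calc _ ≤ (lam : ℝ) * c + ∑ i ∈ Finset.range m, c := by
        gcongr
        · exact h _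
        · exact h _
    _ = totalRate lam m * c := by simp [totalRate]; ring

include hlam in
theorem jumpOp_pow_le {f : Observable} {c : ℝ} (h : ∀ q, f q ≤ c) (n : ℕ) (q : QueueState) :
    (jumpOp lam N m ^ n) f q ≤ c := by
  induction n generalizing q with
  | zero => exact h q
  | succ n ih => rw [jumpOp_pow_succ_apply]; exact jumpOp_const_le hlam N m ih q

include hlam in
theorem le_jumpOp_pow {f : Observable} {c : ℝ} (h : ∀ q, c ≤ f q) (n : ℕ) (q : QueueState) :
    c ≤ (jumpOp lam N m ^ n) f q := by
  have := jumpOp_pow_le hlam N m (f := -f) (c := -c) (fun q => neg_le_neg (h q)) n q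
  rw [map_neg] at this
  exact neg_le_neg_iff.1 this

include hlam in
theorem le_truncSemigroup (t : ℝ≥0) {f : Observable} {c : ℝ} (h : ∀ q, c ≤ f q)
    (q : QueueState) : c ≤ truncSemigroup lam N m t f q :=
  const_le_truncSemigroup t fun n => le_jumpOp_pow hlam N m h n q

include hlam in
theorem norm_truncSemigroup_apply_le (t : ℝ≥0) (f : Observable) :
    ‖truncSemigroup lam N m t f‖ ≤ ‖f‖ := by
  refine (BoundedContinuousFunction.norm_le (norm_nonneg f)).2 fun q => abs_le.2 ⟨?_, ?_⟩
  · exact le_truncSemigroup hlam N m t (fun q => (abs_le.1 (f.norm_coe_le_norm q)).1) q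
  · exact truncSemigroup_le_const t
      fun n => jumpOp_pow_le hlam N m (fun q => (abs_le.1 (f.norm_coe_le_norm q)).2) n q

theorem monotone_truncSemigroup (t : ℝ≥0) {f : Observable} (hf : Monotone f) :
    Monotone (truncSemigroup lam N m t f) := fun _ _ hq =>
  truncSemigroup_le_of_jumpOp_le t fun n => monotone_jumpOp_pow N m hf n hq

theorem truncSemigroup_mono_sites {M N : ℕ∞} (hMN : M ≤ N) (t : ℝ≥0) {f : Observable}
    (hf : Monotone f) (q : QueueState) :
    truncSemigroup lam M m t f q ≤ truncSemigroup lam N m t f q :=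
  truncSemigroup_le_of_jumpOp_le t fun n => jumpOp_pow_mono_sites m hMN hf n q

end Semigroup

/-! ### Expectations under the clocks as values of the semigroup -/

section Master

theorem prod_map_gridList (lam : ℝ≥0) (N : ℕ∞) (m n : ℕ) (h : ℝ≥0) :
    ((gridList m n).map fun p => lazyTickOp N (tickProb (clockRate lam p.2) h) p.2).prod =
      stepOp lam N m h ^ n := by
  induction n with
  | zero => simp [gridList]
  | succ n ih =>
    rw [gridList_succ, List.map_append, List.prod_append, ih, pow_succ, List.map_map]
    rfl

variable {Ω : Type*} [MeasurableSpace Ω] {P : Measure Ω}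
  {lam : ℝ≥0} {clk : Clock → ℝ≥0 → Ω → ℕ}

theorem measurable_tickFold_clocks (hc : IsDrivingNoise lam P clk) (N : ℕ∞) (h : ℝ≥0)
    (l : List (ℕ × Clock)) {Q₀ : Ω → QueueState} (hQ₀ : Measurable Q₀) :
    Measurable fun ω => tickFold N (gridBits (fun e t => clk e t ω) h) l (Q₀ ω) :=
  (measurable_tickFold_gridBits N h l).comp (hQ₀.prodMk
    (measurable_pi_lambda _ fun e => measurable_pi_lambda _ fun t => (hc.poisson e).measurable t))

variable [IsProbabilityMeasure P]

/-- The first bit is independent of the later ones; conditioning on it peels off one lazy tick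
operator. Operators act on observables, so the earliest tick is the outermost factor. -/
theorem IsDrivingNoise.integral_tickFold (hc : IsDrivingNoise lam P clk) (N : ℕ∞) (h : ℝ≥0)
    {l : List (ℕ × Clock)} (hl : l.Nodup) (f : Observable) (q : QueueState) :
    ∫ ω, f (tickFold N (gridBits (fun e t => clk e t ω) h) l q) ∂P =
      (l.map fun p => lazyTickOp N (tickProb (clockRate lam p.2) h) p.2).prod f q := by
  induction l generalizing q with
  | nil => simp [tickFold]
  | cons p l ih =>
    obtain ⟨hpl, hl⟩ := List.nodup_cons.1 hl
    let bit : ℕ × Clock → Ω → Bool := fun p ω => gridBits (fun e t => clk e t ω) h p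
    have hbm : ∀ p, Measurable (bit p) := hc.measurable_gridBits h
    -- The fold over `l` is a function of finitely many bits; on that finite type all maps are
    -- measurable.
    let ext : (l.toFinset → Bool) → ℕ × Clock → Bool := fun x p =>
      if hp : p ∈ l.toFinset then x ⟨p, hp⟩ else false
    have hext : ∀ ω q, tickFold N (fun p => bit p ω) l q =
        tickFold N (ext fun p => bit p ω) l q := fun ω q =>
      tickFold_congr N (fun p hp => by simp [ext, hp]) q
    have hind : ∀ q, IndepFun (fun ω => if bit p ω = true then (1 : ℝ) else 0)
        (fun ω => f (tickFold N (fun p => bit p ω) l q)) P := by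
      intro q
      have h1 := (hc.iIndepFun_gridBits h).indepFun_finset {p} l.toFinset
        (by simpa using hpl) (hc.measurable_gridBits h)
      have h2 := h1.comp (φ := fun x => if x ⟨p, by simp⟩ = true then (1 : ℝ) else 0)
        (ψ := fun x => f (tickFold N (ext x) l q)) .of_discrete .of_discrete
      simp_rw [hext]
      exact h2
    have hFm : ∀ q, Measurable fun ω => f (tickFold N (fun p => bit p ω) l q) := by
      intro q
      simp_rw [hext]
      exact (Measurable.of_discrete (f := fun x => f (tickFold N (ext x) l q))).comp
        (measurable_pi_lambda _ fun p => hbm p)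
    have h1m : Measurable fun ω => if bit p ω = true then (1 : ℝ) else 0 :=
      (Measurable.of_discrete (f := fun b : Bool => if b = true then (1 : ℝ) else 0)).comp (hbm p)
    have hFi : ∀ q, Integrable (fun ω => f (tickFold N (fun p => bit p ω) l q)) P := fun q =>
      (integrable_const ‖f‖).mono' (hFm q).aestronglyMeasurable
        (Eventually.of_forall fun ω => f.norm_coe_le_norm _)
    have hprodi : ∀ q, Integrable (fun ω => (if bit p ω = true then (1 : ℝ) else 0) *
        f (tickFold N (fun p => bit p ω) l q)) P := fun q =>
      (hFi q).bdd_mul (c := 1) h1m.aestronglyMeasurable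
        (Eventually.of_forall fun ω => by split_ifs <;> simp)
    have hE1 : ∫ ω, (if bit p ω = true then (1 : ℝ) else 0) ∂P =
        tickProb (clockRate lam p.2) h := by
      have h1 : (fun ω => if bit p ω = true then (1 : ℝ) else 0) =
          Set.indicator {ω | bit p ω = true} (fun _ => (1 : ℝ)) := by
        ext ω; simp [Set.indicator_apply]
      have hset : MeasurableSet {ω | bit p ω = true} := hbm p (measurableSet_singleton true)
      rw [h1, integral_indicator_const _ hset, measureReal_def,
        hc.measure_gridBits h p, ENNReal.toReal_ofReal (tickProb_nonneg _ _), smul_eq_mul, mul_one]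
    have hsplit : ∀ ω, f (tickFold N (fun p => bit p ω) (p :: l) q) =
        (if bit p ω = true then (1 : ℝ) else 0) *
          f (tickFold N (fun p => bit p ω) l (afterTick N p.2 q)) +
        (f (tickFold N (fun p => bit p ω) l q) -
          (if bit p ω = true then (1 : ℝ) else 0) * f (tickFold N (fun p => bit p ω) l q)) := by
      intro ω
      rw [tickFold_cons]
      split_ifs <;> simp
    change ∫ ω, f (tickFold N (fun p => bit p ω) (p :: l) q) ∂P = _
    simp_rw [hsplit]
    have hmul : ∀ q, ∫ ω, (if bit p ω = true then (1 : ℝ) else 0) *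
        f (tickFold N (fun p => bit p ω) l q) ∂P = tickProb (clockRate lam p.2) h *
          (l.map fun p => lazyTickOp N (tickProb (clockRate lam p.2) h) p.2).prod f q := by
      intro q
      rw [(hind q).integral_fun_mul_eq_mul_integral h1m.aestronglyMeasurable
        (hFm q).aestronglyMeasurable, hE1, ← ih hl q]
    have hsub : ∀ q, Integrable (fun ω => f (tickFold N (fun p => bit p ω) l q) -
        (if bit p ω = true then (1 : ℝ) else 0) * f (tickFold N (fun p => bit p ω) l q)) P :=
      fun q => (hFi q).sub (hprodi q)
    rw [integral_add (hprodi _) (hsub _), integral_sub (hFi _) (hprodi _), hmul,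
      hmul, List.map_cons, List.prod_cons]
    have hmain : (lazyTickOp N (tickProb (clockRate lam p.2) h) p.2 *
        (l.map fun p => lazyTickOp N (tickProb (clockRate lam p.2) h) p.2).prod) f q =
        lazyTickOp N (tickProb (clockRate lam p.2) h) p.2
        ((l.map fun p => lazyTickOp N (tickProb (clockRate lam p.2) h) p.2).prod f) q := rfl
    rw [hmain, lazyTickOp_apply, show ∫ ω, f (tickFold N (fun p => bit p ω) l q) ∂P = _ from ih hl q]
    ring

theorem IsDrivingNoise.integral_tickFold_init (hc : IsDrivingNoise lam P clk) (N : ℕ∞) (h : ℝ≥0)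
    (m n : ℕ) {Q₀ : Ω → QueueState} (hQ₀ : Measurable Q₀)
    (hind : IndepFun Q₀ (fun (ω : Ω) (e : Clock) (t : ℝ≥0) => clk e t ω) P) (f : Observable) :
    ∫ ω, f (tickFold N (gridBits (fun e t => clk e t ω) h) (gridList m n) (Q₀ ω)) ∂P =
      ∫ ω, (stepOp lam N m h ^ n) f (Q₀ ω) ∂P := by
  have hnm : Measurable (fun (ω : Ω) (e : Clock) (t : ℝ≥0) => clk e t ω) :=
    measurable_pi_lambda _ fun e => measurable_pi_lambda _ fun t => (hc.poisson e).measurable t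
  have hGm : Measurable fun x : QueueState × (Clock → ℝ≥0 → ℕ) =>
      f (tickFold N (gridBits x.2 h) (gridList m n) x.1) :=
    f.continuous.measurable.comp (measurable_tickFold_gridBits N h (gridList m n))
  have hGq : ∀ q : QueueState, Measurable fun a : Clock → ℝ≥0 → ℕ =>
      f (tickFold N (gridBits a h) (gridList m n) q) := fun q => hGm.comp measurable_prodMk_left
  have hmap := (indepFun_iff_map_prod_eq_prod_map_map hQ₀.aemeasurable hnm.aemeasurable).1 hind
  have := Measure.isProbabilityMeasure_map (μ := P) hQ₀.aemeasurable
  have := Measure.isProbabilityMeasure_map (μ := P) hnm.aemeasurable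
  calc ∫ ω, f (tickFold N (gridBits (fun e t => clk e t ω) h) (gridList m n) (Q₀ ω)) ∂P
      = ∫ x, f (tickFold N (gridBits x.2 h) (gridList m n) x.1)
          ∂(P.map fun ω => (Q₀ ω, fun (e : Clock) (t : ℝ≥0) => clk e t ω)) := by
        rw [integral_map (hQ₀.prodMk hnm).aemeasurable hGm.aestronglyMeasurable]
    _ = ∫ q, ∫ a, f (tickFold N (gridBits a h) (gridList m n) q)
          ∂(P.map fun ω (e : Clock) (t : ℝ≥0) => clk e t ω) ∂(P.map Q₀) := by
        rw [hmap, integral_prod]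
        exact (integrable_const ‖f‖).mono' hGm.aestronglyMeasurable
          (Eventually.of_forall fun ω => f.norm_coe_le_norm _)
    _ = ∫ q, (stepOp lam N m h ^ n) f q ∂(P.map Q₀) := by
        refine integral_congr_ae (Eventually.of_forall fun q => ?_)
        dsimp only
        rw [integral_map hnm.aemeasurable (hGq q).aestronglyMeasurable,
          hc.integral_tickFold N h (nodup_gridList m n), prod_map_gridList]
    _ = _ := by
        rw [integral_map hQ₀.aemeasurable
          ((stepOp lam N m h ^ n) f).continuous.measurable.aestronglyMeasurable]

theorem tendsto_integral_apply {f : ℕ → Observable} {g : Observable} (hf : Tendsto f atTop (𝓝 g))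
    {Q₀ : Ω → QueueState} (hQ₀ : Measurable Q₀) :
    Tendsto (fun n => ∫ ω, f n (Q₀ ω) ∂P) atTop (𝓝 (∫ ω, g (Q₀ ω) ∂P)) := by
  have hi : ∀ g : Observable, Integrable (fun ω => g (Q₀ ω)) P := fun g =>
    (integrable_const ‖g‖).mono' (g.continuous.measurable.comp hQ₀).aestronglyMeasurable
      (Eventually.of_forall fun ω => g.norm_coe_le_norm _)
  rw [tendsto_iff_norm_sub_tendsto_zero] at hf ⊢
  refine squeeze_zero (fun _ => norm_nonneg _) (fun n => ?_) hf
  rw [← integral_sub (hi _) (hi _)]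
  have := norm_integral_le_of_norm_le_const (μ := P) (f := fun ω => f n (Q₀ ω) - g (Q₀ ω))
    (C := ‖f n - g‖) (Eventually.of_forall fun ω => (f n - g).norm_coe_le_norm (Q₀ ω))
  simpa using this

theorem IsDrivingNoise.ae_tendsto_tickFold (hc : IsDrivingNoise lam P clk) (N : ℕ∞) (m : ℕ)
    (Q₀ : Ω → QueueState) (t : ℝ≥0) :
    ∀ᵐ ω ∂P, Tendsto (fun n : ℕ =>
      tickFold N (gridBits (fun e t => clk e t ω) (t / (n : ℝ≥0))) (gridList m n) (Q₀ ω)) atTop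
      (𝓝 (queuePath N (Q₀ ω) (truncateClocks m fun e t => clk e t ω) t)) := by
  filter_upwards [hc.ae_goodClocks] with ω hω
  exact tendsto_const_nhds.congr' ((hω.eventually_tickFold_eq N (Q₀ ω) m t).mono fun n h => h.symm)

/-- `queuePath` is obtained by choice, so its measurability comes from the discretizations that
converge to it. -/
theorem IsDrivingNoise.aemeasurable_truncate (hc : IsDrivingNoise lam P clk) (N : ℕ∞) (m : ℕ)
    {Q₀ : Ω → QueueState} (hQ₀ : Measurable Q₀) (t : ℝ≥0) :
    AEMeasurable (fun ω => queuePath N (Q₀ ω) (truncateClocks m fun e t => clk e t ω) t) P :=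
  aemeasurable_of_tendsto_metrizable_ae atTop
    (fun n : ℕ => (measurable_tickFold_clocks hc N (t / (n : ℝ≥0)) (gridList m n) hQ₀).aemeasurable)
    (hc.ae_tendsto_tickFold N m Q₀ t)

/-- The expectations on the grid have two limits that must agree: by dominated convergence along the
paths, and by the power formula for the operators. -/
theorem IsDrivingNoise.integral_queuePath_truncate (hlam : 0 < lam) (hc : IsDrivingNoise lam P clk)
    (N : ℕ∞) (m : ℕ) {Q₀ : Ω → QueueState} (hQ₀ : Measurable Q₀)
    (hind : IndepFun Q₀ (fun (ω : Ω) (e : Clock) (t : ℝ≥0) => clk e t ω) P) (t : ℝ≥0)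
    (f : Observable) :
    ∫ ω, f (queuePath N (Q₀ ω) (truncateClocks m fun e t => clk e t ω) t) ∂P =
      ∫ ω, truncSemigroup lam N m t f (Q₀ ω) ∂P := by
  have h1 : Tendsto (fun n : ℕ => ∫ ω, f (tickFold N (gridBits (fun e t => clk e t ω) (t / (n : ℝ≥0)))
      (gridList m n) (Q₀ ω)) ∂P) atTop
      (𝓝 (∫ ω, f (queuePath N (Q₀ ω) (truncateClocks m fun e t => clk e t ω) t) ∂P)) := by
    refine tendsto_integral_of_dominated_convergence (fun _ => ‖f‖) (fun n => ?_)
      (integrable_const _) (fun n => Eventually.of_forall fun ω => f.norm_coe_le_norm _) ?_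
    · exact (f.continuous.measurable.comp
        (measurable_tickFold_clocks hc N (t / (n : ℝ≥0)) (gridList m n) hQ₀)).aestronglyMeasurable
    · filter_upwards [hc.ae_tendsto_tickFold N m Q₀ t] with ω hω
      exact (f.continuous.tendsto _).comp hω
  have h2 : Tendsto (fun n : ℕ => ∫ ω, (stepOp lam N m (t / n : ℝ) ^ n) f (Q₀ ω) ∂P) atTop
      (𝓝 (∫ ω, truncSemigroup lam N m t f (Q₀ ω) ∂P)) := by
    refine tendsto_integral_apply ?_ hQ₀
    exact ((ContinuousLinearMap.apply ℝ Observable f).continuous.tendsto _).comp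
      (tendsto_stepOp_pow hlam N m t)
  refine tendsto_nhds_unique h1 (h2.congr fun n => ?_)
  have := hc.integral_tickFold_init N (t / (n : ℝ≥0)) m n hQ₀ hind f
  rw [this]
  push_cast
  rfl

theorem IsDrivingNoise.tendsto_integral_queuePath (hlam : 0 < lam) (hc : IsDrivingNoise lam P clk)
    (N : ℕ∞) {Q₀ : Ω → QueueState} (hQ₀ : Measurable Q₀)
    (hind : IndepFun Q₀ (fun (ω : Ω) (e : Clock) (t : ℝ≥0) => clk e t ω) P) (t : ℝ≥0)
    (f : Observable) :
    Tendsto (fun m => ∫ ω, truncSemigroup lam N m t f (Q₀ ω) ∂P) atTop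
      (𝓝 (∫ ω, f (queuePath N (Q₀ ω) (fun e t => clk e t ω) t) ∂P)) := by
  simp_rw [← hc.integral_queuePath_truncate hlam N _ hQ₀ hind t f]
  refine tendsto_integral_of_dominated_convergence (fun _ => ‖f‖) (fun m => ?_)
    (integrable_const _) (fun n => Eventually.of_forall fun ω => f.norm_coe_le_norm _) ?_
  · exact (f.continuous.measurable.comp_aemeasurable
      (hc.aemeasurable_truncate N m hQ₀ t)).aestronglyMeasurable
  · filter_upwards [hc.ae_goodClocks] with ω hω
    exact (f.continuous.tendsto _).comp (hω.tendsto_queuePath_truncate N (Q₀ ω) t)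

end Master

/-! ### Uniform approximation by observables of finitely many sites -/

section Cutoff

/-- The configuration in which the queues from number `K` on are emptied. -/
noncomputable def cutoff (K : ℕ∞) (q : QueueState) : QueueState :=
  fun i => if (i : ℕ∞) < K then q i else 0

theorem continuous_cutoff : Continuous fun x : ℕ∞ × QueueState => cutoff x.1 x.2 := by
  refine continuous_pi fun i => ?_
  have hset : {x : ℕ∞ × QueueState | (i : ℕ∞) < x.1} = Prod.fst ⁻¹' (Set.Ici ((i + 1 : ℕ) : ℕ∞)) := by
    ext x
    simp [ENat.add_one_le_iff]
  have hclopen : IsClopen {x : ℕ∞ × QueueState | (i : ℕ∞) < x.1} := by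
    refine ⟨?_, isOpen_lt continuous_const continuous_fst⟩
    rw [hset]
    exact isClosed_Ici.preimage continuous_fst
  exact continuous_if (fun x hx => by simp [hclopen.frontier_eq] at hx)
    ((continuous_apply i).comp continuous_snd).continuousOn continuousOn_const

/-- The observable that sees only the first `K` queues. -/
noncomputable def cutoffObservable (K : ℕ) (f : Observable) : Observable :=
  f.compContinuous ⟨cutoff K, continuous_cutoff.comp (Continuous.prodMk_right (K : ℕ∞))⟩

theorem cutoffObservable_apply (K : ℕ) (f : Observable) (q : QueueState) :
    cutoffObservable K f q = f (cutoff K q) := rfl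

theorem norm_cutoffObservable_le (K : ℕ) (f : Observable) : ‖cutoffObservable K f‖ ≤ ‖f‖ :=
  (BoundedContinuousFunction.norm_le (norm_nonneg _)).2 fun _ => f.norm_coe_le_norm _

theorem cutoffObservable_congr (K : ℕ) (f : Observable) {q q' : QueueState}
    (h : ∀ k < K, q k = q' k) : cutoffObservable K f q = cutoffObservable K f q' := by
  rw [cutoffObservable_apply, cutoffObservable_apply]
  congr 1
  funext k
  unfold cutoff
  split_ifs with hk
  · exact h k (by exact_mod_cast hk)
  · rfl

/-- The map `(K, q) ↦ cutoff K q` is jointly continuous up to `K = ⊤`, where it is the identity in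
`q`; compactness of the space of configurations makes the approximation uniform. This is why the
cutoff level ranges over `ℕ∞`. -/
theorem exists_norm_sub_cutoffObservable_le (f : Observable) {ε : ℝ} (hε : 0 < ε) :
    ∃ K, ‖f - cutoffObservable K f‖ ≤ ε := by
  have h1 : ∀ᶠ K : ℕ∞ in 𝓝 ⊤, ∀ q ∈ Set.univ, |f q - f (cutoff K q)| < ε := by
    refine isCompact_univ.eventually_forall_of_forall_eventually fun q _ => ?_
    have hc : Continuous fun x : ℕ∞ × QueueState => |f x.2 - f (cutoff x.1 x.2)| :=
      ((f.continuous.comp continuous_snd).sub (f.continuous.comp continuous_cutoff)).abs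
    have h0 : |f q - f (cutoff ⊤ q)| < ε := by
      have : cutoff ⊤ q = q := by funext i; simp [cutoff]
      simpa [this] using hε
    exact (hc.tendsto (⊤, q)).eventually (gt_mem_nhds h0)
  have h2 : Tendsto (fun K : ℕ => (K : ℕ∞)) atTop (𝓝 ⊤) := ENat.tendsto_natCast_nhds_top
  obtain ⟨K, hK⟩ := (h2.eventually h1).exists
  refine ⟨K, (BoundedContinuousFunction.norm_le hε.le).2 fun q => ?_⟩
  exact (hK q trivial).le

end Cutoff

/-! ### The Feller semigroup of the full system -/

section Limit

/-- The expectation of `f` at time `t` for the system started from `q`. -/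
noncomputable def queueMean (lam : ℝ≥0) (N : ℕ∞) (t : ℝ≥0) (f : Observable) (q : QueueState) : ℝ :=
  ∫ ω, f (queuePath N q (fun e t => noiseClocks e t ω) t) ∂(noiseMeasure lam)

variable {lam : ℝ≥0}

theorem indepFun_const_noiseClocks (q : QueueState) :
    IndepFun (fun _ => q) (fun ω (e : Clock) (t : ℝ≥0) => noiseClocks e t ω)
      (noiseMeasure lam) := indepFun_const_left _ _

theorem integrable_queueMean (N : ℕ∞) (t : ℝ≥0) (f : Observable)
    (q : QueueState) :
    Integrable (fun ω => f (queuePath N q (fun e t => noiseClocks e t ω) t)) (noiseMeasure lam) := by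
  have hm : AEMeasurable (fun ω => queuePath N q (fun e t => noiseClocks e t ω) t)
      (noiseMeasure lam) := by
    refine aemeasurable_of_tendsto_metrizable_ae atTop (fun m =>
      (isDrivingNoise_noiseClocks lam).aemeasurable_truncate N m (measurable_const (a := q)) t) ?_
    filter_upwards [(isDrivingNoise_noiseClocks lam).ae_goodClocks] with ω hω
    exact hω.tendsto_queuePath_truncate N q t
  exact (integrable_const ‖f‖).mono' (f.continuous.measurable.comp_aemeasurable hm).aestronglyMeasurable
    (Eventually.of_forall fun ω => f.norm_coe_le_norm _)

theorem tendsto_truncSemigroup_apply (hlam : 0 < lam) (N : ℕ∞) (t : ℝ≥0) (f : Observable)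
    (q : QueueState) :
    Tendsto (fun m => truncSemigroup lam N m t f q) atTop (𝓝 (queueMean lam N t f q)) := by
  have h := (isDrivingNoise_noiseClocks lam).tendsto_integral_queuePath hlam N
    (measurable_const (a := q)) (indepFun_const_noiseClocks q) t f
  simp only [integral_const, probReal_univ, one_smul] at h
  exact h

/-- On the first `K` sites the full and the truncated path can differ only if no site between `K`
and `m` is silent. The bound involves neither the configuration nor `N`. -/
theorem abs_truncSemigroup_sub_queueMean_le (hlam : 0 < lam) (N : ℕ∞) (t : ℝ≥0) (f : Observable)
    {K m : ℕ} (hf : ∀ q q' : QueueState, (∀ k < K, q k = q' k) → f q = f q') (q : QueueState) :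
    |truncSemigroup lam N m t f q - queueMean lam N t f q| ≤
      2 * ‖f‖ * tickProb 1 t ^ (m - K) := by
  have hc := isDrivingNoise_noiseClocks lam
  have h1 := hc.integral_queuePath_truncate hlam N m (measurable_const (a := q))
    (indepFun_const_noiseClocks q) t f
  simp only [integral_const, probReal_univ, one_smul] at h1
  have hi1 : Integrable (fun ω => f (queuePath N q (truncateClocks m fun e t => noiseClocks e t ω) t))
      (noiseMeasure lam) := (integrable_const ‖f‖).mono' (f.continuous.measurable.comp_aemeasurable
        (hc.aemeasurable_truncate N m (measurable_const (a := q)) t)).aestronglyMeasurable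
    (Eventually.of_forall fun ω => f.norm_coe_le_norm _)
  let B := {ω | ∀ i, K ≤ i → i < m → noiseClocks (some i) t ω ≠ 0}
  have hB : MeasurableSet B := by
    have : B = ⋂ i : ℕ, ⋂ (_ : K ≤ i), ⋂ (_ : i < m), {ω | noiseClocks (some i) t ω ≠ 0} := by
      ext ω; simp [B]
    rw [this]
    exact .iInter fun i => .iInter fun _ => .iInter fun _ =>
      (hc.poisson (some i)).measurable t (measurableSet_singleton 0).compl
  rw [← h1, queueMean, ← integral_sub hi1 (integrable_queueMean N t f q)]
  have hbound : ∀ᵐ ω ∂(noiseMeasure lam),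
      ‖f (queuePath N q (truncateClocks m fun e t => noiseClocks e t ω) t) -
        f (queuePath N q (fun e t => noiseClocks e t ω) t)‖ ≤
      B.indicator (fun _ => 2 * ‖f‖) ω := by
    filter_upwards [hc.ae_goodClocks] with ω hω
    by_cases hb : ω ∈ B
    · rw [Set.indicator_of_mem hb, two_mul]
      exact (norm_sub_le _ _).trans (add_le_add (f.norm_coe_le_norm _) (f.norm_coe_le_norm _))
    · rw [Set.indicator_of_notMem hb]
      simp only [B, Set.mem_ofPred_eq, not_forall, not_not] at hb
      obtain ⟨i, hKi, him, hi⟩ := hb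
      rw [hf _ _ fun k hk => hω.queuePath_truncate_eq N q him.le hi k (hk.le.trans hKi), sub_self,
        norm_zero]
  refine (norm_integral_le_of_norm_le ((integrable_const _).indicator hB) hbound).trans ?_
  rw [integral_indicator_const _ hB, smul_eq_mul, mul_comm]
  refine mul_le_mul_of_nonneg_left ?_ (by positivity)
  rw [measureReal_def]
  exact ENNReal.toReal_le_of_le_ofReal (pow_nonneg (tickProb_nonneg _ _) _)
    (hc.measure_not_silent_le K m t)

theorem abs_queueMean_sub_le (N : ℕ∞) (t : ℝ≥0) (f g : Observable)
    (q : QueueState) : |queueMean lam N t f q - queueMean lam N t g q| ≤ ‖f - g‖ := by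
  rw [queueMean, queueMean, ← integral_sub (integrable_queueMean N t f q)
    (integrable_queueMean N t g q)]
  simpa using norm_integral_le_of_norm_le_const (μ := noiseMeasure lam) (C := ‖f - g‖)
    (Eventually.of_forall fun ω =>
      (f - g).norm_coe_le_norm (queuePath N q (fun e t => noiseClocks e t ω) t))

/-- Uniformity in `q` makes the limit continuous; uniformity in `N` permits the limit of infinitely
many sites. -/
theorem eventually_truncSemigroup_sub_queueMean_le (hlam : 0 < lam) (t : ℝ≥0) (f : Observable)
    {ε : ℝ} (hε : 0 < ε) :
    ∀ᶠ m in atTop, ∀ N q, |truncSemigroup lam N m t f q - queueMean lam N t f q| ≤ ε := by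
  obtain ⟨K, hK⟩ := exists_norm_sub_cutoffObservable_le f (ε := ε / 3) (by positivity)
  have hpow : Tendsto (fun m => 2 * ‖f‖ * tickProb 1 t ^ (m - K)) atTop (𝓝 (2 * ‖f‖ * 0)) :=
    ((tendsto_pow_atTop_nhds_zero_of_lt_one (tickProb_nonneg _ _) (tickProb_lt_one _ _)).comp
      (tendsto_sub_atTop_nat K)).const_mul _
  rw [mul_zero] at hpow
  filter_upwards [hpow.eventually (gt_mem_nhds (show 0 < ε / 3 by positivity))] with m hm N q
  have h1 := abs_truncSemigroup_sub_queueMean_le hlam N t (cutoffObservable K f) (m := m)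
    (fun q q' => cutoffObservable_congr K f) q
  have h2 := abs_queueMean_sub_le (lam := lam) N t (cutoffObservable K f) f q
  have h3 := norm_truncSemigroup_apply_le hlam N m t (f - cutoffObservable K f)
  have h4 := (truncSemigroup lam N m t (f - cutoffObservable K f)).norm_coe_le_norm q
  rw [map_sub, BoundedContinuousFunction.coe_sub, Pi.sub_apply, Real.norm_eq_abs] at h4
  have h5 : 2 * ‖cutoffObservable K f‖ * tickProb 1 t ^ (m - K) ≤
      2 * ‖f‖ * tickProb 1 t ^ (m - K) := by
    have := pow_nonneg (tickProb_nonneg 1 t) (m - K)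
    have := norm_cutoffObservable_le K f
    gcongr
  rw [norm_sub_rev] at h2
  rw [map_sub] at h3
  have := abs_sub_le (truncSemigroup lam N m t f q) (truncSemigroup lam N m t (cutoffObservable K f) q)
    (queueMean lam N t f q)
  have := abs_sub_le (truncSemigroup lam N m t (cutoffObservable K f) q)
    (queueMean lam N t (cutoffObservable K f) q) (queueMean lam N t f q)
  linarith

/-- The Markov semigroup of the system with `N` sites, acting on bounded continuous functions. -/
noncomputable def queueSemigroup (hlam : 0 < lam) (N : ℕ∞) (t : ℝ≥0) (f : Observable) :
    Observable :=
  BoundedContinuousFunction.mkOfCompact ⟨queueMean lam N t f, by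
    have h : TendstoUniformly (fun m q => truncSemigroup lam N m t f q) (queueMean lam N t f)
        atTop := by
      rw [Metric.tendstoUniformly_iff]
      intro ε hε
      filter_upwards [eventually_truncSemigroup_sub_queueMean_le hlam t f (half_pos hε)] with m hm q
      rw [dist_comm, Real.dist_eq]
      exact (hm N q).trans_lt (half_lt_self hε)
    exact h.continuous (Frequently.of_forall fun m => (truncSemigroup lam N m t f).continuous)⟩

theorem tendsto_truncSemigroup_queueSemigroup_apply (hlam : 0 < lam) (N : ℕ∞) (t : ℝ≥0)
    (f : Observable) (q : QueueState) :
    Tendsto (fun m => truncSemigroup lam N m t f q) atTop (𝓝 (queueSemigroup hlam N t f q)) :=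
  tendsto_truncSemigroup_apply hlam N t f q

theorem tendsto_truncSemigroup (hlam : 0 < lam) (N : ℕ∞) (t : ℝ≥0) (f : Observable) :
    Tendsto (fun m => truncSemigroup lam N m t f) atTop (𝓝 (queueSemigroup hlam N t f)) := by
  rw [Metric.tendsto_nhds]
  intro ε hε
  filter_upwards [eventually_truncSemigroup_sub_queueMean_le hlam t f (half_pos hε)] with m hm
  refine ((BoundedContinuousFunction.dist_le (half_pos hε).le).2 fun q => ?_).trans_lt
    (half_lt_self hε)
  rw [Real.dist_eq]
  exact hm N q

/-- The Markov property is inherited from the exponentials through convergence in norm and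
contractivity, without any argument on paths. -/
theorem queueSemigroup_add (hlam : 0 < lam) (N : ℕ∞) (s t : ℝ≥0) (f : Observable) :
    queueSemigroup hlam N (s + t) f = queueSemigroup hlam N s (queueSemigroup hlam N t f) := by
  refine tendsto_nhds_unique (tendsto_truncSemigroup hlam N (s + t) f) ?_
  have h1 := tendsto_truncSemigroup hlam N s (queueSemigroup hlam N t f)
  refine tendsto_of_tendsto_of_dist h1 ?_
  have h2 := tendsto_truncSemigroup hlam N t f
  rw [tendsto_iff_dist_tendsto_zero] at h2
  refine squeeze_zero (fun _ => dist_nonneg) (fun m => ?_) h2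
  rw [truncSemigroup_add, dist_comm, dist_eq_norm, dist_eq_norm]
  change ‖truncSemigroup lam N m s (truncSemigroup lam N m t f) - _‖ ≤ _
  rw [← map_sub]
  exact norm_truncSemigroup_apply_le hlam N m s _

theorem le_queueSemigroup (hlam : 0 < lam) (N : ℕ∞) (t : ℝ≥0) {f : Observable} {c : ℝ}
    (h : ∀ q, c ≤ f q) (q : QueueState) : c ≤ queueSemigroup hlam N t f q :=
  ge_of_tendsto' (tendsto_truncSemigroup_apply hlam N t f q) fun m =>
    le_truncSemigroup hlam N m t h q

theorem monotone_queueSemigroup (hlam : 0 < lam) (N : ℕ∞) (t : ℝ≥0) {f : Observable}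
    (hf : Monotone f) : Monotone (queueSemigroup hlam N t f) := fun _ _ hq =>
  le_of_tendsto_of_tendsto' (tendsto_truncSemigroup_apply hlam N t f _)
    (tendsto_truncSemigroup_apply hlam N t f _) fun m => monotone_truncSemigroup N m t hf hq

theorem queueSemigroup_mono_sites (hlam : 0 < lam) {M N : ℕ∞} (hMN : M ≤ N) (t : ℝ≥0)
    {f : Observable} (hf : Monotone f) (q : QueueState) :
    queueSemigroup hlam M t f q ≤ queueSemigroup hlam N t f q :=
  le_of_tendsto_of_tendsto' (tendsto_truncSemigroup_apply hlam M t f _)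
    (tendsto_truncSemigroup_apply hlam N t f _) fun m =>
      truncSemigroup_mono_sites m hMN t hf q

theorem afterTick_of_succ_lt {M N : ℕ∞} {i : ℕ} (hM : ((i + 1 : ℕ) : ℕ∞) < M)
    (hN : ((i + 1 : ℕ) : ℕ∞) < N) : afterTick M (some i) = afterTick N (some i) := by
  funext q
  simp only [afterTick, hM, hN]

/-- The exit is felt only when the last of the `N` sites serves, and the clocks `some i` with `i < m
< N` do not include it. -/
theorem truncSemigroup_eq_top (N : ℕ∞) {m : ℕ} (hm : (m : ℕ∞) < N) (t : ℝ≥0) :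
    truncSemigroup lam N m t = truncSemigroup lam ⊤ m t := by
  have h : jumpOp lam N m = jumpOp lam ⊤ m := by
    ext f q
    rw [jumpOp_apply, jumpOp_apply]
    congr 2
    refine Finset.sum_congr rfl fun i hi => ?_
    rw [afterTick_of_succ_lt (M := N) (N := ⊤) _ (ENat.natCast_lt_top _)]
    exact lt_of_le_of_lt (by exact_mod_cast Finset.mem_range.1 hi) hm
  rw [truncSemigroup, truncSemigroup, h]

theorem tendsto_queueSemigroup_sites (hlam : 0 < lam) (t : ℝ≥0) (f : Observable) (q : QueueState) :
    Tendsto (fun N : ℕ => queueSemigroup hlam N t f q) atTop (𝓝 (queueSemigroup hlam ⊤ t f q)) := by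
  rw [Metric.tendsto_nhds]
  intro ε hε
  obtain ⟨m, hm⟩ := (eventually_truncSemigroup_sub_queueMean_le hlam t f
    (show 0 < ε / 3 by positivity)).exists
  filter_upwards [eventually_gt_atTop m] with N hN
  have h1 := hm N q
  have h2 := hm ⊤ q
  rw [truncSemigroup_eq_top (lam := lam) N (by exact_mod_cast hN) t] at h1
  rw [abs_sub_comm] at h1
  rw [Real.dist_eq]
  change |queueMean lam N t f q - queueMean lam ⊤ t f q| < ε
  have := abs_sub_le (queueMean lam N t f q) (truncSemigroup lam ⊤ m t f q) (queueMean lam ⊤ t f q)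
  linarith

/-- Almost surely the path of a version is the one determined by its clocks and its initial
configuration. All later statements about laws pass through this identity. -/
theorem IsBackPressureProcess.integral_eq (hlam : 0 < lam) {Ω : Type*} [MeasurableSpace Ω]
    {P : Measure Ω} [IsProbabilityMeasure P] {N : ℕ∞} {Q : ℝ≥0 → Ω → QueueState}
    (hQ : IsBackPressureProcess lam N P Q) (t : ℝ≥0) (f : Observable) :
    ∫ ω, f (Q t ω) ∂P = ∫ ω, queueSemigroup hlam N t f (Q 0 ω) ∂P := by
  obtain ⟨clk, hc, hind, hfol⟩ := hQ.dynamics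
  have h1 := hc.tendsto_integral_queuePath hlam N (hQ.measurable 0) hind t f
  have h2 := tendsto_integral_apply (P := P) (tendsto_truncSemigroup hlam N t f) (hQ.measurable 0)
  rw [← tendsto_nhds_unique h1 h2]
  refine integral_congr_ae ?_
  filter_upwards [hc.ae_goodClocks, hfol] with ω hω hq
  have := hω.eq_queuePath hq
  exact congrArg f (congrFun this t)

end Limit

/-! ### Increasing events and monotone observables -/

section UpperApprox

/-- The configurations that dominate a member of `C` as far as this can be seen from the first `n`
queues, truncated at level `n`. -/
def upperApprox (C : Set QueueState) (n : ℕ) : Set QueueState :=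
  {q | ∃ c ∈ C, ∀ p ∈ Finset.range n ×ˢ Finset.range n, (p.2 : ℕ∞) ≤ c p.1 → (p.2 : ℕ∞) ≤ q p.1}

theorem subset_upperApprox (C : Set QueueState) (n : ℕ) : C ⊆ upperApprox C n :=
  fun c hc => ⟨c, hc, fun _ _ h => h⟩

theorem isUpperSet_upperApprox (C : Set QueueState) (n : ℕ) : IsUpperSet (upperApprox C n) :=
  fun _ _ hq ⟨c, hc, h⟩ => ⟨c, hc, fun p hp hpc => (h p hp hpc).trans (hq p.1)⟩

theorem antitone_upperApprox (C : Set QueueState) : Antitone (upperApprox C) :=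
  fun _ _ hmn _ ⟨c, hc, h⟩ => ⟨c, hc, fun p hp =>
    h p (Finset.product_subset_product (Finset.range_subset_range.2 hmn)
      (Finset.range_subset_range.2 hmn) hp)⟩

theorem isClopen_natCast_le_apply (i a : ℕ) : IsClopen {q : QueueState | (a : ℕ∞) ≤ q i} := by
  refine ⟨isClosed_Ici.preimage (continuous_apply i), ?_⟩
  cases a with
  | zero => simp
  | succ a =>
    have : {q : QueueState | ((a + 1 : ℕ) : ℕ∞) ≤ q i} = {q | (a : ℕ∞) < q i} := by
      ext q
      simp [ENat.add_one_le_iff]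
    rw [this]
    exact isOpen_Ioi.preimage (continuous_apply i)

/-- Only finitely many sets of thresholds inside the `n × n` square occur, and each threshold
condition is clopen. -/
theorem isClopen_upperApprox (C : Set QueueState) (n : ℕ) : IsClopen (upperApprox C n) := by
  let S : Set (Finset (ℕ × ℕ)) := {T | T ⊆ Finset.range n ×ˢ Finset.range n ∧
    ∃ c ∈ C, ∀ p ∈ Finset.range n ×ˢ Finset.range n, (p.2 : ℕ∞) ≤ c p.1 → p ∈ T}
  have hS : S.Finite :=
    (Finset.finite_toSet (Finset.range n ×ˢ Finset.range n).powerset).subset fun _ hT =>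
      Finset.mem_coe.2 (Finset.mem_powerset.2 hT.1)
  have h : upperApprox C n = ⋃ T ∈ S, ⋂ p ∈ T, {q : QueueState | (p.2 : ℕ∞) ≤ q p.1} := by
    ext q
    simp only [Set.mem_iUnion, Set.mem_iInter, exists_prop]
    constructor
    · rintro ⟨c, hc, hq⟩
      refine ⟨(Finset.range n ×ˢ Finset.range n).filter fun p => (p.2 : ℕ∞) ≤ c p.1,
        ⟨Finset.filter_subset _ _, c, hc, fun p hp hpc => Finset.mem_filter.2 ⟨hp, hpc⟩⟩,
        fun p hp => hq p (Finset.mem_filter.1 hp).1 (Finset.mem_filter.1 hp).2⟩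
    · rintro ⟨T, ⟨-, c, hc, hcT⟩, hq⟩
      exact ⟨c, hc, fun p hp hpc => hq p (hcT p hp hpc)⟩
  rw [h]
  exact hS.isClopen_biUnion fun T _ => isClopen_biInter_finset fun p _ =>
    isClopen_natCast_le_apply p.1 p.2

/-- By compactness of `C` the witnesses at all levels `n` can be replaced by a single `c ∈ C`, and
then `c ≤ q`. -/
theorem IsClosed.iInter_upperApprox_subset {C U : Set QueueState} (hC : IsClosed C)
    (hU : IsUpperSet U) (hCU : C ⊆ U) : ⋂ n, upperApprox C n ⊆ U := by
  intro q hq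
  rw [Set.mem_iInter] at hq
  have hne : (⋂ n : ℕ, C ∩ ⋂ p ∈ Finset.range n ×ˢ Finset.range n,
      {c : QueueState | (p.2 : ℕ∞) ≤ c p.1 → (p.2 : ℕ∞) ≤ q p.1}).Nonempty := by
    have hcl : ∀ n : ℕ, IsClosed (C ∩ ⋂ p ∈ Finset.range n ×ˢ Finset.range n,
        {c : QueueState | (p.2 : ℕ∞) ≤ c p.1 → (p.2 : ℕ∞) ≤ q p.1}) := fun n =>
      hC.inter <| isClosed_biInter fun p _ =>
        isClosed_imp (isClopen_natCast_le_apply p.1 p.2).isOpen isClosed_const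
    refine IsCompact.nonempty_iInter_of_sequence_nonempty_isCompact_isClosed _ (fun n => ?_)
      (fun n => ?_) (hcl 0).isCompact hcl
    · refine Set.inter_subset_inter_right _ (Set.biInter_subset_biInter_left fun p hp => ?_)
      exact Finset.product_subset_product (Finset.range_subset_range.2 n.le_succ)
        (Finset.range_subset_range.2 n.le_succ) hp
    · obtain ⟨c, hc, h⟩ := hq n
      exact ⟨c, hc, Set.mem_iInter₂.2 h⟩
  obtain ⟨c, hc⟩ := hne
  rw [Set.mem_iInter] at hc
  refine hU (fun i => ?_) (hCU (hc 0).1)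
  refine ENat.forall_natCast_le_iff_le.1 fun a ha => ?_
  have h := Set.mem_iInter₂.1 (hc (max i a + 1)).2 (i, a) (by simp)
  exact h ha

end UpperApprox

theorem integral_indicator_isClopen (μ : Measure QueueState) {s : Set QueueState}
    (hs : IsClopen s) : ∫ q, BoundedContinuousFunction.indicator s hs q ∂μ = μ.real s :=
  integral_indicator_one hs.isClosed.measurableSet

theorem monotone_indicator {s : Set QueueState} (hs : IsClopen s) (hu : IsUpperSet s) :
    Monotone (BoundedContinuousFunction.indicator s hs) := by
  intro q q' h
  change s.indicator (fun _ => (1 : ℝ)) q ≤ s.indicator (fun _ => (1 : ℝ)) q'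
  by_cases h1 : q ∈ s
  · rw [Set.indicator_of_mem h1, Set.indicator_of_mem (hu h h1)]
  · rw [Set.indicator_of_notMem h1]
    exact Set.indicator_nonneg (fun _ _ => zero_le_one) _

section StochLE

variable {μ μ' : Measure QueueState} [IsProbabilityMeasure μ] [IsProbabilityMeasure μ']

/-- Inner regularity reduces an increasing event to a closed subset `C`. This need not be
increasing, but the clopen increasing sets `upperApprox C n` decrease to a set between `C` and the
event, and their indicators are monotone observables. -/
theorem stochLE_of_integral_le
    (h : ∀ f : Observable, Monotone f → ∫ q, f q ∂μ ≤ ∫ q, f q ∂μ') : StochLE μ μ' := by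
  intro U hU hup
  rw [hU.measure_eq_iSup_isClosed_of_ne_top (measure_ne_top μ U)]
  refine iSup_le fun C => iSup_le fun hCU => iSup_le fun hC => ?_
  have hlim : Tendsto (μ' ∘ upperApprox C) atTop (𝓝 (μ' (⋂ n, upperApprox C n))) :=
    tendsto_measure_iInter_atTop (fun n => (isClopen_upperApprox C n).isClosed.measurableSet.nullMeasurableSet)
      (antitone_upperApprox C) ⟨0, measure_ne_top _ _⟩
  have hle : ∀ n, μ C ≤ μ' (upperApprox C n) := by
    intro n
    refine (measure_mono (subset_upperApprox C n)).trans ?_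
    have hc := isClopen_upperApprox C n
    have := h _ (monotone_indicator hc (isUpperSet_upperApprox C n))
    rw [integral_indicator_isClopen, integral_indicator_isClopen] at this
    exact (ENNReal.toReal_le_toReal (measure_ne_top _ _) (measure_ne_top _ _)).1 this
  exact (ge_of_tendsto' hlim hle).trans (measure_mono (hC.iInter_upperApprox_subset hup hCU))

theorem eq_of_stochLE (h : StochLE μ μ') (h' : StochLE μ' μ) : μ = μ' := by
  refine ext_of_generate_finite (Set.range fun a : QueueState => Set.Ici a) ?_ ?_ ?_ (by simp)
  · refine le_antisymm (iSup_le fun i => ?_) (MeasurableSpace.generateFrom_le ?_)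
    · rw [← measurable_iff_comap_le]
      refine @measurable_of_Ici _ _ _ _ _ (_) _ _ _ _ fun x => ?_
      -- As `0` is the least length, being above `Pi.single i x` constrains the coordinate `i` only.
      refine MeasurableSpace.measurableSet_generateFrom ⟨Pi.single i x, ?_⟩
      ext q
      refine ⟨fun h => by simpa using h i, fun h j => ?_⟩
      by_cases hj : j = i
      · subst hj; simpa using h
      · simp [Pi.single_eq_of_ne hj]
    · rintro _ ⟨a, rfl⟩
      exact isClosed_Ici.measurableSet
  · rintro _ ⟨a, rfl⟩ _ ⟨b, rfl⟩ -
    exact ⟨a ⊔ b, Set.Ici_inter_Ici.symm⟩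
  · rintro _ ⟨a, rfl⟩
    exact le_antisymm (h _ isClosed_Ici.measurableSet (isUpperSet_Ici a))
      (h' _ isClosed_Ici.measurableSet (isUpperSet_Ici a))

theorem eq_of_integral_monotone_eq
    (h : ∀ f : Observable, Monotone f → ∫ q, f q ∂μ = ∫ q, f q ∂μ') : μ = μ' :=
  eq_of_stochLE (stochLE_of_integral_le fun f hf => (h f hf).le)
    (stochLE_of_integral_le fun f hf => (h f hf).ge)

end StochLE

/-- The space of laws is compact, so there is a cluster point; monotone observables identify it, so
there is only one. -/
theorem exists_tendsto_of_tendsto_integral {ι : Type*} {F : Filter ι} [F.NeBot]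
    (μ : ι → ProbabilityMeasure QueueState) (ℓ : Observable → ℝ)
    (h : ∀ f : Observable, Monotone f →
      Tendsto (fun i => ∫ q, f q ∂(μ i : Measure QueueState)) F (𝓝 (ℓ f))) :
    ∃ ν : ProbabilityMeasure QueueState, Tendsto μ F (𝓝 ν) := by
  obtain ⟨ν, hν⟩ := exists_clusterPt_of_compactSpace (map μ F)
  have key : ∀ ρ : ProbabilityMeasure QueueState, MapClusterPt ρ F μ →
      ∀ f : Observable, Monotone f → ∫ q, f q ∂(ρ : Measure QueueState) = ℓ f := by
    intro ρ hρ f hf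
    obtain ⟨U, hU, hlim⟩ := mapClusterPt_iff_ultrafilter.1 hρ
    exact tendsto_nhds_unique
      (ProbabilityMeasure.tendsto_iff_forall_integral_tendsto.1 hlim f) ((h f hf).mono_left hU)
  refine ⟨ν, tendsto_nhds_of_unique_mapClusterPt fun ρ hρ => ?_⟩
  exact ProbabilityMeasure.toMeasure_injective (eq_of_integral_monotone_eq fun f hf => by
    rw [key ρ hρ f hf, key ν hν f hf])

theorem tendsto_of_tendsto_integral_monotone {ι : Type*} {F : Filter ι} [F.NeBot]
    {μ : ι → ProbabilityMeasure QueueState} {ν : ProbabilityMeasure QueueState}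
    (h : ∀ f : Observable, Monotone f → Tendsto (fun i => ∫ q, f q ∂(μ i : Measure QueueState)) F
      (𝓝 (∫ q, f q ∂(ν : Measure QueueState)))) : Tendsto μ F (𝓝 ν) := by
  obtain ⟨ρ, hρ⟩ := exists_tendsto_of_tendsto_integral μ _ h
  have : ρ = ν := ProbabilityMeasure.toMeasure_injective (eq_of_integral_monotone_eq fun f hf => tendsto_nhds_unique
    (ProbabilityMeasure.tendsto_iff_forall_integral_tendsto.1 hρ f) (h f hf))
  exact this ▸ hρ

theorem summable_enat {ι : Type*} (f : ι → ℕ∞) : Summable f :=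
  ⟨_, tendsto_atTop_iSup fun _ _ h => Finset.sum_le_sum_of_subset h⟩

theorem TailLE.of_le {q q' : QueueState} (h : q ≤ q') (hq' : ∑' k, q' k ≠ ⊤) : TailLE q q' := by
  have hle : ∀ n : ℕ, ∑' k, q (n + k) ≤ ∑' k, q' (n + k) := fun n =>
    (summable_enat _).tsum_le_tsum (fun k => h (n + k)) (summable_enat _)
  refine ⟨ne_top_of_le_ne_top hq' ?_, hq', hle⟩
  simpa using hle 0

/-! ### Versions of the process and the coupling -/

section Existence

variable {lam : ℝ≥0}

theorem IsDrivingNoise.comp_measurePreserving {Ω Ω' : Type*} [MeasurableSpace Ω]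
    [MeasurableSpace Ω'] {P : Measure Ω} {P' : Measure Ω'} {φ : Ω' → Ω}
    (hφ : MeasurePreserving φ P' P) {clk : Clock → ℝ≥0 → Ω → ℕ} (hc : IsDrivingNoise lam P clk) :
    IsDrivingNoise lam P' (fun e t ω => clk e t (φ ω)) where
  arrivals := hc.arrivals.comp_measurePreserving hφ
  services i := (hc.services i).comp_measurePreserving hφ
  indep := by
    have hm : ∀ e, Measurable fun (ω : Ω) (t : ℝ≥0) => clk e t ω := fun e =>
      measurable_pi_lambda _ fun t => (hc.poisson e).measurable t
    have h := hc.indep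
    rw [iIndepFun_iff_measure_inter_preimage_eq_mul] at h ⊢
    intro S sets hs
    have h1 := h S hs
    rw [← hφ.measure_preimage (Finset.measurableSet_biInter S fun i hi =>
      hm i (hs i hi)).nullMeasurableSet] at h1
    have h2 : ∀ i ∈ S, P ((fun (ω : Ω) (t : ℝ≥0) => clk i t ω) ⁻¹' sets i) =
        P' ((fun (ω : Ω') (t : ℝ≥0) => clk i t (φ ω)) ⁻¹' sets i) := fun i hi => by
      rw [← hφ.measure_preimage (hm i (hs i hi)).nullMeasurableSet]
      rfl
    rw [Finset.prod_congr rfl h2] at h1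
    rw [← h1, Set.preimage_iInter₂]
    rfl

open Classical in
/-- The queue length process on the measurable set `G` of good realizations, and the constant
process off this set. -/
noncomputable def queueVersion {Ω : Type*} (G : Set Ω) (clk : Clock → ℝ≥0 → Ω → ℕ)
    (Q₀ : Ω → QueueState) (N : ℕ∞) (t : ℝ≥0) (ω : Ω) : QueueState :=
  if ω ∈ G then queuePath N (Q₀ ω) (fun e t => clk e t ω) t else Q₀ ω

theorem queueVersion_zero {Ω : Type*} (G : Set Ω) (clk : Clock → ℝ≥0 → Ω → ℕ)
    (Q₀ : Ω → QueueState) (N : ℕ∞) : queueVersion G clk Q₀ N 0 = Q₀ := by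
  funext ω
  rw [queueVersion, queuePath_zero, ite_self]

variable {Ω : Type*} [MeasurableSpace Ω] {P : Measure Ω} {clk : Clock → ℝ≥0 → Ω → ℕ}

/-- A version has to be measurable, not only almost everywhere so. With the constant process off `G`
the approximations converge at every point. -/
theorem IsDrivingNoise.measurable_queueVersion (hc : IsDrivingNoise lam P clk) {G : Set Ω}
    (hG : MeasurableSet G) (hgood : ∀ ω ∈ G, GoodClocks fun e t => clk e t ω)
    {Q₀ : Ω → QueueState} (hQ₀ : Measurable Q₀) (N : ℕ∞) (t : ℝ≥0) :
    Measurable (queueVersion G clk Q₀ N t) := by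
  classical
  have h1 : ∀ m : ℕ, Measurable fun ω => if ω ∈ G then
      queuePath N (Q₀ ω) (truncateClocks m fun e t => clk e t ω) t else Q₀ ω := by
    intro m
    refine measurable_of_tendsto_metrizable (f := fun (n : ℕ) ω => if ω ∈ G then
      tickFold N (gridBits (fun e t => clk e t ω) (t / n)) (gridList m n) (Q₀ ω) else Q₀ ω)
      (fun n => Measurable.ite hG (measurable_tickFold_clocks hc N (t / n) (gridList m n) hQ₀) hQ₀) ?_
    refine tendsto_pi_nhds.2 fun ω => ?_
    by_cases hω : ω ∈ G
    · simp only [hω, if_true]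
      exact tendsto_const_nhds.congr' (((hgood ω hω).eventually_tickFold_eq N (Q₀ ω) m t).mono
        fun n h => h.symm)
    · simp only [hω, if_false]
      exact tendsto_const_nhds
  refine measurable_of_tendsto_metrizable h1 (tendsto_pi_nhds.2 fun ω => ?_)
  unfold queueVersion
  by_cases hω : ω ∈ G
  · simp only [hω, if_true]
    exact (hgood ω hω).tendsto_queuePath_truncate N (Q₀ ω) t
  · simp only [hω, if_false]
    exact tendsto_const_nhds

theorem IsDrivingNoise.isBackPressureProcess_queueVersion (hc : IsDrivingNoise lam P clk)
    {G : Set Ω} (hG : MeasurableSet G) (hGae : ∀ᵐ ω ∂P, ω ∈ G)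
    (hgood : ∀ ω ∈ G, GoodClocks fun e t => clk e t ω)
    {Q₀ : Ω → QueueState} (hQ₀ : Measurable Q₀)
    (hind : IndepFun Q₀ (fun (ω : Ω) (e : Clock) (t : ℝ≥0) => clk e t ω) P) {N : ℕ∞}
    (hinit : ∀ᵐ ω ∂P, Q₀ ω ∈ stateSpace N) :
    IsBackPressureProcess lam N P (queueVersion G clk Q₀ N) where
  measurable := hc.measurable_queueVersion hG hgood hQ₀ N
  init := by rwa [queueVersion_zero]
  dynamics := by
    refine ⟨clk, hc, by rwa [queueVersion_zero], ?_⟩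
    filter_upwards [hGae] with ω hω
    simp only [queueVersion, hω, if_true]
    exact (hgood ω hω).followsClocks_queuePath N (Q₀ ω)

theorem IsDrivingNoise.exists_good_set [IsProbabilityMeasure P] (hc : IsDrivingNoise lam P clk) :
    ∃ G : Set Ω, MeasurableSet G ∧ (∀ᵐ ω ∂P, ω ∈ G) ∧
      ∀ ω ∈ G, GoodClocks fun e t => clk e t ω := by
  obtain ⟨G, hG, hGm, h⟩ := hc.ae_goodClocks.exists_measurable_mem
  exact ⟨G, hGm, hG, h⟩

theorem exists_isBackPressureProcess (lam : ℝ≥0) {N : ℕ∞} (μ : Measure QueueState)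
    [IsProbabilityMeasure μ] (hμ : ∀ᵐ q ∂μ, q ∈ stateSpace N) :
    ∃ (Ω : Type) (_ : MeasurableSpace Ω) (P : Measure Ω) (Q : ℝ≥0 → Ω → QueueState),
      IsProbabilityMeasure P ∧ IsBackPressureProcess lam N P Q ∧ P.map (Q 0) = μ := by
  let P := μ.prod (noiseMeasure lam)
  have hfst : MeasurePreserving Prod.fst P μ := measurePreserving_fst
  have hsnd : MeasurePreserving Prod.snd P (noiseMeasure lam) := measurePreserving_snd
  have hc := (isDrivingNoise_noiseClocks lam).comp_measurePreserving hsnd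
  obtain ⟨G, hG, hGae, hgood⟩ := hc.exists_good_set
  have hind : IndepFun Prod.fst (fun ω (e : Clock) (t : ℝ≥0) => noiseClocks e t ω.2) P := by
    refine indepFun_prod (X := id) (Y := fun ω (e : Clock) (t : ℝ≥0) => noiseClocks e t ω)
      measurable_id ?_
    exact measurable_pi_lambda _ fun e => measurable_pi_lambda _ fun t =>
      ((isDrivingNoise_noiseClocks lam).poisson e).measurable t
  refine ⟨_, _, P, queueVersion G _ Prod.fst N, inferInstance,
    hc.isBackPressureProcess_queueVersion hG hGae hgood measurable_fst hind
      (hfst.quasiMeasurePreserving.ae hμ), ?_⟩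
  rw [queueVersion_zero]
  exact hfst.map_eq

/-- All systems are driven by the same clocks from the empty configuration. -/
theorem exists_monotone_coupling (lam : ℝ≥0) :
    ∃ (Ω : Type) (_ : MeasurableSpace Ω) (P : Measure Ω) (X : ℕ∞ → ℝ≥0 → Ω → QueueState),
      IsProbabilityMeasure P ∧ (∀ N : ℕ∞, IsBackPressureFromZero lam N P (X N)) ∧
      ∀ᵐ ω ∂P, ∀ t : ℝ≥0, ∀ M N : ℕ∞, M ≤ N →
        X M t ω ≤ X N t ω ∧ TailLE (X M t ω) (X N t ω) := by
  have hc := isDrivingNoise_noiseClocks lam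
  obtain ⟨G, hG, hGae, hgood⟩ := hc.exists_good_set
  refine ⟨_, _, noiseMeasure lam, queueVersion G noiseClocks fun _ => 0, inferInstance,
    fun N => ⟨hc.isBackPressureProcess_queueVersion hG hGae hgood measurable_const
      (indepFun_const_noiseClocks 0) (Eventually.of_forall fun _ => zero_mem_stateSpace N),
      Eventually.of_forall fun ω => by rw [queueVersion_zero]⟩, ?_⟩
  filter_upwards [hGae] with ω hω t M N hMN
  simp only [queueVersion, hω, if_true]
  have hp := fun N => (hgood ω hω).followsClocks_queuePath N (0 : QueueState)
  have hle := (hp M).le (hgood ω hω) hMN (hp N) (by rw [queuePath_zero, queuePath_zero]) t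
  refine ⟨hle, TailLE.of_le hle (ne_top_of_le_ne_top (ENat.natCast_ne_top _)
    ((hp N).tsum_le (hgood ω hω) (queuePath_zero _ _ _) t))⟩

end Existence

/-! ### The system started empty -/

section FromZero

variable {lam : ℝ≥0} {Ω : Type*} [MeasurableSpace Ω] {P : Measure Ω} [IsProbabilityMeasure P]
  {N : ℕ∞} {Q : ℝ≥0 → Ω → QueueState}

theorem IsBackPressureFromZero.boundedTail (hQ : IsBackPressureFromZero lam N P Q) :
    ∀ᵐ ω ∂P, ∀ t, BoundedTail (Q t ω) := by
  obtain ⟨clk, hc, -, hfol⟩ := hQ.1.dynamics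
  filter_upwards [hc.ae_goodClocks, hfol, hQ.2] with ω hω hq h0 t
  exact hq.boundedTail hω h0 t

theorem IsBackPressureFromZero.integral_eq (hlam : 0 < lam)
    (hQ : IsBackPressureFromZero lam N P Q) (t : ℝ≥0) (f : Observable) :
    ∫ ω, f (Q t ω) ∂P = queueSemigroup hlam N t f 0 := by
  rw [hQ.1.integral_eq hlam t f]
  have : ∀ᵐ ω ∂P, queueSemigroup hlam N t f (Q 0 ω) = queueSemigroup hlam N t f 0 := by
    filter_upwards [hQ.2] with ω hω
    rw [hω]
  rw [integral_congr_ae this]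
  simp

theorem IsBackPressureFromZero.integral_map_eq (hlam : 0 < lam)
    (hQ : IsBackPressureFromZero lam N P Q) (t : ℝ≥0) (f : Observable) :
    ∫ q, f q ∂(P.map (Q t)) = queueSemigroup hlam N t f 0 := by
  rw [integral_map (hQ.1.measurable t).aemeasurable f.continuous.measurable.aestronglyMeasurable,
    hQ.integral_eq hlam]

/-- After running for the extra time the configuration is at least `0`, and the remaining evolution
is monotone. -/
theorem queueSemigroup_mono_time (hlam : 0 < lam) (N : ℕ∞) {f : Observable} (hf : Monotone f) :
    Monotone fun t => queueSemigroup hlam N t f 0 := by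
  intro s t hst
  obtain ⟨r, rfl⟩ := exists_add_of_le hst
  dsimp only
  rw [add_comm, queueSemigroup_add]
  exact le_queueSemigroup hlam N r
    (fun q => monotone_queueSemigroup hlam N s hf (fun k => zero_le)) 0

theorem queueSemigroup_le_norm (hlam : 0 < lam) (N : ℕ∞) (t : ℝ≥0) (f : Observable)
    (q : QueueState) : queueSemigroup hlam N t f q ≤ ‖f‖ := by
  refine le_of_tendsto' (tendsto_truncSemigroup_apply hlam N t f q) fun m => ?_
  exact (le_abs_self _).trans (((truncSemigroup lam N m t f).norm_coe_le_norm q).trans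
    (norm_truncSemigroup_apply_le hlam N m t f))

theorem bddAbove_range_queueSemigroup (hlam : 0 < lam) (N : ℕ∞) (f : Observable) :
    BddAbove (Set.range fun t => queueSemigroup hlam N t f 0) :=
  ⟨‖f‖, by rintro _ ⟨t, rfl⟩; exact queueSemigroup_le_norm hlam N t f 0⟩

theorem stochLE_of_fromZero (hlam : 0 < lam) {Ω' : Type*} [MeasurableSpace Ω'] {P' : Measure Ω'}
    [IsProbabilityMeasure P'] {M : ℕ∞} {Q' : ℝ≥0 → Ω' → QueueState} (hMN : M ≤ N)
    (hQ' : IsBackPressureFromZero lam M P' Q') (hQ : IsBackPressureFromZero lam N P Q)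
    {s t : ℝ≥0} (hst : s ≤ t) : StochLE (P'.map (Q' s)) (P.map (Q t)) := by
  have := Measure.isProbabilityMeasure_map (μ := P) (hQ.1.measurable t).aemeasurable
  have := Measure.isProbabilityMeasure_map (μ := P') (hQ'.1.measurable s).aemeasurable
  refine stochLE_of_integral_le fun f hf => ?_
  rw [hQ'.integral_map_eq hlam, hQ.integral_map_eq hlam]
  exact (queueSemigroup_mono_sites hlam hMN s hf 0).trans (queueSemigroup_mono_time hlam N hf hst)

end FromZero

/-! ### The limit law and its minimality -/

section Lower

variable {lam : ℝ≥0}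

/-- The law `ν` is the limit of the system with `N` sites started empty. -/
def IsLowerLaw (hlam : 0 < lam) (N : ℕ∞) (ν : ProbabilityMeasure QueueState) : Prop :=
  ∀ f : Observable, Tendsto (fun t => queueSemigroup hlam N t f 0) atTop
    (𝓝 (∫ q, f q ∂(ν : Measure QueueState)))

theorem IsLowerLaw.tendstoInDistribution {hlam : 0 < lam} {N : ℕ∞}
    {ν : ProbabilityMeasure QueueState} (hν : IsLowerLaw hlam N ν)
    {Ω : Type*} [MeasurableSpace Ω] {P : Measure Ω} [IsProbabilityMeasure P]
    {Q : ℝ≥0 → Ω → QueueState} (hQ : IsBackPressureFromZero lam N P Q) :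
    TendstoInDistribution Q atTop (id : QueueState → QueueState) (fun _ => P)
      (ν : Measure QueueState) where
  forall_aemeasurable t := (hQ.1.measurable t).aemeasurable
  tendsto := by
    refine ProbabilityMeasure.tendsto_iff_forall_integral_tendsto.2 fun f => ?_
    simp only [ProbabilityMeasure.coe_mk, Measure.map_id]
    simp_rw [hQ.integral_map_eq hlam]
    exact hν f

theorem exists_isLowerLaw (hlam : 0 < lam) (N : ℕ∞) :
    ∃ ν : ProbabilityMeasure QueueState, IsLowerLaw hlam N ν := by
  obtain ⟨Ω, _, P, X, _, hX, -⟩ := exists_monotone_coupling lam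
  let μ : ℝ≥0 → ProbabilityMeasure QueueState := fun t => ⟨P.map (X N t),
    Measure.isProbabilityMeasure_map ((hX N).1.measurable t).aemeasurable⟩
  have hμ : ∀ t (f : Observable), ∫ q, f q ∂(μ t : Measure QueueState) =
      queueSemigroup hlam N t f 0 := fun t f => (hX N).integral_map_eq hlam t f
  obtain ⟨ν, hν⟩ := exists_tendsto_of_tendsto_integral (F := atTop) μ
    (fun f => ⨆ t, queueSemigroup hlam N t f 0) fun f hf => by
      simp_rw [hμ]
      exact tendsto_atTop_ciSup (queueSemigroup_mono_time hlam N hf)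
        (bddAbove_range_queueSemigroup hlam N f)
  refine ⟨ν, fun f => ?_⟩
  simp_rw [← hμ]
  exact ProbabilityMeasure.tendsto_iff_forall_integral_tendsto.1 hν f

variable {hlam : 0 < lam} {N : ℕ∞} {ν : ProbabilityMeasure QueueState}

theorem IsLowerLaw.queueSemigroup_le (hν : IsLowerLaw hlam N ν) {f : Observable} (hf : Monotone f)
    (t : ℝ≥0) : queueSemigroup hlam N t f 0 ≤ ∫ q, f q ∂(ν : Measure QueueState) :=
  (queueSemigroup_mono_time hlam N hf).ge_of_tendsto (hν f) t

theorem IsLowerLaw.integral_queueSemigroup (hν : IsLowerLaw hlam N ν) (t : ℝ≥0) (f : Observable) :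
    ∫ q, queueSemigroup hlam N t f q ∂(ν : Measure QueueState) =
      ∫ q, f q ∂(ν : Measure QueueState) := by
  refine tendsto_nhds_unique (hν (queueSemigroup hlam N t f)) ?_
  simp_rw [← queueSemigroup_add]
  exact (hν f).comp (tendsto_atTop_mono (fun s => le_self_add) tendsto_id)

/-- Invariance under the semigroup is automatic. The hypothesis on the state space matters for
finite `N`, where mass could escape to infinite queues in the limit. -/
theorem IsLowerLaw.isStationaryDistribution (hν : IsLowerLaw hlam N ν)
    (h : ∀ᵐ q ∂(ν : Measure QueueState), q ∈ stateSpace N) :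
    IsStationaryDistribution lam N (ν : Measure QueueState) := by
  obtain ⟨Ω, _, P, Q, _, hQ, h0⟩ := exists_isBackPressureProcess lam (ν : Measure QueueState) h
  refine ⟨Ω, _, P, Q, inferInstance, hQ, fun t => ?_⟩
  have := Measure.isProbabilityMeasure_map (μ := P) (hQ.measurable t).aemeasurable
  refine ext_of_forall_integral_eq_of_IsFiniteMeasure fun f => ?_
  rw [integral_map (hQ.measurable t).aemeasurable f.continuous.measurable.aestronglyMeasurable,
    hQ.integral_eq hlam, ← hν.integral_queueSemigroup t f]
  conv_rhs => rw [← h0]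
  rw [integral_map (hQ.measurable 0).aemeasurable
    (queueSemigroup hlam N t f).continuous.measurable.aestronglyMeasurable]

theorem IsStationaryDistribution.isProbabilityMeasure {μ : Measure QueueState}
    (hμ : IsStationaryDistribution lam N μ) : IsProbabilityMeasure μ := by
  obtain ⟨Ω, _, P, Q, _, hQ, h⟩ := hμ
  rw [← h 0]
  exact Measure.isProbabilityMeasure_map (hQ.measurable 0).aemeasurable

theorem measurableSet_stateSpace (N : ℕ∞) : MeasurableSet (stateSpace N) := by
  have h : stateSpace N = ⋂ (_ : N ≠ ⊤), ⋂ i : ℕ, (fun q : QueueState => q i) ⁻¹'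
      {x | x ≠ ⊤ ∧ (N ≤ (i : ℕ∞) → x = 0)} := by
    ext q
    simp [stateSpace]
  rw [h]
  exact .iInter fun _ => .iInter fun i => measurable_pi_apply i .of_discrete

theorem IsStationaryDistribution.ae_mem_stateSpace {μ : Measure QueueState}
    (hμ : IsStationaryDistribution lam N μ) : ∀ᵐ q ∂μ, q ∈ stateSpace N := by
  obtain ⟨Ω, _, P, Q, _, hQ, h⟩ := hμ
  rw [← h 0]
  exact (ae_map_iff (hQ.measurable 0).aemeasurable (measurableSet_stateSpace N)).2 hQ.init

theorem IsStationaryDistribution.integral_queueSemigroup (hlam : 0 < lam) {μ : Measure QueueState}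
    (hμ : IsStationaryDistribution lam N μ) (t : ℝ≥0) (f : Observable) :
    ∫ q, queueSemigroup hlam N t f q ∂μ = ∫ q, f q ∂μ := by
  obtain ⟨Ω, _, P, Q, _, hQ, h⟩ := hμ
  have h1 := hQ.integral_eq hlam t f
  rw [← integral_map (f := f) (hQ.measurable t).aemeasurable
    f.continuous.measurable.aestronglyMeasurable, h t,
    ← integral_map (f := queueSemigroup hlam N t f) (hQ.measurable 0).aemeasurable
    (queueSemigroup hlam N t f).continuous.measurable.aestronglyMeasurable, h 0] at h1
  exact h1.symm

/-- A stationary start dominates the empty start at time `0`, hence at every time. -/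
theorem IsLowerLaw.stochLE (hν : IsLowerLaw hlam N ν) {μ : Measure QueueState}
    (hμ : IsStationaryDistribution lam N μ) : StochLE (ν : Measure QueueState) μ := by
  have := hμ.isProbabilityMeasure
  refine stochLE_of_integral_le fun f hf => le_of_tendsto' (hν f) fun t => ?_
  rw [← hμ.integral_queueSemigroup hlam t f]
  have h : ∀ q, queueSemigroup hlam N t f 0 ≤ queueSemigroup hlam N t f q := fun q =>
    monotone_queueSemigroup hlam N t hf (fun k => zero_le)
  have hi : Integrable (queueSemigroup hlam N t f) μ := (queueSemigroup hlam N t f).integrable μ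
  simpa using integral_mono (integrable_const _) hi h

theorem isClosed_boundedTail : IsClosed {q | BoundedTail q} := by
  have : {q | BoundedTail q} = ⋂ n : ℕ, ⋂ k : ℕ, ⋂ (_ : n < k), {q | q k ≤ q n + 1} := by
    ext q
    simp [BoundedTail]
  rw [this]
  exact isClosed_iInter fun n => isClosed_iInter fun k => isClosed_iInter fun _ =>
    isClosed_le (continuous_apply k) ((continuous_apply n).add continuous_const)

theorem IsLowerLaw.ae_mem_of_isClosed (hν : IsLowerLaw hlam N ν) {C : Set QueueState}
    (hC : IsClosed C) (h : ∀ (Ω : Type) [MeasurableSpace Ω] (P : Measure Ω) [IsProbabilityMeasure P]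
      (Q : ℝ≥0 → Ω → QueueState), IsBackPressureFromZero lam N P Q → ∀ t, ∀ᵐ ω ∂P, Q t ω ∈ C) :
    ∀ᵐ q ∂(ν : Measure QueueState), q ∈ C := by
  obtain ⟨Ω, _, P, X, _, hX, -⟩ := exists_monotone_coupling lam
  have hlim := (hν.tendstoInDistribution (hX N)).tendsto
  have h1 := ProbabilityMeasure.limsup_measure_closed_le_of_tendsto hlim hC
  have h2 : ∀ t, P.map (X N t) C = 1 := fun t => by
    rw [Measure.map_apply ((hX N).1.measurable t) hC.measurableSet]
    exact (prob_compl_eq_zero_iff ((hX N).1.measurable t hC.measurableSet)).1 (h Ω P _ (hX N) t)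
  simp only [ProbabilityMeasure.coe_mk, h2, limsup_const, Measure.map_id] at h1
  exact (prob_compl_eq_zero_iff hC.measurableSet).2 (le_antisymm prob_le_one h1)

theorem IsLowerLaw.ae_boundedTail (hν : IsLowerLaw hlam N ν) :
    ∀ᵐ q ∂(ν : Measure QueueState), BoundedTail q :=
  hν.ae_mem_of_isClosed isClosed_boundedTail fun _ _ _ _ _ hQ t =>
    hQ.boundedTail.mono fun _ h => h t

theorem IsLowerLaw.stochLE_of_le {M : ℕ∞} {π : ProbabilityMeasure QueueState}
    (hπ : IsLowerLaw hlam M π) (hν : IsLowerLaw hlam N ν) (hMN : M ≤ N) :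
    StochLE (π : Measure QueueState) (ν : Measure QueueState) :=
  stochLE_of_integral_le fun f hf => le_of_tendsto_of_tendsto' (hπ f) (hν f) fun t =>
    queueSemigroup_mono_sites hlam hMN t hf 0

/-- For the lower bound a time `t` is fixed first, at which the infinite system nearly attains its
limit; at that time the finite systems converge, and their stationary means are at least their means
at `t`. -/
theorem tendsto_of_isLowerLaw (hν : IsLowerLaw hlam ⊤ ν) {π : ℕ → ProbabilityMeasure QueueState}
    (hπ : ∀ N : ℕ, IsLowerLaw hlam N (π N)) : Tendsto π atTop (𝓝 ν) := by
  refine tendsto_of_tendsto_integral_monotone fun f hf => ?_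
  have hle : ∀ N, ∫ q, f q ∂(π N : Measure QueueState) ≤ ∫ q, f q ∂(ν : Measure QueueState) :=
    fun N => le_of_tendsto_of_tendsto' (hπ N f) (hν f) fun t =>
      queueSemigroup_mono_sites hlam le_top t hf 0
  refine tendsto_order.2 ⟨fun a ha => ?_, fun a ha => Eventually.of_forall fun N =>
    (hle N).trans_lt ha⟩
  obtain ⟨t, ht⟩ := ((hν f).eventually (lt_mem_nhds ha)).exists
  filter_upwards [(tendsto_queueSemigroup_sites hlam t f 0).eventually (lt_mem_nhds ht)] with N hN
  exact hN.trans_le ((hπ N).queueSemigroup_le hf t)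

end Lower

/-! ### Finite systems: additive functionals and reachability of the empty configuration -/

section Moves

/-- The length of the queue number `k`, as a real number; infinite queues count as empty. -/
noncomputable def queueLength (q : QueueState) (k : ℕ) : ℝ := (q k).toNat

/-- The sum over the first `N` sites of a function of the site and the length of its queue. -/
noncomputable def siteSum (N : ℕ) (φ : ℕ → ℝ → ℝ) (q : QueueState) : ℝ :=
  ∑ k ∈ Finset.range N, φ k (queueLength q k)

theorem queueLength_nonneg (q : QueueState) (k : ℕ) : 0 ≤ queueLength q k := Nat.cast_nonneg _

theorem queueLength_lt_iff {N : ℕ} {q : QueueState} (hq : q ∈ stateSpace N) (i j : ℕ) :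
    queueLength q i < queueLength q j ↔ q i < q j := by
  have h := hq (ENat.natCast_ne_top N)
  rw [queueLength, queueLength, Nat.cast_lt, ← ENat.natCast_lt_natCast,
    ENat.natCast_toNat (h i).1, ENat.natCast_toNat (h j).1]

theorem queueLength_eq_zero {N : ℕ} {q : QueueState} (hq : q ∈ stateSpace N) {i : ℕ} (hi : N ≤ i) :
    queueLength q i = 0 := by
  simp [queueLength, (hq (ENat.natCast_ne_top N) i).2 (by exact_mod_cast hi)]

theorem queueLength_afterTick_none {N : ℕ} {q : QueueState} (hq : q ∈ stateSpace N) (k : ℕ) :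
    queueLength (afterTick N none q) k = queueLength q k + if k = 0 then 1 else 0 := by
  have h := (hq (ENat.natCast_ne_top N) k).1
  rw [queueLength, afterTick_none_apply]
  split_ifs with hk
  · rw [ENat.toNat_add h (by simp)]
    simp [queueLength]
  · simp [queueLength]

theorem queueLength_afterTick_some {N : ℕ} {q : QueueState} (hq : q ∈ stateSpace N) {i : ℕ}
    (hi : q (i + 1) < q i) (k : ℕ) :
    queueLength (afterTick N (some i) q) k =
      if k = i then queueLength q k - 1
      else if k = i + 1 ∧ i + 1 < N then queueLength q k + 1 else queueLength q k := by
  have h := fun k => (hq (ENat.natCast_ne_top N) k).1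
  have h1 : 1 ≤ (q i).toNat := by
    have := (queueLength_lt_iff hq (i + 1) i).2 hi
    rw [queueLength, queueLength, Nat.cast_lt] at this
    omega
  have hN : (((i + 1 : ℕ) : ℕ∞) < (N : ℕ∞)) ↔ i + 1 < N := Nat.cast_lt
  simp only [queueLength, afterTick, hi, if_true, hN]
  split_ifs with hk hk'
  · rw [hk, ENat.toNat_sub (by simp), ENat.toNat_one, Nat.cast_sub h1, Nat.cast_one]
  · rw [hk'.1, ENat.toNat_add (h _) (by simp)]
    simp
  · rfl

theorem siteSum_afterTick_none {N : ℕ} (hN : 1 ≤ N) (φ : ℕ → ℝ → ℝ) {q : QueueState}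
    (hq : q ∈ stateSpace N) : siteSum N φ (afterTick N none q) =
      siteSum N φ q + (φ 0 (queueLength q 0 + 1) - φ 0 (queueLength q 0)) := by
  have h : ∀ k ∈ Finset.range N, φ k (queueLength (afterTick N none q) k) =
      φ k (queueLength q k) + if k = 0 then φ 0 (queueLength q 0 + 1) - φ 0 (queueLength q 0)
        else 0 := by
    intro k _
    rw [queueLength_afterTick_none hq]
    split_ifs with hk
    · rw [hk]; ring
    · rw [add_zero, add_zero]
  rw [siteSum, Finset.sum_congr rfl h, Finset.sum_add_distrib, Finset.sum_ite_eq',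
    if_pos (Finset.mem_range.2 hN), siteSum]

theorem siteSum_afterTick_some {N : ℕ} (φ : ℕ → ℝ → ℝ) {q : QueueState}
    (hq : q ∈ stateSpace N) {i : ℕ} (hiN : i < N) (hi : q (i + 1) < q i) :
    siteSum N φ (afterTick N (some i) q) = siteSum N φ q +
      (φ i (queueLength q i - 1) - φ i (queueLength q i)) +
      if i + 1 < N then φ (i + 1) (queueLength q (i + 1) + 1) - φ (i + 1) (queueLength q (i + 1))
      else 0 := by
  have h : ∀ k ∈ Finset.range N, φ k (queueLength (afterTick N (some i) q) k) =
      φ k (queueLength q k) +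
        (if k = i then φ i (queueLength q i - 1) - φ i (queueLength q i) else 0) +
        if k = i + 1 then
          φ (i + 1) (queueLength q (i + 1) + 1) - φ (i + 1) (queueLength q (i + 1)) else 0 := by
    intro k hkN
    rw [Finset.mem_range] at hkN
    rw [queueLength_afterTick_some hq hi]
    by_cases hk : k = i
    · subst hk
      simp
    · by_cases hk' : k = i + 1
      · subst hk'
        simp [hkN]
      · simp [hk, hk']
  rw [siteSum, Finset.sum_congr rfl h, Finset.sum_add_distrib, Finset.sum_add_distrib,
    Finset.sum_ite_eq', Finset.sum_ite_eq', if_pos (Finset.mem_range.2 hiN), siteSum]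
  simp only [Finset.mem_range]

theorem afterTick_some_of_not_lt (N : ℕ∞) {i : ℕ} {q : QueueState} (hi : ¬ q (i + 1) < q i) :
    afterTick N (some i) q = q := by
  simp [afterTick, hi]

/-- If no site can serve, the queues are non-decreasing along the line, while the site after the
last one is empty. -/
theorem exists_lt_of_ne_zero {N : ℕ} {q : QueueState} (hq : q ∈ stateSpace N) (h0 : q ≠ 0) :
    ∃ i < N, q (i + 1) < q i := by
  by_contra! hcon
  refine h0 (funext fun k => ?_)
  have hz : ∀ i, N ≤ i → q i = 0 := fun i hi =>
    (hq (ENat.natCast_ne_top N) i).2 (by exact_mod_cast hi)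
  rcases le_total N k with hk | hk
  · exact hz k hk
  · have : ∀ n, k ≤ n → n ≤ N → q k ≤ q n := by
      intro n hn
      induction n, hn using Nat.le_induction with
      | base => exact fun _ => le_rfl
      | succ n _ ih => exact fun h => (ih (by omega)).trans (hcon n (by omega))
    exact le_antisymm ((this N hk le_rfl).trans (hz N le_rfl).le) zero_le

theorem exists_ticks_eq_zero {N : ℕ} (hN : 1 ≤ N) {q : QueueState} (hq : q ∈ stateSpace N) :
    ∃ w : List (Fin N), w.foldr (fun i q => afterTick N (some i) q) q = 0 := by
  have hN' : (1 : ℕ∞) ≤ N := by exact_mod_cast hN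
  -- A customer at site `k` still needs `N - k` services, so every effective service lowers `M` by
  -- exactly one.
  let M := siteSum N fun k x => ((N : ℝ) - k) * x
  have hM : ∀ q, 0 ≤ M q := fun q => Finset.sum_nonneg fun k hk =>
    mul_nonneg (sub_nonneg.2 (Nat.cast_le.2 (Finset.mem_range.1 hk).le)) (queueLength_nonneg q k)
  have hdec : ∀ q ∈ stateSpace N, q ≠ 0 → ∃ i : Fin N, M (afterTick N (some i) q) = M q - 1 := by
    intro q hq h0
    obtain ⟨i, hiN, hi⟩ := exists_lt_of_ne_zero hq h0
    refine ⟨⟨i, hiN⟩, ?_⟩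
    change siteSum N _ (afterTick N (some i) q) = siteSum N _ q - 1
    rw [siteSum_afterTick_some _ hq hiN hi]
    split_ifs with h
    · push_cast; ring
    · have : (N : ℝ) = i + 1 := by exact_mod_cast (by omega : N = i + 1)
      rw [this]; ring
  have key : ∀ n : ℕ, ∀ q ∈ stateSpace N, M q ≤ n →
      ∃ w : List (Fin N), w.foldr (fun i q => afterTick N (some i) q) q = 0 := by
    intro n
    induction n with
    | zero =>
      intro q hq hn
      by_cases h0 : q = 0
      · exact ⟨[], h0⟩
      · obtain ⟨i, hi⟩ := hdec q hq h0
        have := hM (afterTick N (some i) q)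
        simp only [CharP.cast_eq_zero] at hn
        linarith
    | succ n ih =>
      intro q hq hn
      by_cases h0 : q = 0
      · exact ⟨[], h0⟩
      · obtain ⟨i, hi⟩ := hdec q hq h0
        push_cast at hn
        obtain ⟨w, hw⟩ := ih _ (afterTick_mem_stateSpace hN' (some i) hq) (by linarith)
        exact ⟨w ++ [i], by simpa using hw⟩
  obtain ⟨n, hn⟩ := exists_nat_ge (M q)
  exact key n q hq hn

end Moves

/-! ### Negative drift of the sum of squares -/

section Drift

/-- The total of the differences of consecutive queues. -/
noncomputable def totalDescent (N : ℕ) (q : QueueState) : ℝ :=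
  ∑ i ∈ Finset.range N, max (queueLength q i - queueLength q (i + 1)) 0

/-- The differences telescope from site `j` down to the empty site `N`. -/
theorem queueLength_le_totalDescent {N : ℕ} {q : QueueState} (hq : q ∈ stateSpace N) {j : ℕ}
    (hj : j ≤ N) : queueLength q j ≤ totalDescent N q := by
  have h : ∀ n, j ≤ n → queueLength q j ≤ totalDescent n q + queueLength q n := by
    intro n hn
    induction n, hn using Nat.le_induction with
    | base =>
      exact le_add_of_nonneg_left (Finset.sum_nonneg fun _ _ => le_max_right _ _)
    | succ n _ ih =>
      rw [totalDescent, Finset.sum_range_succ]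
      have := le_max_left (queueLength q n - queueLength q (n + 1)) 0
      rw [totalDescent] at ih
      linarith
  simpa [queueLength_eq_zero hq le_rfl] using h N hj

/-- The sum of the squares of the queues of the first `N` sites. -/
noncomputable def squareSum (N : ℕ) : QueueState → ℝ := siteSum N fun _ x => x ^ 2

theorem squareSum_nonneg (N : ℕ) (q : QueueState) : 0 ≤ squareSum N q := by
  unfold squareSum siteSum
  positivity

/-- A move from a queue `x` to a queue `y < x` changes `x² + y²` by `2 - 2 (x - y)`; a departure
from the system is covered with `y = 0`. -/
theorem squareSum_afterTick_some_le {N : ℕ} {q : QueueState} (hq : q ∈ stateSpace N) {i : ℕ}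
    (hiN : i < N) : squareSum N (afterTick N (some i) q) ≤
      squareSum N q + (2 - 2 * max (queueLength q i - queueLength q (i + 1)) 0) := by
  by_cases hi : q (i + 1) < q i
  · have h := (queueLength_lt_iff hq _ _).2 hi
    rw [squareSum, siteSum_afterTick_some _ hq hiN hi, max_eq_left (by linarith)]
    split_ifs with h1
    · nlinarith
    · have : queueLength q (i + 1) = 0 := queueLength_eq_zero hq (by omega)
      nlinarith
  · have h : ¬ queueLength q (i + 1) < queueLength q i :=
      fun h => hi ((queueLength_lt_iff hq _ _).1 h)
    rw [afterTick_some_of_not_lt _ hi, max_eq_right (by linarith)]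
    linarith

/-- The transition operator of the jump chain, acting on all functions. -/
noncomputable def averageMap (lam : ℝ≥0) (N : ℕ) : Module.End ℝ (QueueState → ℝ) :=
  (totalRate lam N)⁻¹ • ((lam : ℝ) • LinearMap.funLeft ℝ ℝ (afterTick N none) +
    ∑ i ∈ Finset.range N, LinearMap.funLeft ℝ ℝ (afterTick N (some i)))

variable {lam : ℝ≥0} {N : ℕ}

theorem averageMap_apply (g : QueueState → ℝ) (q : QueueState) :
    averageMap lam N g q = (totalRate lam N)⁻¹ * (lam * g (afterTick N none q) +
      ∑ i ∈ Finset.range N, g (afterTick N (some i) q)) := by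
  simp [averageMap, LinearMap.funLeft_apply, Finset.sum_apply, mul_add]

theorem averageMap_pow_apply_succ (n : ℕ) (g : QueueState → ℝ) (q : QueueState) :
    (averageMap lam N ^ (n + 1)) g q = averageMap lam N ((averageMap lam N ^ n) g) q := by
  rw [pow_succ']; rfl

/-- The sum of squares is unbounded and is not an observable; its drift is computed with
`averageMap` and brought back through this identity. -/
theorem jumpOp_pow_eq_averageMap_pow (n : ℕ) (f : Observable) (q : QueueState) :
    (jumpOp lam N N ^ n) f q = (averageMap lam N ^ n) f q := by
  induction n generalizing q with
  | zero => rfl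
  | succ n ih =>
    rw [jumpOp_pow_succ_apply, averageMap_pow_apply_succ, jumpOp_apply, averageMap_apply]
    simp_rw [ih]

theorem averageMap_pow_mono (hN : 1 ≤ N) {g h : QueueState → ℝ}
    (hgh : ∀ q ∈ stateSpace N, g q ≤ h q) (n : ℕ) {q : QueueState} (hq : q ∈ stateSpace N) :
    (averageMap lam N ^ n) g q ≤ (averageMap lam N ^ n) h q := by
  have hN' : (1 : ℕ∞) ≤ N := by exact_mod_cast hN
  induction n generalizing q with
  | zero => exact hgh q hq
  | succ n ih =>
    rw [averageMap_pow_apply_succ, averageMap_pow_apply_succ, averageMap_apply, averageMap_apply]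
    have : 0 ≤ (totalRate lam N)⁻¹ := by unfold totalRate; positivity
    gcongr
    · exact ih (afterTick_mem_stateSpace hN' _ hq)
    · exact ih (afterTick_mem_stateSpace hN' _ hq)

theorem averageMap_pow_const (hlam : 0 < lam) (n : ℕ) (c : ℝ) (q : QueueState) :
    (averageMap lam N ^ n) (fun _ => c) q = c := by
  induction n generalizing q with
  | zero => rfl
  | succ n ih =>
    rw [averageMap_pow_apply_succ, averageMap_apply]
    simp_rw [ih]
    have := totalRate_pos hlam N
    rw [inv_mul_eq_iff_eq_mul₀ this.ne']
    simp [totalRate]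
    ring

theorem averageMap_squareSum_le (hlam : 0 < lam) (hlam1 : lam < 1) (hN : 1 ≤ N) {j : ℕ}
    (hj : j < N) {q : QueueState} (hq : q ∈ stateSpace N) :
    averageMap lam N (squareSum N) q ≤ squareSum N q -
      (totalRate lam N)⁻¹ * (2 * (1 - lam)) * queueLength q j +
      (totalRate lam N)⁻¹ * (lam + 2 * N) := by
  have hr := totalRate_pos hlam N
  have h1 : (lam : ℝ) < 1 := by exact_mod_cast hlam1
  have hl : (0 : ℝ) ≤ lam := lam.coe_nonneg
  have h0 : squareSum N (afterTick N none q) = squareSum N q + (2 * queueLength q 0 + 1) := by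
    rw [squareSum, siteSum_afterTick_none hN _ hq]
    ring
  have hs : ∑ i ∈ Finset.range N, squareSum N (afterTick N (some i) q) ≤
      N * squareSum N q + 2 * N - 2 * totalDescent N q := by
    refine (Finset.sum_le_sum fun i hi =>
      squareSum_afterTick_some_le hq (Finset.mem_range.1 hi)).trans (le_of_eq ?_)
    rw [Finset.sum_add_distrib, Finset.sum_sub_distrib, ← Finset.mul_sum, totalDescent]
    simp
    ring
  -- The descent is split with weights `lam` and `1 - lam`: the first part pays for the arrivals at
  -- site `0`, the second leaves the drift at site `j`.
  have hd0 := queueLength_le_totalDescent hq (Nat.zero_le N)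
  have hdj := queueLength_le_totalDescent hq hj.le
  have hmain : (lam : ℝ) * squareSum N (afterTick N none q) +
      ∑ i ∈ Finset.range N, squareSum N (afterTick N (some i) q) ≤
      totalRate lam N * squareSum N q - 2 * (1 - lam) * queueLength q j + (lam + 2 * N) := by
    rw [h0, totalRate]
    nlinarith
  rw [averageMap_apply]
  calc _ ≤ (totalRate lam N)⁻¹ * (totalRate lam N * squareSum N q -
        2 * (1 - lam) * queueLength q j + (lam + 2 * N)) := by gcongr
    _ = _ := by field_simp

/-- The drift inequality is summed along the chain; the sum of squares starts at `0` and stays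
nonnegative. -/
theorem sum_averageMap_pow_queueLength_le (hlam : 0 < lam) (hlam1 : lam < 1) (hN : 1 ≤ N) {j : ℕ}
    (hj : j < N) (n : ℕ) :
    2 * (1 - lam) * ∑ k ∈ Finset.range n, (averageMap lam N ^ k) (fun q => queueLength q j) 0 ≤
      n * (lam + 2 * N) := by
  have hr := totalRate_pos hlam N
  have hz : (0 : QueueState) ∈ stateSpace N := zero_mem_stateSpace N
  have hstep : ∀ k, (averageMap lam N ^ (k + 1)) (squareSum N) 0 ≤
      (averageMap lam N ^ k) (squareSum N) 0 - (totalRate lam N)⁻¹ * (2 * (1 - lam)) *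
        (averageMap lam N ^ k) (fun q => queueLength q j) 0 +
        (totalRate lam N)⁻¹ * (lam + 2 * N) := by
    intro k
    rw [pow_succ]
    change (averageMap lam N ^ k) (averageMap lam N (squareSum N)) 0 ≤ _
    refine (averageMap_pow_mono hN (h := squareSum N -
      ((totalRate lam N)⁻¹ * (2 * (1 - lam))) • (fun q => queueLength q j) +
      fun _ => (totalRate lam N)⁻¹ * (lam + 2 * N))
      (fun q hq => averageMap_squareSum_le hlam hlam1 hN hj hq) k hz).trans (le_of_eq ?_)
    rw [map_add, map_sub, map_smul, Pi.add_apply, averageMap_pow_const hlam]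
    rfl
  have hsum : ∀ n : ℕ, (averageMap lam N ^ n) (squareSum N) 0 + (totalRate lam N)⁻¹ *
      (2 * (1 - lam) *
        ∑ k ∈ Finset.range n, (averageMap lam N ^ k) (fun q => queueLength q j) 0) ≤
      (totalRate lam N)⁻¹ * (n * (lam + 2 * N)) := by
    intro n
    induction n with
    | zero => simp [squareSum, siteSum, queueLength]
    | succ n ih =>
      rw [Finset.sum_range_succ]
      have := hstep n
      push_cast
      linarith
  have hpos : 0 ≤ (averageMap lam N ^ n) (squareSum N) 0 := by
    have := averageMap_pow_mono (lam := lam) hN (g := fun _ => 0) (h := squareSum N)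
      (fun q _ => squareSum_nonneg N q) n hz
    rwa [averageMap_pow_const hlam] at this
  have h := hsum n
  exact le_of_mul_le_mul_left (by linarith) (inv_pos.2 hr)

end Drift

/-! ### Uniqueness of the stationary distribution of a finite system -/

section FiniteSystem

variable {lam : ℝ≥0} {N : ℕ}

/-- The generator of the system that is driven by the arrivals and the first `m` service clocks. -/
noncomputable def generatorOp (lam : ℝ≥0) (N : ℕ∞) (m : ℕ) : ObservableOp :=
  totalRate lam m • (jumpOp lam N m - 1)

theorem truncSemigroup_eq_exp (N : ℕ∞) (m : ℕ) (t : ℝ≥0) :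
    truncSemigroup lam N m t = NormedSpace.exp ((t : ℝ) • generatorOp lam N m) := by
  rw [truncSemigroup, generatorOp, smul_smul]

theorem generatorOp_apply (hlam : 0 < lam) (N : ℕ∞) (m : ℕ) (f : Observable) (q : QueueState) :
    generatorOp lam N m f q = lam * (f (afterTick N none q) - f q) +
      ∑ i ∈ Finset.range m, (f (afterTick N (some i) q) - f q) := by
  have h : generatorOp lam N m f q = totalRate lam m * (jumpOp lam N m f q - f q) := rfl
  rw [h, jumpOp_apply, mul_sub, mul_inv_cancel_left₀ (totalRate_pos hlam m).ne',
    Finset.sum_sub_distrib]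
  simp [totalRate]
  ring

/-- Clocks of sites beyond `N` do nothing on the state space. The comparison is made for generators
because the normalization of the jump operators depends on `m`. -/
theorem generatorOp_pow_apply_eq (hlam : 0 < lam) (hN : 1 ≤ N) {m : ℕ} (hm : N ≤ m) (f : Observable)
    (n : ℕ) {q : QueueState} (hq : q ∈ stateSpace N) :
    (generatorOp lam N m ^ n) f q = (generatorOp lam N N ^ n) f q := by
  have hN' : (1 : ℕ∞) ≤ N := by exact_mod_cast hN
  have hs : ∀ (A : ObservableOp) (n : ℕ), (A ^ (n + 1)) f = A ((A ^ n) f) := fun A n => by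
    rw [pow_succ']; rfl
  induction n generalizing q with
  | zero => rfl
  | succ n ih =>
    rw [hs, hs, generatorOp_apply hlam, generatorOp_apply hlam, ih hq,
      ih (afterTick_mem_stateSpace hN' none hq)]
    congr 1
    rw [← Finset.sum_subset (Finset.range_subset_range.2 hm)]
    · exact Finset.sum_congr rfl fun i _ => by rw [ih (afterTick_mem_stateSpace hN' (some i) hq)]
    · intro i _ hi
      rw [afterTick_of_le (ENat.natCast_ne_top N) (by simpa using hi) hq, ih hq, sub_self]

theorem truncSemigroup_apply_eq (hlam : 0 < lam) (hN : 1 ≤ N) {m : ℕ} (hm : N ≤ m) (t : ℝ≥0)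
    (f : Observable) {q : QueueState} (hq : q ∈ stateSpace N) :
    truncSemigroup lam N m t f q = truncSemigroup lam N N t f q := by
  have h1 := hasSum_exp_smul_apply (generatorOp lam N m) t f
    (BoundedContinuousFunction.evalCLM ℝ q)
  have h2 := hasSum_exp_smul_apply (generatorOp lam N N) t f
    (BoundedContinuousFunction.evalCLM ℝ q)
  rw [truncSemigroup_eq_exp, truncSemigroup_eq_exp]
  refine h1.unique (h2.congr_fun fun n => ?_)
  congr 1
  exact generatorOp_pow_apply_eq hlam hN hm f n hq

theorem queueSemigroup_eq_truncSemigroup (hlam : 0 < lam) (hN : 1 ≤ N) (t : ℝ≥0) (f : Observable)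
    {q : QueueState} (hq : q ∈ stateSpace N) :
    queueSemigroup hlam N t f q = truncSemigroup lam N N t f q := by
  refine tendsto_nhds_unique (tendsto_truncSemigroup_queueSemigroup_apply hlam N t f q)
    (tendsto_const_nhds.congr' ?_)
  filter_upwards [eventually_ge_atTop N] with m hm
  exact (truncSemigroup_apply_eq hlam hN hm t f hq).symm

theorem queueSemigroup_le_of_jumpOp_pow_le (hlam : 0 < lam) (hN : 1 ≤ N) (t : ℝ≥0) {f : Observable}
    {q : QueueState} (hq : q ∈ stateSpace N) {c : ℝ} (h : ∀ n, (jumpOp lam N N ^ n) f q ≤ c) :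
    queueSemigroup hlam N t f q ≤ c := by
  rw [queueSemigroup_eq_truncSemigroup hlam hN t f hq]
  exact truncSemigroup_le_const t h

/-- The integral of bounded continuous functions, as a continuous linear map. -/
noncomputable def integralFunctional (μ : Measure QueueState) [IsProbabilityMeasure μ] :
    Observable →L[ℝ] ℝ :=
  LinearMap.mkContinuous
    { toFun := fun f => ∫ q, f q ∂μ
      map_add' := fun f g => integral_add (f.integrable μ) (g.integrable μ)
      map_smul' := fun c f => integral_const_mul c f } 1 fun f => by
    simpa using norm_integral_le_of_norm_le_const (μ := μ)
      (Eventually.of_forall fun q => f.norm_coe_le_norm q)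

theorem integralFunctional_apply (μ : Measure QueueState) [IsProbabilityMeasure μ]
    (f : Observable) : integralFunctional μ f = ∫ q, f q ∂μ := rfl

/-- Stationarity makes the mean constant in time; its derivative at time `0` is the mean of the
generator, which therefore vanishes. -/
theorem IsStationaryDistribution.integral_jumpOp (hlam : 0 < lam) (hN : 1 ≤ N)
    {μ : Measure QueueState} (hμ : IsStationaryDistribution lam N μ) (f : Observable) :
    ∫ q, jumpOp lam N N f q ∂μ = ∫ q, f q ∂μ := by
  have := hμ.isProbabilityMeasure
  let G := generatorOp lam N N
  have hder : HasDerivAt (fun u : ℝ => integralFunctional μ (NormedSpace.exp (u • G) f))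
      (integralFunctional μ (G f)) 0 := by
    have h1 := hasDerivAt_exp_smul_const (𝕂 := ℝ) G 0
    rw [zero_smul, NormedSpace.exp_zero, one_mul] at h1
    let ev : EndOp Observable →L[ℝ] ℝ :=
      (integralFunctional μ).comp (ContinuousLinearMap.apply ℝ Observable f)
    exact ev.hasFDerivAt.comp_hasDerivAt (0 : ℝ) h1
  have hconst : ∀ u : ℝ, 0 ≤ u →
      integralFunctional μ (NormedSpace.exp (u • G) f) = integralFunctional μ f := by
    intro u hu
    lift u to ℝ≥0 using hu
    rw [← truncSemigroup_eq_exp, integralFunctional_apply, integralFunctional_apply,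
      ← hμ.integral_queueSemigroup hlam u f]
    refine integral_congr_ae ?_
    filter_upwards [hμ.ae_mem_stateSpace] with q hq
    exact (queueSemigroup_eq_truncSemigroup hlam hN u f hq).symm
  have hzero : integralFunctional μ (G f) = 0 := by
    -- The mean is known to be constant for nonnegative times only, so the one-sided derivative is
    -- used.
    refine (uniqueDiffWithinAt_Ici (0 : ℝ)).eq_deriv _ hder.hasDerivWithinAt ?_
    exact (hasDerivWithinAt_const (0 : ℝ) (Set.Ici 0) (integralFunctional μ f)).congr
      (fun u hu => hconst u hu) (hconst 0 le_rfl)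
  have hG : G f = totalRate lam N • (jumpOp lam N N f - f) := rfl
  rw [hG, map_smul, map_sub, smul_eq_mul, mul_eq_zero] at hzero
  exact sub_eq_zero.1 (hzero.resolve_left (totalRate_pos hlam N).ne')

/-- The law after one step of the jump chain, when `μ` is the law before. -/
noncomputable def stepMeasure (lam : ℝ≥0) (N : ℕ) (μ : Measure QueueState) : Measure QueueState :=
  (lam + N : ℝ≥0)⁻¹ • (lam • μ.map (afterTick N none) +
    ∑ i ∈ Finset.range N, μ.map (afterTick N (some i)))

theorem stepMeasure_apply (μ : Measure QueueState) {s : Set QueueState} (hs : MeasurableSet s) :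
    stepMeasure lam N μ s = (lam + N : ℝ≥0)⁻¹ • (lam • μ (afterTick N none ⁻¹' s) +
      ∑ i ∈ Finset.range N, μ (afterTick N (some i) ⁻¹' s)) := by
  simp only [stepMeasure, Measure.smul_apply, Measure.add_apply, Measure.finsetSum_apply,
    Measure.map_apply (measurable_afterTick N _) hs]

theorem stepMeasure_univ (hlam : 0 < lam) (μ : Measure QueueState) :
    stepMeasure lam N μ Set.univ = μ Set.univ := by
  rw [stepMeasure_apply μ .univ]
  simp only [Set.preimage_univ, Finset.sum_const, Finset.card_range]
  have h : (lam + N : ℝ≥0) ≠ 0 := by positivity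
  rw [← Nat.cast_smul_eq_nsmul ℝ≥0, ← add_smul, smul_smul, inv_mul_cancel₀ h, one_smul]

theorem stepMeasure_mono {μ ρ : Measure QueueState} (h : μ ≤ ρ) :
    stepMeasure lam N μ ≤ stepMeasure lam N ρ := by
  refine Measure.le_iff.2 fun s hs => ?_
  rw [stepMeasure_apply μ hs, stepMeasure_apply ρ hs]
  gcongr

theorem stepMeasure_add (μ ρ : Measure QueueState) :
    stepMeasure lam N (μ + ρ) = stepMeasure lam N μ + stepMeasure lam N ρ := by
  refine Measure.ext fun s hs => ?_
  rw [Measure.add_apply, stepMeasure_apply _ hs, stepMeasure_apply _ hs, stepMeasure_apply _ hs]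
  simp only [Measure.add_apply, Finset.sum_add_distrib, smul_add]
  abel

theorem stepMeasure_eq_of_integral_jumpOp {μ : Measure QueueState} [IsProbabilityMeasure μ]
    (hlam : 0 < lam)
    (h : ∀ f : Observable, ∫ q, jumpOp lam N N f q ∂μ = ∫ q, f q ∂μ) : stepMeasure lam N μ = μ := by
  have : IsProbabilityMeasure (stepMeasure lam N μ) := ⟨by rw [stepMeasure_univ hlam, measure_univ]⟩
  refine ext_of_forall_integral_eq_of_IsFiniteMeasure fun f => ?_
  rw [← h f]
  have hm : ∀ e, ∫ q, f q ∂(μ.map (afterTick N e)) = ∫ q, f (afterTick N e q) ∂μ := fun e =>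
    integral_map (measurable_afterTick N e).aemeasurable
      f.continuous.measurable.aestronglyMeasurable
  have hi : ∀ e, Integrable (fun q => f (afterTick N e q)) μ := fun e => (tickOp N e f).integrable μ
  have hi' : ∀ e, Integrable f (μ.map (afterTick N e)) := fun e =>
    have := Measure.isProbabilityMeasure_map (μ := μ) (measurable_afterTick N e).aemeasurable
    f.integrable _
  rw [stepMeasure, integral_smul_nnreal_measure, integral_add_measure ((hi' none).smul_measure_nnreal)
    (integrable_finsetSum_measure.2 fun i _ => hi' (some i)), integral_smul_nnreal_measure,
    integral_finsetSum_measure fun i _ => hi' (some i)]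
  simp_rw [jumpOp_apply, hm]
  rw [integral_const_mul, integral_add ((hi none).const_mul _)
    (integrable_finsetSum _ fun i _ => hi (some i)), integral_const_mul,
    integral_finsetSum _ fun i _ => hi (some i)]
  simp [totalRate, NNReal.smul_def, mul_add]

theorem measure_preimage_afterTick_eq_zero (hlam : 0 < lam) {ρ : Measure QueueState}
    (hρ : stepMeasure lam N ρ = ρ) {s : Set QueueState} (hs : MeasurableSet s) (h0 : ρ s = 0)
    (i : Fin N) : ρ (afterTick N (some i) ⁻¹' s) = 0 := by
  have h : (lam + N : ℝ≥0) ≠ 0 := by positivity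
  rw [← hρ, stepMeasure_apply ρ hs, smul_eq_zero, add_eq_zero] at h0
  have h1 := (h0.resolve_left (inv_ne_zero h)).2
  exact (Finset.sum_eq_zero_iff.1 h1) i (Finset.mem_range.2 i.2)

/-- An invariant measure that does not charge `0` does not charge its preimage under any finite word
of services. There are countably many words, and every configuration of the state space reaches `0`
by one of them. -/
theorem eq_zero_of_measure_singleton_zero (hlam : 0 < lam) (hN : 1 ≤ N) {ρ : Measure QueueState}
    (hρ : stepMeasure lam N ρ = ρ) (hS : ∀ᵐ q ∂ρ, q ∈ stateSpace N) (h0 : ρ {0} = 0) : ρ = 0 := by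
  let F : List (Fin N) → QueueState → QueueState := fun w q =>
    w.foldr (fun i q => afterTick N (some i) q) q
  have hw : ∀ w : List (Fin N), MeasurableSet (F w ⁻¹' {0}) ∧ ρ (F w ⁻¹' {0}) = 0 := by
    intro w
    induction w using List.reverseRecOn with
    | nil => exact ⟨measurableSet_singleton 0, h0⟩
    | append_singleton w i ih =>
      have : F (w ++ [i]) ⁻¹' {0} = afterTick N (some i) ⁻¹' (F w ⁻¹' {0}) := by
        ext q; simp [F]
      rw [this]
      exact ⟨measurable_afterTick N _ ih.1, measure_preimage_afterTick_eq_zero hlam hρ ih.1 ih.2 i⟩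
  rw [← Measure.measure_univ_eq_zero]
  have hall : ∀ᵐ q ∂ρ, ∀ w, q ∉ F w ⁻¹' {0} := ae_all_iff.2 fun w => measure_eq_zero_iff_ae_notMem.1 (hw w).2
  have hF : ∀ᵐ _ ∂ρ, False := by
    filter_upwards [hS, hall] with q hq hq'
    obtain ⟨w, hw⟩ := exists_ticks_eq_zero hN hq
    exact hq' w hw
  simpa [ae_iff] using hF

/-- The infimum `m` of the two laws is mapped below itself and keeps its mass, so it is invariant.
If the laws differ, the two remainders above `m` are nonzero and invariant, so both charge `0`;
adding the smaller of these masses at `0` to `m` contradicts that `m` is the infimum. -/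
theorem eq_of_stepMeasure_eq (hlam : 0 < lam) (hN : 1 ≤ N) {μ π : Measure QueueState}
    [IsProbabilityMeasure μ] [IsProbabilityMeasure π] (hμ : stepMeasure lam N μ = μ)
    (hπ : stepMeasure lam N π = π) (hμS : ∀ᵐ q ∂μ, q ∈ stateSpace N)
    (hπS : ∀ᵐ q ∂π, q ∈ stateSpace N) : μ = π := by
  have hmμ : μ ⊓ π ≤ μ := inf_le_left
  have hmπ : μ ⊓ π ≤ π := inf_le_right
  set m := μ ⊓ π with hm
  have : IsFiniteMeasure m := isFiniteMeasure_of_le μ hmμ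
  have hstep : stepMeasure lam N m = m := by
    have : IsFiniteMeasure (stepMeasure lam N m) :=
      ⟨by rw [stepMeasure_univ hlam]; exact measure_lt_top m _⟩
    refine Measure.eq_of_le_of_measure_univ_eq ?_ (stepMeasure_univ hlam m)
    exact le_inf ((stepMeasure_mono hmμ).trans_eq hμ) ((stepMeasure_mono hmπ).trans_eq hπ)
  have hdiff : ∀ ρ : Measure QueueState, IsProbabilityMeasure ρ → m ≤ ρ → stepMeasure lam N ρ = ρ →
      (∀ᵐ q ∂ρ, q ∈ stateSpace N) → m ≠ ρ → (ρ - m) {0} ≠ 0 := by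
    intro ρ _ hmρ hρ hρS hne h0
    have hadd : ρ - m + m = ρ := Measure.sub_add_cancel_of_le hmρ
    have h1 : stepMeasure lam N (ρ - m) = ρ - m := by
      have h2 := hρ
      rw [← hadd, stepMeasure_add, hstep] at h2
      refine Measure.ext fun s _ => ?_
      have h3 := congrArg (fun κ : Measure QueueState => κ s) h2
      simp only [Measure.add_apply] at h3
      exact (ENNReal.add_left_inj (measure_ne_top m s)).1 h3
    have h2 := eq_zero_of_measure_singleton_zero hlam hN h1
      (ae_mono Measure.sub_le hρS) h0
    rw [h2, zero_add] at hadd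
    exact hne hadd
  by_contra hne
  have hneμ : m ≠ μ := fun h => hne (Measure.eq_of_le_of_measure_univ_eq (h ▸ hmπ) (by simp))
  have hneπ : m ≠ π := fun h => hne (Measure.eq_of_le_of_measure_univ_eq (h ▸ hmμ) (by simp)).symm
  have h1 := hdiff μ inferInstance hmμ hμ hμS hneμ
  have h2 := hdiff π inferInstance hmπ hπ hπS hneπ
  let c := min ((μ - m) {0}) ((π - m) {0})
  have hc : c ≠ 0 := by simp [c, h1, h2]
  have hle : ∀ ρ : Measure QueueState, m ≤ ρ → c ≤ (ρ - m) {0} →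
      m + c • Measure.dirac 0 ≤ ρ := by
    intro ρ hmρ hcρ
    have hd : c • Measure.dirac 0 ≤ ρ - m := by
      refine Measure.le_iff.2 fun s hs => ?_
      rw [Measure.smul_apply, Measure.dirac_apply' _ hs, smul_eq_mul]
      by_cases h : (0 : QueueState) ∈ s
      · rw [Set.indicator_of_mem h, Pi.one_apply, mul_one]
        exact hcρ.trans (measure_mono (Set.singleton_subset_iff.2 h))
      · rw [Set.indicator_of_notMem h, mul_zero]
        exact zero_le
    calc m + c • Measure.dirac 0 ≤ m + (ρ - m) := by gcongr
      _ = ρ := by rw [add_comm]; exact Measure.sub_add_cancel_of_le hmρ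
  have h3 : m + c • Measure.dirac 0 ≤ m :=
    le_inf (hle μ hmμ (min_le_left _ _)) (hle π hmπ (min_le_right _ _))
  have h4 := h3 {0}
  rw [Measure.add_apply, Measure.smul_apply, Measure.dirac_apply' _ (measurableSet_singleton 0),
    Set.indicator_of_mem (Set.mem_singleton 0), Pi.one_apply, smul_eq_mul, mul_one] at h4
  exact hc (by simpa using (ENNReal.le_sub_of_add_le_left (measure_ne_top m _) h4))

end FiniteSystem

/-! ### No escape of mass in subcritical finite systems -/

section Tightness

variable {lam : ℝ≥0} {N : ℕ}

/-- The indicator of the event that the queue number `j` has at least `a` customers. -/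
noncomputable def levelObservable (j a : ℕ) : Observable :=
  BoundedContinuousFunction.indicator _ (isClopen_natCast_le_apply j a)

theorem levelObservable_apply (j a : ℕ) (q : QueueState) :
    levelObservable j a q = Set.indicator {q : QueueState | (a : ℕ∞) ≤ q j} 1 q := rfl

theorem monotone_levelObservable (j a : ℕ) : Monotone (levelObservable j a) :=
  monotone_indicator _ fun _ _ h h' => le_trans h' (h j)

theorem integral_levelObservable (μ : Measure QueueState) (j a : ℕ) :
    ∫ q, levelObservable j a q ∂μ = μ.real {q | (a : ℕ∞) ≤ q j} :=
  integral_indicator_isClopen μ _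

/-- The minimum of `b` and the length of the queue number `j`. -/
noncomputable def cappedLength (j b : ℕ) : Observable :=
  ∑ a ∈ Finset.range b, levelObservable j (a + 1)

theorem cappedLength_apply (j b : ℕ) (q : QueueState) :
    cappedLength j b q = ∑ a ∈ Finset.range b, levelObservable j (a + 1) q := by
  simp [cappedLength]

theorem monotone_cappedLength (j b : ℕ) : Monotone (cappedLength j b) := fun q q' h => by
  rw [cappedLength_apply, cappedLength_apply]
  exact Finset.sum_le_sum fun a _ => monotone_levelObservable j (a + 1) h

theorem cappedLength_le_queueLength {q : QueueState} (hq : q ∈ stateSpace N) (j b : ℕ) :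
    cappedLength j b q ≤ queueLength q j := by
  rw [cappedLength_apply, queueLength]
  obtain ⟨x, hx⟩ := ENat.ne_top_iff_exists.1 (hq (ENat.natCast_ne_top N) j).1
  have h : ∀ a, levelObservable j (a + 1) q = if a < x then 1 else 0 := fun a => by
    rw [levelObservable_apply, Set.indicator_apply]
    simp only [Set.mem_ofPred_eq, ← hx, Nat.cast_le, Nat.succ_le_iff, Pi.one_apply]
  simp_rw [h, ← hx, ENat.toNat_natCast]
  rw [Finset.sum_ite, Finset.sum_const_zero, add_zero, Finset.sum_const, nsmul_eq_mul, mul_one,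
    Nat.cast_le]
  refine (Finset.card_le_card (t := Finset.range x) fun a ha => ?_).trans_eq (Finset.card_range x)
  exact Finset.mem_range.2 (Finset.mem_filter.1 ha).2

theorem jumpOp_pow_apply_zero_mono (hlam : 0 < lam) (N : ℕ∞) (m : ℕ) {f : Observable}
    (hf : Monotone f) : Monotone fun n => (jumpOp lam N m ^ n) f 0 := by
  refine monotone_nat_of_le_succ fun n => ?_
  rw [jumpOp_pow_succ_apply]
  have h := le_jumpOp_pow hlam N m (f := (jumpOp lam N m ^ n) f)
    (fun q => monotone_jumpOp_pow N m hf n (show (0 : QueueState) ≤ q from fun _ => zero_le)) 1 0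
  rwa [pow_one] at h

/-- If some `u n` exceeded `c`, monotonicity would eventually push the averages above `c`. -/
theorem le_of_average_le {u : ℕ → ℝ} (hu : Monotone u) {c : ℝ}
    (h : ∀ n : ℕ, ∑ k ∈ Finset.range n, u k ≤ n * c) (n : ℕ) : u n ≤ c := by
  by_contra! hc
  obtain ⟨m, hm⟩ := exists_nat_gt (n * (c - u 0) / (u n - c))
  rw [div_lt_iff₀ (sub_pos.2 hc)] at hm
  have h1 := h (n + m)
  rw [Finset.sum_range_add] at h1
  have h2 : (n : ℝ) * u 0 ≤ ∑ k ∈ Finset.range n, u k := by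
    simpa using Finset.card_nsmul_le_sum (Finset.range n) u (u 0) fun k _ => hu (Nat.zero_le k)
  have h3 : (m : ℝ) * u n ≤ ∑ k ∈ Finset.range m, u (n + k) := by
    simpa using Finset.card_nsmul_le_sum (Finset.range m) (fun k => u (n + k)) (u n)
      fun k _ => hu (Nat.le_add_right n k)
  push_cast at h1
  linarith

/-- Capping makes the queue length an observable, and monotonicity along the chain turns the
averaged bound into one for every step. The bound does not depend on the cap `b`. -/
theorem jumpOp_pow_cappedLength_le (hlam : 0 < lam) (hlam1 : lam < 1) (hN : 1 ≤ N) {j : ℕ}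
    (hj : j < N) (b n : ℕ) :
    (jumpOp lam N N ^ n) (cappedLength j b) 0 ≤ (lam + 2 * N) / (2 * (1 - lam)) := by
  have h1 : (lam : ℝ) < 1 := by exact_mod_cast hlam1
  refine le_of_average_le (jumpOp_pow_apply_zero_mono hlam N N (monotone_cappedLength j b))
    (fun n => ?_) n
  have h := sum_averageMap_pow_queueLength_le hlam hlam1 hN hj n
  rw [← mul_div_assoc, le_div_iff₀ (by linarith), mul_comm]
  refine le_trans (mul_le_mul_of_nonneg_left (Finset.sum_le_sum fun k _ => ?_) (by linarith)) h
  rw [jumpOp_pow_eq_averageMap_pow]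
  exact averageMap_pow_mono hN (fun q hq => cappedLength_le_queueLength hq j b) k
    (zero_mem_stateSpace N)

variable {hlam : 0 < lam} {π : ProbabilityMeasure QueueState}

theorem IsLowerLaw.measure_eq_top (hπ : IsLowerLaw hlam N π) (hlam1 : lam < 1) (hN : 1 ≤ N) {j : ℕ}
    (hj : j < N) : (π : Measure QueueState) {q | q j = ⊤} = 0 := by
  set c : ℝ := (lam + 2 * N) / (2 * (1 - lam))
  -- An infinite queue has capped length `b` for every `b`, while the mean stays below `c`.
  have hb : ∀ b : ℕ, b * (π : Measure QueueState).real {q | q j = ⊤} ≤ c := by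
    intro b
    have h1 : ∫ q, cappedLength j b q ∂(π : Measure QueueState) ≤ c :=
      le_of_tendsto' (hπ (cappedLength j b)) fun t =>
        queueSemigroup_le_of_jumpOp_pow_le hlam hN t (zero_mem_stateSpace N)
          fun n => jumpOp_pow_cappedLength_le hlam hlam1 hN hj b n
    simp_rw [cappedLength_apply] at h1
    rw [integral_finsetSum _ fun a _ => (levelObservable j (a + 1)).integrable _] at h1
    refine le_trans ?_ h1
    have h2 := Finset.card_nsmul_le_sum (Finset.range b)
      (fun a => ∫ q, levelObservable j (a + 1) q ∂(π : Measure QueueState))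
      ((π : Measure QueueState).real {q | q j = ⊤}) fun a _ => by
        rw [integral_levelObservable]
        refine measureReal_mono fun q hq => ?_
        simp only [Set.mem_ofPred_eq] at hq ⊢
        rw [hq]
        exact le_top
    simpa using h2
  rw [← measureReal_eq_zero_iff]
  by_contra hne
  have hpos := lt_of_le_of_ne measureReal_nonneg (Ne.symm hne)
  obtain ⟨b, hb'⟩ := exists_nat_gt (c / (π : Measure QueueState).real {q | q j = ⊤})
  rw [div_lt_iff₀ hpos] at hb'
  exact (hb b).not_gt hb'

theorem IsLowerLaw.measure_one_le (hπ : IsLowerLaw hlam N π) (hN : 1 ≤ N) {j : ℕ}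
    (hj : N ≤ j) : (π : Measure QueueState) {q | ((1 : ℕ) : ℕ∞) ≤ q j} = 0 := by
  rw [← measureReal_eq_zero_iff, ← integral_levelObservable]
  have hzero : ∀ n, (jumpOp lam N N ^ n) (levelObservable j 1) 0 ≤ 0 := by
    intro n
    rw [jumpOp_pow_eq_averageMap_pow, ← averageMap_pow_const (N := N) hlam n 0 0]
    refine averageMap_pow_mono hN (fun q hq => ?_) n (zero_mem_stateSpace N)
    have : q j = 0 := (hq (ENat.natCast_ne_top N) j).2 (by exact_mod_cast hj)
    simp [levelObservable_apply, this]
  refine le_antisymm (le_of_tendsto' (hπ _) fun t =>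
    queueSemigroup_le_of_jumpOp_pow_le hlam hN t (zero_mem_stateSpace N) hzero) ?_
  rw [integral_levelObservable]
  exact measureReal_nonneg

theorem IsLowerLaw.ae_mem_stateSpace (hπ : IsLowerLaw hlam N π) (hlam1 : lam < 1) (hN : 1 ≤ N) :
    ∀ᵐ q ∂(π : Measure QueueState), q ∈ stateSpace N := by
  have h1 : ∀ᵐ q ∂(π : Measure QueueState), ∀ j < N, q j ≠ ⊤ :=
    ae_all_iff.2 fun j => ae_all_iff.2 fun hj =>
      measure_eq_zero_iff_ae_notMem.1 (hπ.measure_eq_top hlam1 hN hj)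
  have h2 : ∀ᵐ q ∂(π : Measure QueueState), ∀ j, N ≤ j → ¬ ((1 : ℕ) : ℕ∞) ≤ q j :=
    ae_all_iff.2 fun j => ae_all_iff.2 fun hj =>
      measure_eq_zero_iff_ae_notMem.1 (hπ.measure_one_le hN hj)
  filter_upwards [h1, h2] with q h1 h2 _ i
  have hz : N ≤ i → q i = 0 := fun hi => by
    have := h2 i hi
    rwa [Nat.cast_one, Order.one_le_iff_ne_zero, not_not] at this
  refine ⟨?_, fun hi => hz (by exact_mod_cast hi)⟩
  rcases lt_or_ge i N with hi | hi
  · exact h1 i hi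
  · rw [hz hi]
    exact ENat.zero_ne_top

theorem IsLowerLaw.isStationaryDistribution_iff (hπ : IsLowerLaw hlam N π) (hlam1 : lam < 1)
    (hN : 1 ≤ N) (μ : Measure QueueState) :
    IsStationaryDistribution lam N μ ↔ μ = (π : Measure QueueState) := by
  have hstat := hπ.isStationaryDistribution (hπ.ae_mem_stateSpace hlam1 hN)
  refine ⟨fun hμ => ?_, fun h => h ▸ hstat⟩
  have := hμ.isProbabilityMeasure
  exact eq_of_stepMeasure_eq hlam hN
    (stepMeasure_eq_of_integral_jumpOp hlam (hμ.integral_jumpOp hlam hN))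
    (stepMeasure_eq_of_integral_jumpOp hlam (hstat.integral_jumpOp hlam hN))
    hμ.ae_mem_stateSpace hstat.ae_mem_stateSpace

end Tightness

/-! ### The main theorem -/

theorem proposition2 (lam : ℝ≥0) (hlam : 0 < lam) :
    -- (i) one coupling of all the systems that is monotone in the number of sites
    (∃ (Ω : Type) (_ : MeasurableSpace Ω) (P : Measure Ω) (X : ℕ∞ → ℝ≥0 → Ω → QueueState),
      IsProbabilityMeasure P ∧
      (∀ N : ℕ∞, 1 ≤ N → IsBackPressureFromZero lam N P (X N)) ∧
      ∀ᵐ ω ∂P, ∀ t : ℝ≥0, ∀ M N : ℕ∞, 1 ≤ M → M ≤ N →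
        X M t ω ≤ X N t ω ∧ TailLE (X M t ω) (X N t ω)) ∧
    -- (ii) stochastic monotonicity in time and in the number of sites
    (∀ (Ω Ω' : Type u) [MeasurableSpace Ω] [MeasurableSpace Ω']
      (P : Measure Ω) (P' : Measure Ω') [IsProbabilityMeasure P] [IsProbabilityMeasure P']
      (M N : ℕ∞) (Q : ℝ≥0 → Ω → QueueState) (Q' : ℝ≥0 → Ω' → QueueState),
      1 ≤ M → M ≤ N → IsBackPressureFromZero lam M P Q → IsBackPressureFromZero lam N P' Q' →
      ∀ s t : ℝ≥0, s ≤ t → StochLE (P.map (Q s)) (P'.map (Q' t))) ∧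
    ∃ ν : ProbabilityMeasure QueueState,
      -- (iii) convergence of the infinite system as time grows
      (∀ (Ω : Type u) [MeasurableSpace Ω] (P : Measure Ω) [IsProbabilityMeasure P]
        (Q : ℝ≥0 → Ω → QueueState), IsBackPressureFromZero lam ⊤ P Q →
        TendstoInDistribution Q atTop (id : QueueState → QueueState) (fun _ => P)
          (ν : Measure QueueState)) ∧
      -- (iii) the stationary distributions of the finite systems, and their limit
      (lam < 1 → ∃ π : ℕ → ProbabilityMeasure QueueState,
        (∀ N : ℕ, 1 ≤ N →
          (∀ μ : Measure QueueState,
            IsStationaryDistribution lam N μ ↔ μ = (π N : Measure QueueState)) ∧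
          (∀ (Ω : Type u) [MeasurableSpace Ω] (P : Measure Ω) [IsProbabilityMeasure P]
            (Q : ℝ≥0 → Ω → QueueState), IsBackPressureFromZero lam N P Q →
            TendstoInDistribution Q atTop (id : QueueState → QueueState) (fun _ => P)
              (π N : Measure QueueState))) ∧
        (∀ M N : ℕ, 1 ≤ M → M ≤ N →
          StochLE (π M : Measure QueueState) (π N : Measure QueueState)) ∧
        Tendsto π atTop (𝓝 ν)) ∧
      -- (iv) the limit is the lower invariant measure of the infinite system
      IsStationaryDistribution lam ⊤ (ν : Measure QueueState) ∧
      (∀ μ : Measure QueueState, IsStationaryDistribution lam ⊤ μ →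
        StochLE (ν : Measure QueueState) μ) ∧
      -- (v) the bound on the downstream queues, at all times and in the limit
      (∀ (Ω : Type u) [MeasurableSpace Ω] (P : Measure Ω) [IsProbabilityMeasure P]
        (Q : ℝ≥0 → Ω → QueueState), IsBackPressureFromZero lam ⊤ P Q →
        ∀ᵐ ω ∂P, ∀ t : ℝ≥0, BoundedTail (Q t ω)) ∧
      ∀ᵐ q ∂(ν : Measure QueueState), BoundedTail q := by
  have h : ∀ N : ℕ∞, ∃ ν : ProbabilityMeasure QueueState, IsLowerLaw hlam N ν :=
    exists_isLowerLaw hlam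
  choose law hlaw using h
  refine ⟨?_, ?_, law ⊤, ?_, fun hlam1 => ⟨fun N => law N, fun N hN => ⟨?_, ?_⟩, ?_, ?_⟩, ?_, ?_,
    ?_, ?_⟩
  · obtain ⟨Ω, m, P, X, hP, hX, h⟩ := exists_monotone_coupling lam
    exact ⟨Ω, m, P, X, hP, fun N _ => hX N, h.mono fun ω hω t M N _ hMN => hω t M N hMN⟩
  · intro Ω Ω' _ _ P P' _ _ M N Q Q' _ hMN hQ hQ' s t hst
    exact stochLE_of_fromZero hlam hMN hQ hQ' hst
  · intro Ω _ P _ Q hQ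
    exact (hlaw ⊤).tendstoInDistribution hQ
  · exact (hlaw N).isStationaryDistribution_iff hlam1 hN
  · intro Ω _ P _ Q hQ
    exact (hlaw N).tendstoInDistribution hQ
  · intro M N _ hMN
    exact (hlaw M).stochLE_of_le (hlaw N) (by exact_mod_cast hMN)
  · exact tendsto_of_isLowerLaw (hlaw ⊤) fun N => hlaw N
  -- For `N = ⊤` the state space is everything, so no tightness is required and `lam` may be at
  -- least `1`.
  · exact (hlaw ⊤).isStationaryDistribution (Eventually.of_forall fun q h => absurd rfl h)
  · intro μ hμ
    exact (hlaw ⊤).stochLE hμ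
  · intro Ω _ P _ Q hQ
    exact hQ.boundedTail
  · exact (hlaw ⊤).ae_boundedTail
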